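/- Let $i\neq 0$ be a fixed \emph{real} number, let $X,Y,P,\Phi\subset\mathbb R$ be non-empty open intervals, and let $Q=Q(x,y,p)$ be a smooth function on $J=X\times Y\times P$ (it defines the equation $y''=Q(x,y,y')$). Put $$D=\partial_x+p\,\partial_y+Q\,\partial_p,\qquad w_2=Q_{pppp},$$ $$w_1=D^2Q_{pp}-4DQ_{py}-Q_p\,DQ_{pp}+4Q_pQ_{py}-3Q_{pp}Q_y+6Q_{yy}.$$ For a smooth nowhere vanishing function $\rho=\rho(x,y,p,\phi)$ on $M=J\times\Phi$ let $$g_F=2\rho^2\Big[(dp-Q\,dx)\,dx-(dy-p\,dx)\Big(\tfrac23 i\,d\phi+\tfrac23Q_p\,dx+\tfrac16Q_{pp}(dy-p\,dx)\Big)\Big]$$ be the corresponding Fefferman metric; as $\rho$ varies, these are exactly the metrics of the Fefferman conformal class of the equation. Call $g_F$ \emph{Einstein} if $Ric(g_F)=\Lambda g_F$ on $M$ for some constant $\Lambda\in\mathbb R$, and \emph{conformally flat} if every point of $M$ has a neighbourhood on which $e^{2u}g_F$ has vanishing Riemann tensor for some smooth function $u$. Then the following hold. 1. If $g_F$ is Einstein,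 then on $M$ $$(3\rho_\phi-i\rho)\,w_2=0\quad\text{and}\quad(3\rho_\phi+i\rho)\,w_1=0,$$ and one of the following three cases occurs: ($\bullet$) $w_1=w_2=0$ identically; ($\bullet\bullet$) $w_2=0$ identically, $w_1$ is not identically zero, and $\rho=A(x,y,p)\,e^{-i\phi/3}$; ($\bullet\bullet\bullet$) $w_1=0$ identically, $w_2$ is not identically zero, and $\rho=A(x,y,p)\,e^{i\phi/3}$, with $A$ smooth on $J$. 2. If $w_1=w_2=0$ identically, then $g_F$ is conformally flat for every $\rho$. 3. (a) $g_F$ is Einstein, $\rho$ is of the form $A(x,y,p)e^{-i\phi/3}$ and $\rho_p$ vanishes nowhere on $M$ if and only if there are smooth functions $a,b,c$ of $(x,y)\in X\times Y$ and a sign $\varepsilon=\pm1$ such that $p+2b\neq0$ on $J$, $$\rho=\varepsilon\,\frac{e^{-\frac23a}}{p+2b}\,e^{-\frac{i\phi}{3}},$$ $$Q=p^3c+p^2(6bc-2a_y)+p(12b^2c-3b_y-6ba_y-a_x)+8b^3c-2bb_y-4b^2a_y-2b_x-2ba_x.$$ (b) $g_F$ is Einstein, $\rho$ is of the form $A(x,y,p)e^{-i\phi/3}$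 and $\rho_p=0$ identically on $M$ if and only if there are smooth functions $a,b$ of $(x,y)\in X\times Y$ and a sign $\varepsilon=\pm1$ such that $$\rho=\varepsilon\,e^{-\frac23a}\,e^{-\frac{i\phi}{3}},\qquad Q=p^2a_y+2pa_x+b.$$ (Since $M$ is an arbitrary product of intervals, (a) and (b) describe all solutions with $\rho=Ae^{-i\phi/3}$ near the points of an open dense set.) 4. $g_F$ is Einstein and $\rho$ is of the form $A(x,y,p)e^{i\phi/3}$ if and only if $\rho=a\,e^{i\phi/3}$ for a smooth function $a=a(x,y)$ on $X\times Y$ satisfying on $J$ the single equation $$36(Da)^2+6a\,(-3D^2a+Q_p\,Da)+a^2\,(6DQ_p-18Q_y-4Q_p^2)=0.$$ If this equation has a smooth nowhere vanishing solution $a=a(x,y)$, then $w_1=0$ on $J$. 5. If $g_F$ is Einstein and either $\rho$ has one of the forms $A(x,y,p)e^{\mp i\phi/3}$ or $g_F$ is not conformally flat, then $g_F$ is Ricci flat. -/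

import Mathlib

open scoped ContDiff

noncomputable section

namespace Fefferman

/-! ### Pseudo-Riemannian geometry in a coordinate chart of `ℝⁿ` -/

/-- The partial derivative `∂f / ∂zᵏ`. -/
def pd {n : ℕ} (k : Fin n) (f : (Fin n → ℝ) → ℝ) (z : Fin n → ℝ) : ℝ :=
  fderiv ℝ f z (Pi.single k 1)

/-- The Christoffel symbol `Γᵃ_{bc}` of the Levi-Civita connection of the metric `g`,
given by its component matrix `g z` at each point `z`. -/
def christoffel {n : ℕ} (g : (Fin n → ℝ) → Matrix (Fin n) (Fin n) ℝ) (a b c : Fin n)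
    (z : Fin n → ℝ) : ℝ :=
  (1 / 2) * ∑ e, (g z)⁻¹ a e *
    (pd c (fun w => g w e b) z + pd b (fun w => g w e c) z - pd e (fun w => g w b c) z)

/-- The Riemann curvature tensor
`Rᵃ_{bcd} = ∂_c Γᵃ_{bd} - ∂_d Γᵃ_{bc} + Γᵃ_{ce} Γᵉ_{bd} - Γᵃ_{de} Γᵉ_{bc}`. -/
def riemann {n : ℕ} (g : (Fin n → ℝ) → Matrix (Fin n) (Fin n) ℝ) (a b c d : Fin n)
    (z : Fin n → ℝ) : ℝ :=
  pd c (christoffel g a b d) z - pd d (christoffel g a b c) z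
    + ∑ e, (christoffel g a c e z * christoffel g e b d z
        - christoffel g a d e z * christoffel g e b c z)

/-- The Ricci tensor `Ric_{bd} = Rᵃ_{bad}`. -/
def ricci {n : ℕ} (g : (Fin n → ℝ) → Matrix (Fin n) (Fin n) ℝ) (b d : Fin n)
    (z : Fin n → ℝ) : ℝ :=
  ∑ a, riemann g a b a d z

/-- `Ric(g) = Λ g` on `U`, with cosmological constant `Λ`. -/
def EinsteinOn {n : ℕ} (g : (Fin n → ℝ) → Matrix (Fin n) (Fin n) ℝ) (Λ : ℝ)
    (U : Set (Fin n → ℝ)) : Prop :=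
  ∀ z ∈ U, ∀ b d, ricci g b d z = Λ * g z b d

/-- `Ric(g) = 0` on `U`. -/
def RicciFlatOn {n : ℕ} (g : (Fin n → ℝ) → Matrix (Fin n) (Fin n) ℝ)
    (U : Set (Fin n → ℝ)) : Prop :=
  ∀ z ∈ U, ∀ b d, ricci g b d z = 0

/-- `g` is conformally flat on `U`: near every point of `U` some smooth conformal rescaling
`e^{2u} g` has vanishing Riemann tensor. -/
def ConformallyFlatOn {n : ℕ} (g : (Fin n → ℝ) → Matrix (Fin n) (Fin n) ℝ)
    (U : Set (Fin n → ℝ)) : Prop :=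
  ∀ z ∈ U, ∃ V : Set (Fin n → ℝ), IsOpen V ∧ z ∈ V ∧ V ⊆ U ∧
    ∃ u : (Fin n → ℝ) → ℝ, ContDiffOn ℝ ∞ u V ∧
      ∀ w ∈ V, ∀ a b c d, riemann (fun v => Real.exp (2 * u v) • g v) a b c d w = 0

/-! ### Domains

Coordinates: `(x, y)` on the plane, `(x, y, p)` on the jet space `J¹`, and `(x, y, p, φ)` on the
four-dimensional space that carries the Fefferman metrics. -/

/-- The domain of `(x, y)`. -/
def planeBox (X Y : Set ℝ) : Set (Fin 2 → ℝ) := {z | z 0 ∈ X ∧ z 1 ∈ Y}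

/-- The domain of `(x, y, p)`. -/
def jetBox (X Y P : Set ℝ) : Set (Fin 3 → ℝ) := {z | z 0 ∈ X ∧ z 1 ∈ Y ∧ z 2 ∈ P}

/-- The domain of `(x, y, p, φ)`. -/
def fefBox (X Y P Φ : Set ℝ) : Set (Fin 4 → ℝ) :=
  {z | z 0 ∈ X ∧ z 1 ∈ Y ∧ z 2 ∈ P ∧ z 3 ∈ Φ}

/-- The projection `(x, y, p, φ) ↦ (x, y, p)`. -/
def toJet (z : Fin 4 → ℝ) : Fin 3 → ℝ := ![z 0, z 1, z 2]

/-- The projection `(x, y, p) ↦ (x, y)`. -/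
def toPlane (z : Fin 3 → ℝ) : Fin 2 → ℝ := ![z 0, z 1]

/-! ### The equation `y'' = Q(x, y, y')` and its relative invariants -/

/-- The total derivative `D = ∂_x + p ∂_y + Q ∂_p`. -/
def totalD (Q f : (Fin 3 → ℝ) → ℝ) (z : Fin 3 → ℝ) : ℝ :=
  pd 0 f z + z 2 * pd 1 f z + Q z * pd 2 f z

/-- `w₁ = D²Q_pp - 4 D Q_py - Q_p D Q_pp + 4 Q_p Q_py - 3 Q_pp Q_y + 6 Q_yy`. -/
def w₁ (Q : (Fin 3 → ℝ) → ℝ) (z : Fin 3 → ℝ) : ℝ :=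
  totalD Q (totalD Q (pd 2 (pd 2 Q))) z - 4 * totalD Q (pd 1 (pd 2 Q)) z
    - totalD Q (pd 2 (pd 2 Q)) z * pd 2 Q z + 4 * pd 2 Q z * pd 1 (pd 2 Q) z
    - 3 * pd 2 (pd 2 Q) z * pd 1 Q z + 6 * pd 1 (pd 1 Q) z

/-- `w₂ = Q_pppp`. -/
def w₂ (Q : (Fin 3 → ℝ) → ℝ) (z : Fin 3 → ℝ) : ℝ :=
  pd 2 (pd 2 (pd 2 (pd 2 Q))) z

/-! ### The Fefferman metrics

A one-form on the `(x, y, p, φ)`-space is given by its components in the basis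
`(dx, dy, dp, dφ)`. The parameter `i` is a non-zero real number. -/

/-- `θ¹ = ρ (dp - Q dx)`. -/
def θ₁ (Q : (Fin 3 → ℝ) → ℝ) (ρ : (Fin 4 → ℝ) → ℝ) (z : Fin 4 → ℝ) : Fin 4 → ℝ :=
  ρ z • ![-Q (toJet z), 0, 1, 0]

/-- `θ² = ρ dx`. -/
def θ₂ (ρ : (Fin 4 → ℝ) → ℝ) (z : Fin 4 → ℝ) : Fin 4 → ℝ :=
  ρ z • ![1, 0, 0, 0]

/-- `θ³ = -ρ² (dy - p dx)`. -/
def θ₃ (ρ : (Fin 4 → ℝ) → ℝ) (z : Fin 4 → ℝ) : Fin 4 → ℝ :=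
  (-(ρ z) ^ 2) • ![-z 2, 1, 0, 0]

/-- `θ⁴ = (2/3) i dφ + (2/3) Q_p dx + (1/6) Q_pp (dy - p dx)`. -/
def θ₄ (i : ℝ) (Q : (Fin 3 → ℝ) → ℝ) (z : Fin 4 → ℝ) : Fin 4 → ℝ :=
  (2 / 3 * i) • ![0, 0, 0, 1] + (2 / 3 * pd 2 Q (toJet z)) • ![1, 0, 0, 0]
    + (1 / 6 * pd 2 (pd 2 Q) (toJet z)) • ![-z 2, 1, 0, 0]

/-- The Fefferman metric `g_F = 2 θ¹ θ² + 2 θ³ θ⁴` (products are symmetrised tensor products,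
`αβ = (α ⊗ β + β ⊗ α) / 2`), that is,
`2ρ² [(dp - Q dx) dx - (dy - p dx)((2/3) i dφ + (2/3) Q_p dx + (1/6) Q_pp (dy - p dx))]`. -/
def gF (i : ℝ) (Q : (Fin 3 → ℝ) → ℝ) (ρ : (Fin 4 → ℝ) → ℝ) (z : Fin 4 → ℝ) :
    Matrix (Fin 4) (Fin 4) ℝ :=
  Matrix.of fun a b =>
    θ₁ Q ρ z a * θ₂ ρ z b + θ₂ ρ z a * θ₁ Q ρ z b
      + θ₃ ρ z a * θ₄ i Q z b + θ₄ i Q z a * θ₃ ρ z b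

/-! ### The two families of solutions -/

/-- `ρ = A(x, y, p) e^{κ φ}` on `fefBox X Y P Φ` with `A` smooth. -/
def HasPhase (X Y P Φ : Set ℝ) (κ : ℝ) (ρ : (Fin 4 → ℝ) → ℝ) : Prop :=
  ∃ A : (Fin 3 → ℝ) → ℝ, ContDiffOn ℝ ∞ A (jetBox X Y P) ∧
    ∀ z ∈ fefBox X Y P Φ, ρ z = A (toJet z) * Real.exp (κ * z 3)

/-- The first explicit family with `w₂ = 0`, with smooth `a, b, c` depending on `(x, y)` and a
sign `ε` (the metric depends on `ρ²` only):
`ρ = ε e^{-2a/3} / (p + 2b) · e^{-iφ/3}` and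
`Q = p³ c + p² (6bc - 2a_y) + p (12b²c - 3b_y - 6b a_y - a_x)
  + 8b³c - 2b b_y - 4b² a_y - 2b_x - 2b a_x`. -/
def IsFirstFamily (X Y P Φ : Set ℝ) (i : ℝ) (Q : (Fin 3 → ℝ) → ℝ) (ρ : (Fin 4 → ℝ) → ℝ) :
    Prop :=
  ∃ (ε : ℝ) (a b c : (Fin 2 → ℝ) → ℝ), (ε = 1 ∨ ε = -1) ∧
    ContDiffOn ℝ ∞ a (planeBox X Y) ∧ ContDiffOn ℝ ∞ b (planeBox X Y) ∧
    ContDiffOn ℝ ∞ c (planeBox X Y) ∧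
    (∀ z ∈ jetBox X Y P, z 2 + 2 * b (toPlane z) ≠ 0) ∧
    (∀ z ∈ fefBox X Y P Φ,
      ρ z = ε * (Real.exp (-(2 / 3) * a (toPlane (toJet z)))
        / (z 2 + 2 * b (toPlane (toJet z)))) * Real.exp (-(i * z 3 / 3))) ∧
    ∀ z ∈ jetBox X Y P,
      let q := toPlane z
      let p := z 2
      Q z = p ^ 3 * c q + p ^ 2 * (6 * b q * c q - 2 * pd 1 a q)
        + p * (12 * b q ^ 2 * c q - 3 * pd 1 b q - 6 * b q * pd 1 a q - pd 0 a q)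
        + 8 * b q ^ 3 * c q - 2 * b q * pd 1 b q - 4 * b q ^ 2 * pd 1 a q
        - 2 * pd 0 b q - 2 * b q * pd 0 a q

/-- The second explicit family with `w₂ = 0`, with smooth `a, b` depending on `(x, y)` and a
sign `ε`: `ρ = ε e^{-2a/3} e^{-iφ/3}` and `Q = p² a_y + 2p a_x + b`. -/
def IsSecondFamily (X Y P Φ : Set ℝ) (i : ℝ) (Q : (Fin 3 → ℝ) → ℝ) (ρ : (Fin 4 → ℝ) → ℝ) :
    Prop :=
  ∃ (ε : ℝ) (a b : (Fin 2 → ℝ) → ℝ), (ε = 1 ∨ ε = -1) ∧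
    ContDiffOn ℝ ∞ a (planeBox X Y) ∧ ContDiffOn ℝ ∞ b (planeBox X Y) ∧
    (∀ z ∈ fefBox X Y P Φ,
      ρ z = ε * Real.exp (-(2 / 3) * a (toPlane (toJet z))) * Real.exp (-(i * z 3 / 3))) ∧
    ∀ z ∈ jetBox X Y P,
      Q z = z 2 ^ 2 * pd 1 a (toPlane z) + 2 * z 2 * pd 0 a (toPlane z) + b (toPlane z)

/-- The equation
`36 (Da)² + 6a (-3 D²a + Q_p Da) + a² (6 D Q_p - 18 Q_y - 4 Q_p²) = 0` on `jetBox X Y P`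
for a function `a` of `(x, y)`. -/
def ScaleEquation (X Y P : Set ℝ) (Q : (Fin 3 → ℝ) → ℝ) (a : (Fin 2 → ℝ) → ℝ) : Prop :=
  ∀ z ∈ jetBox X Y P,
    let α : (Fin 3 → ℝ) → ℝ := fun v => a (toPlane v)
    36 * totalD Q α z ^ 2
      + 6 * α z * (-3 * totalD Q (totalD Q α) z + pd 2 Q z * totalD Q α z)
      + α z ^ 2 * (6 * totalD Q (pd 2 Q) z - 18 * pd 1 Q z - 4 * pd 2 Q z ^ 2) = 0

end Fefferman

end

/-! Put `s = 1/ρ` and `ψ = (2i/3)φ`. In the coordinates `(x, y, p, ψ)` the metric is `s⁻² g`, where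
`g` is the metric with `ρ = 1` and contains neither `i` nor `ρ`. The Einstein condition forces the
trace-free part of `∇∇s + s P` to vanish, `P` being the Schouten tensor of `g`. This is a linear
overdetermined system for `s`, and its components in the null coframe are written out as `E11`, ...,
`E44`.

The components 44 and 14 read `s_ψψ = s/4` and `s_pψ = s_p/2`. So `s` is the sum of a part `∼
e^{ψ/2}` (`plus`) and a part `∼ e^{-ψ/2}` (`minus`) that is independent of `p`. For `a = plus s`
what remains is `a_pp = 0`, `D a = Q_p a/3`; for `b = minus s` it is the single linear equation `L b
= 0` (`isPlus_isMinus`). The other components follow by applying `∂_p`, `∂_y` and `D`, and the same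
prolongation produces the integrability conditions `w₂ a = 0` and `w₁ b = 0`. The prolonged systems
are closed, so a solution whose value and first derivatives vanish at one point is zero. Hence `w₂ ≠
0` somewhere kills `a`, `w₁ ≠ 0` somewhere kills `b`, and both cannot happen because `s ≠ 0`: this
is the trichotomy.

A pure solution of either kind satisfies `∇∇s + s P = k g` with `|ds|² = 2sk`, and these two facts
cancel the scalar curvature of `s⁻² g`. This gives Ricci flatness and the converse implications at
once.

The Weyl tensor of `g` has only the components `w₁` and `w₂`. If both vanish, `Q` is cubic in `p`,
and `L b = 0` splits by powers of `p` into a linear total system for `(b, b_x, b_y)` whose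
integrability condition is `w₁ = 0`. A local solution with `b ≠ 0`, from a Frobenius theorem, gives
a scale whose metric is Ricci flat with zero Weyl tensor, hence flat.

The explicit families come from `a_pp = 0`: the scale is affine in `p`, and `D a = Q_p a/3` is then
a first order linear equation in `p` for `Q`. In the other case `L` is the quadratic equation for
`ρ` rewritten in `1/ρ`.

All curvature identities are proved over an abstract ring with commuting derivations, where they are
polynomial identities, and are then specialised to smooth functions. -/

open scoped ContDiff

noncomputable section

namespace Fefferman

/-! ### Curvature over a ring with commuting derivations -/

section Algebraic

variable {R : Type*} [CommRing R] [Algebra ℝ R] {n : ℕ}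

/-- Christoffel symbols of the metric `g` with inverse `h`, over a ring with derivations `d`. -/
def chr (d : Fin n → Derivation ℝ R R) (g h : Matrix (Fin n) (Fin n) R) (a b c : Fin n) : R :=
  (1 / 2 : ℝ) • ∑ e, h a e * (d c (g e b) + d b (g e c) - d e (g b c))

/-- The curvature of the connection with symbols `Γ`. -/
def curv (d : Fin n → Derivation ℝ R R) (Γ : Fin n → Fin n → Fin n → R) (a b c e : Fin n) : R :=
  d c (Γ a b e) - d e (Γ a b c) + ∑ f, (Γ a c f * Γ f b e - Γ a e f * Γ f b c)

/-- The second covariant derivative of `s`. -/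
def hess (d : Fin n → Derivation ℝ R R) (Γ : Fin n → Fin n → Fin n → R) (s : R) (a b : Fin n) : R :=
  d a (d b s) - ∑ e, Γ e a b * d e s

/-- The gradient of `s`. -/
def grad (d : Fin n → Derivation ℝ R R) (h : Matrix (Fin n) (Fin n) R) (s : R) (a : Fin n) : R :=
  ∑ e, h a e * d e s

theorem chr_symm {d : Fin n → Derivation ℝ R R} {g h : Matrix (Fin n) (Fin n) R}
    (hg : ∀ a b, g a b = g b a) (a b c : Fin n) : chr d g h a b c = chr d g h a c b := by
  unfold chr
  congr 1
  refine Finset.sum_congr rfl fun e _ => ?_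
  rw [hg b c]; ring

/-- Lowering the index removes the inverse metric; later identities are checked in this form. -/
theorem sum_mul_chr {d : Fin n → Derivation ℝ R R} {g h : Matrix (Fin n) (Fin n) R}
    (hgh : g * h = 1) (f b c : Fin n) :
    ∑ a, g f a * chr d g h a b c = (1 / 2 : ℝ) • (d c (g f b) + d b (g f c) - d f (g b c)) := by
  have h1 : ∀ e, ∑ a, g f a * h a e = (1 : Matrix (Fin n) (Fin n) R) f e := fun e => by
    rw [← hgh, Matrix.mul_apply]
  calc ∑ a, g f a * chr d g h a b c
      = (1 / 2 : ℝ) • ∑ a, ∑ e, g f a * h a e * (d c (g e b) + d b (g e c) - d e (g b c)) := by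
        unfold chr
        rw [Finset.smul_sum]
        refine Finset.sum_congr rfl fun a _ => ?_
        rw [mul_smul_comm, Finset.mul_sum]
        simp only [mul_assoc]
    _ = _ := by
        rw [Finset.sum_comm]
        simp only [← Finset.sum_mul, h1, Matrix.one_apply, ite_mul, one_mul, zero_mul,
          Finset.sum_ite_eq, Finset.mem_univ, if_true]

/-- The Levi-Civita connection preserves the metric. -/
theorem metric_compat {d : Fin n → Derivation ℝ R R} {g h : Matrix (Fin n) (Fin n) R}
    (hg : ∀ a b, g a b = g b a) (hgh : g * h = 1) (a b c : Fin n) :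
    d c (g a b) = ∑ e, g a e * chr d g h e b c + ∑ e, g b e * chr d g h e a c := by
  rw [sum_mul_chr hgh, sum_mul_chr hgh, hg b a, hg b c, hg a c]
  algebra

theorem sum_mul_grad {d : Fin n → Derivation ℝ R R} {g h : Matrix (Fin n) (Fin n) R}
    (hgh : g * h = 1) (s : R) (b : Fin n) : ∑ a, g b a * grad d h s a = d b s := by
  have h1 : ∀ e, ∑ a, g b a * h a e = (1 : Matrix (Fin n) (Fin n) R) b e := fun e => by
    rw [← hgh, Matrix.mul_apply]
  simp only [grad, Finset.mul_sum]
  rw [Finset.sum_comm]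
  simp only [← mul_assoc, ← Finset.sum_mul, h1, Matrix.one_apply, ite_mul, one_mul, zero_mul,
    Finset.sum_ite_eq, Finset.mem_univ, if_true]

theorem eq_sum_mul_of_sum_mul_eq {S : Type*} [CommRing S] {g h : Matrix (Fin n) (Fin n) S}
    (hhg : h * g = 1)
    {u v : Fin n → S} (huv : ∀ b, ∑ a, g b a * u a = v b) (a : Fin n) :
    u a = ∑ e, h a e * v e := by
  have h1 : ∀ e, ∑ b, h a b * g b e = (1 : Matrix (Fin n) (Fin n) S) a e := fun e => by
    rw [← hhg, Matrix.mul_apply]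
  simp only [← huv, Finset.mul_sum]
  rw [Finset.sum_comm]
  simp only [← mul_assoc, ← Finset.sum_mul, h1, Matrix.one_apply, ite_mul, one_mul, zero_mul,
    Finset.sum_ite_eq, Finset.mem_univ, if_true]

/-- The covariant derivative of the gradient is the Hessian with an index raised. -/
theorem deriv_grad {d : Fin n → Derivation ℝ R R} {g h : Matrix (Fin n) (Fin n) R}
    (hg : ∀ a b, g a b = g b a) (hgh : g * h = 1) (hhg : h * g = 1) (s : R) (a c : Fin n) :
    d c (grad d h s a) + ∑ f, chr d g h a c f * grad d h s f
      = ∑ e, h a e * hess d (chr d g h) s c e := by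
  -- The identity is checked with the index lowered, where it is the derivative of `g(grad s, ·) =
  -- ds` combined with metric compatibility.
  refine eq_sum_mul_of_sum_mul_eq hhg
    (u := fun a => d c (grad d h s a) + ∑ f, chr d g h a c f * grad d h s f) (fun b => ?_) a
  have h0 := congrArg (d c) (sum_mul_grad (d := d) hgh s b)
  simp only [map_sum, Derivation.leibniz, smul_eq_mul, Finset.sum_add_distrib] at h0
  have h1 : ∑ a, grad d h s a * d c (g b a)
      = ∑ a, ∑ f, g b a * (chr d g h a c f * grad d h s f) + ∑ e, chr d g h e c b * d e s := by
    have h2 : ∑ e, chr d g h e c b * d e s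
        = ∑ a, ∑ e, grad d h s a * (g a e * chr d g h e c b) := by
      rw [Finset.sum_comm]
      refine Finset.sum_congr rfl fun e _ => ?_
      rw [← sum_mul_grad (d := d) hgh s e, Finset.mul_sum]
      refine Finset.sum_congr rfl fun a _ => ?_
      rw [hg e a]; ring
    rw [h2, Finset.sum_comm (f := fun a f => g b a * (chr d g h a c f * grad d h s f)),
      ← Finset.sum_add_distrib]
    refine Finset.sum_congr rfl fun a _ => ?_
    rw [metric_compat hg hgh b a c, mul_add, Finset.mul_sum, Finset.mul_sum]
    congr 1
    · refine Finset.sum_congr rfl fun e _ => ?_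
      rw [chr_symm hg e c a]; ring
    · refine Finset.sum_congr rfl fun e _ => ?_
      rw [chr_symm hg e c b]
  rw [h1] at h0
  simp only [mul_add, Finset.sum_add_distrib, Finset.mul_sum, hess]
  linear_combination h0

theorem deriv_inv (d : Derivation ℝ R R) {r s : R} (hrs : r * s = 1) : d r = -(r ^ 2 * d s) := by
  have h := congrArg d hrs
  simp only [Derivation.leibniz, smul_eq_mul, Derivation.map_one_eq_zero] at h
  linear_combination r * h - d r * hrs

/-- Christoffel symbols of the conformally rescaled metric `s⁻² g`. -/
theorem chr_conformal {d : Fin n → Derivation ℝ R R} {g h : Matrix (Fin n) (Fin n) R}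
    (hhg : h * g = 1) {r s : R} (hrs : r * s = 1) (a b c : Fin n) :
    chr d (r ^ 2 • g) (s ^ 2 • h) a b c = chr d g h a b c
      + -(r * ((1 : Matrix (Fin n) (Fin n) R) a b * d c s
        + (1 : Matrix (Fin n) (Fin n) R) a c * d b s - g b c * grad d h s a)) := by
  have h1 : ∀ e, ∑ b, h a b * g b e = (1 : Matrix (Fin n) (Fin n) R) a e := fun e => by
    rw [← hhg, Matrix.mul_apply]
  have hsq : s ^ 2 * r ^ 2 = 1 := by linear_combination (r * s + 1) * hrs
  have h3 : s ^ 2 * r ^ 3 = r := by linear_combination r * hsq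
  have key : ∀ e, s ^ 2 * h a e * (d c (r ^ 2 * g e b) + d b (r ^ 2 * g e c) - d e (r ^ 2 * g b c))
      = h a e * (d c (g e b) + d b (g e c) - d e (g b c))
        - 2 * r * (h a e * g e b * d c s + h a e * g e c * d b s - g b c * (h a e * d e s)) := by
    intro e
    simp only [Derivation.leibniz, Derivation.leibniz_pow, smul_eq_mul, deriv_inv (d _) hrs,
      nsmul_eq_mul, Nat.cast_ofNat, Nat.add_one_sub_one, pow_one]
    linear_combination (h a e * (d c (g e b) + d b (g e c) - d e (g b c))) * hsq
      - 2 * (h a e * g e b * d c s + h a e * g e c * d b s - g b c * (h a e * d e s)) * h3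
  simp only [chr, Matrix.smul_apply, smul_eq_mul, key, Finset.sum_sub_distrib, ← Finset.mul_sum,
    Finset.sum_add_distrib, ← Finset.sum_mul, h1, grad]
  algebra

/-- The conformal factor is written as `s⁻²` because the terms `ds ⊗ ds` then cancel: the change of
curvature contains the Hessian of `s` linearly and, apart from that, only `|ds|²`. The Einstein
condition becomes linear in `s` up to trace. -/
theorem curv_conformal {d : Fin n → Derivation ℝ R R} (hd : ∀ a b f, d a (d b f) = d b (d a f))
    {g h : Matrix (Fin n) (Fin n) R}
    (hg : ∀ a b, g a b = g b a) (hgh : g * h = 1) (hhg : h * g = 1) {r s : R} (hrs : r * s = 1)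
    (a b c e : Fin n) :
    curv d (chr d (r ^ 2 • g) (s ^ 2 • h)) a b c e = curv d (chr d g h) a b c e
      + r * ((1 : Matrix (Fin n) (Fin n) R) a c * hess d (chr d g h) s e b
        - (1 : Matrix (Fin n) (Fin n) R) a e * hess d (chr d g h) s c b
        + g b e * ∑ f, h a f * hess d (chr d g h) s c f
        - g b c * ∑ f, h a f * hess d (chr d g h) s e f)
      + r ^ 2 * (∑ f, d f s * grad d h s f)
        * ((1 : Matrix (Fin n) (Fin n) R) a e * g b c
          - (1 : Matrix (Fin n) (Fin n) R) a c * g b e) := by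
  set Γ := chr d g h with hΓ
  set X := grad d h s with hX
  set δ := (1 : Matrix (Fin n) (Fin n) R) with hδ
  have hsym : ∀ a b c, Γ a b c = Γ a c b := chr_symm hg
  have hC : ∀ a b c, chr d (r ^ 2 • g) (s ^ 2 • h) a b c = Γ a b c
      + -(r * (δ a b * d c s + δ a c * d b s - g b c * X a)) := chr_conformal hhg hrs
  have dδ : ∀ k a b, d k (δ a b) = 0 := fun k a b => by
    rw [hδ, Matrix.one_apply]; split_ifs <;> simp
  have sδ : ∀ (u : Fin n → R) b, ∑ f, u f * δ f b = u b := fun u b => by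
    simp [hδ, Matrix.one_apply]
  have sδ' : ∀ (u : Fin n → R) b, ∑ f, δ b f * u f = u b := fun u b => by
    simp [hδ, Matrix.one_apply]
  have gX : ∀ b, ∑ f, g b f * X f = d b s := sum_mul_grad hgh s
  have left : ∀ (u : Fin n → R) b e, ∑ f, u f * -(r * (δ f b * d e s + δ f e * d b s - g b e * X f))
      = -(r * (u b * d e s + u e * d b s - g b e * ∑ f, u f * X f)) := fun u b e => by
    have : ∀ f, u f * -(r * (δ f b * d e s + δ f e * d b s - g b e * X f))
      = -(r * d e s * (u f * δ f b)) - r * d b s * (u f * δ f e) + r * g b e * (u f * X f) :=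
      fun f => by ring
    simp only [this, Finset.sum_add_distrib, Finset.sum_sub_distrib, Finset.sum_neg_distrib,
      ← Finset.mul_sum, sδ]
    ring
  have right : ∀ (v : Fin n → R) a c,
      ∑ f, -(r * (δ a c * d f s + δ a f * d c s - g c f * X a)) * v f
      = -(r * (δ a c * ∑ f, d f s * v f + d c s * v a - X a * ∑ f, g c f * v f)) :=
    fun v a c => by
    have : ∀ f, -(r * (δ a c * d f s + δ a f * d c s - g c f * X a)) * v f
      = -(r * δ a c * (d f s * v f)) - r * d c s * (δ a f * v f) + r * X a * (g c f * v f) :=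
      fun f => by ring
    simp only [this, Finset.sum_add_distrib, Finset.sum_sub_distrib, Finset.sum_neg_distrib,
      ← Finset.mul_sum, sδ']
    ring
  have prod : ∀ a c b e, ∑ f, chr d (r ^ 2 • g) (s ^ 2 • h) a c f
        * chr d (r ^ 2 • g) (s ^ 2 • h) f b e
      = ∑ f, Γ a c f * Γ f b e - r * (Γ a c b * d e s + Γ a c e * d b s - g b e * ∑ f, Γ a c f * X f)
        - r * (δ a c * ∑ f, d f s * Γ f b e + d c s * Γ a b e - X a * ∑ f, g c f * Γ f b e)
        + r ^ 2 * (δ a c * (d b s * d e s + d e s * d b s - g b e * ∑ f, d f s * X f)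
          + d c s * (δ a b * d e s + δ a e * d b s - g b e * X a)
          - X a * (g c b * d e s + g c e * d b s - g b e * d c s)) := by
    intro a c b e
    simp only [hC, add_mul, mul_add, Finset.sum_add_distrib]
    rw [left (Γ a c), right (fun f => Γ f b e),
      right (fun f => -(r * (δ f b * d e s + δ f e * d b s - g b e * X f))), left (fun f => d f s),
      left (g c), gX]
    ring
  have hDX : ∀ a c, d c (X a) = ∑ f, h a f * hess d Γ s c f - ∑ f, Γ a c f * X f := fun a c => by
    rw [← deriv_grad hg hgh hhg]; ring
  have hs : ∀ a b, d a (d b s) = hess d Γ s a b + ∑ f, d f s * Γ f a b := fun a b => by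
    simp only [hess, mul_comm (d _ s)]; ring
  have hs' : ∀ a b, hess d Γ s a b = hess d Γ s b a := fun a b => by
    simp only [hess, hd a b, hsym _ a b]
  simp only [curv, Finset.sum_sub_distrib, prod]
  simp only [hC, map_add, map_neg, map_sub, Derivation.leibniz, smul_eq_mul, dδ, hDX, hs,
    deriv_inv (d _) hrs, metric_compat (d := d) hg hgh, ← hΓ]
  rw [hs' c e, hsym a e b, hsym a e c]
  simp only [hsym _ e b, hsym _ c b, hsym _ e c, hg e c, hg e b, hg c b]
  ring

end Algebraic

/-! ### The Fefferman metric of `y'' = Q(x, y, y')` over a differential ring -/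

/-- A ring with commuting derivations `d 0 = ∂_x`, `d 1 = ∂_y`, `d 2 = ∂_p`, `d 3 = ∂_ψ`, containing
the coordinate `p` and a function `Q` of `(x, y, p)`. -/
structure JetAlgebra (R : Type*) [CommRing R] [Algebra ℝ R] where
  d : Fin 4 → Derivation ℝ R R
  comm : ∀ a b f, d a (d b f) = d b (d a f)
  p : R
  Q : R
  d0_p : d 0 p = 0
  d1_p : d 1 p = 0
  d2_p : d 2 p = 1
  d3_p : d 3 p = 0
  d3_Q : d 3 Q = 0

namespace JetAlgebra

variable {R : Type*} [CommRing R] [Algebra ℝ R] (J : JetAlgebra R)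

theorem d10 (f : R) : J.d 1 (J.d 0 f) = J.d 0 (J.d 1 f) := J.comm _ _ _
theorem d20 (f : R) : J.d 2 (J.d 0 f) = J.d 0 (J.d 2 f) := J.comm _ _ _
theorem d30 (f : R) : J.d 3 (J.d 0 f) = J.d 0 (J.d 3 f) := J.comm _ _ _
theorem d21 (f : R) : J.d 2 (J.d 1 f) = J.d 1 (J.d 2 f) := J.comm _ _ _
theorem d31 (f : R) : J.d 3 (J.d 1 f) = J.d 1 (J.d 3 f) := J.comm _ _ _
theorem d32 (f : R) : J.d 3 (J.d 2 f) = J.d 2 (J.d 3 f) := J.comm _ _ _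

theorem d_ofNat (k : Fin 4) (m : ℕ) [m.AtLeastTwo] : J.d k (OfNat.ofNat m : R) = 0 :=
  (J.d k).map_natCast m

/-- The total derivative. -/
def D (f : R) : R := J.d 0 f + J.p * J.d 1 f + J.Q * J.d 2 f

/-- The relative invariant `w₁`. -/
def w1 : R :=
  J.D (J.D (J.d 2 (J.d 2 J.Q))) - 4 * J.D (J.d 1 (J.d 2 J.Q))
    - J.D (J.d 2 (J.d 2 J.Q)) * J.d 2 J.Q + 4 * J.d 2 J.Q * J.d 1 (J.d 2 J.Q)
    - 3 * J.d 2 (J.d 2 J.Q) * J.d 1 J.Q + 6 * J.d 1 (J.d 1 J.Q)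

/-- The relative invariant `w₂`. -/
def w2 : R := J.d 2 (J.d 2 (J.d 2 (J.d 2 J.Q)))

/-- `dp - Q dx` -/
def t1 : Fin 4 → R := ![-J.Q, 0, 1, 0]

/-- `dx` -/
def t2 (_ : JetAlgebra R) : Fin 4 → R := ![1, 0, 0, 0]

/-- `-(dy - p dx)` -/
def t3 : Fin 4 → R := ![J.p, -1, 0, 0]

/-- `dψ + (2/3) Q_p dx + (1/6) Q_pp (dy - p dx)` -/
def t4 : Fin 4 → R :=
  ![(2 / 3 : ℝ) • J.d 2 J.Q - (1 / 6 : ℝ) • (J.p * J.d 2 (J.d 2 J.Q)),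
    (1 / 6 : ℝ) • J.d 2 (J.d 2 J.Q), 0, 1]

/-- The vector dual to `t1`. -/
def e1 (_ : JetAlgebra R) : Fin 4 → R := ![0, 0, 1, 0]

/-- The vector dual to `t2`. -/
def e2 : Fin 4 → R := ![1, J.p, J.Q, -((2 / 3 : ℝ) • J.d 2 J.Q)]

/-- The vector dual to `t3`. -/
def e3 : Fin 4 → R := ![0, -1, 0, (1 / 6 : ℝ) • J.d 2 (J.d 2 J.Q)]

/-- The vector dual to `t4`. -/
def e4 (_ : JetAlgebra R) : Fin 4 → R := ![0, 0, 0, 1]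

/-- The Fefferman metric with `ρ = 1`. -/
def g : Matrix (Fin 4) (Fin 4) R := Matrix.of fun a b =>
  J.t1 a * J.t2 b + J.t2 a * J.t1 b + J.t3 a * J.t4 b + J.t4 a * J.t3 b

/-- The inverse metric. -/
def h : Matrix (Fin 4) (Fin 4) R := Matrix.of fun a b =>
  J.e1 a * J.e2 b + J.e2 a * J.e1 b + J.e3 a * J.e4 b + J.e4 a * J.e3 b

/-- The components of `g`. -/
def gtab : Fin 4 → Fin 4 → R
  | 0, 0 => -(2 * J.Q) + (4 / 3 : ℝ) • (J.p * J.d 2 J.Q)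
      - (1 / 3 : ℝ) • (J.p ^ 2 * J.d 2 (J.d 2 J.Q))
  | 0, 1 | 1, 0 => (1 / 3 : ℝ) • (J.p * J.d 2 (J.d 2 J.Q)) - (2 / 3 : ℝ) • J.d 2 J.Q
  | 1, 1 => -((1 / 3 : ℝ) • J.d 2 (J.d 2 J.Q))
  | 0, 2 | 2, 0 => 1
  | 0, 3 | 3, 0 => J.p
  | 1, 3 | 3, 1 => -1
  | 1, 2 | 2, 1 => 0
  | 2, 2 => 0
  | 2, 3 | 3, 2 => 0
  | 3, 3 => 0

/-- The components of `h`. -/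
def htab : Fin 4 → Fin 4 → R
  | 0, 0 => 0
  | 0, 1 | 1, 0 => 0
  | 1, 1 => 0
  | 0, 2 | 2, 0 => 1
  | 0, 3 | 3, 0 => 0
  | 1, 2 | 2, 1 => J.p
  | 1, 3 | 3, 1 => -1
  | 2, 2 => 2 * J.Q
  | 2, 3 | 3, 2 => -((2 / 3 : ℝ) • J.d 2 J.Q)
  | 3, 3 => (1 / 3 : ℝ) • J.d 2 (J.d 2 J.Q)

/-- The Christoffel symbols `Γˣ` of `g`. -/
def gamX : Fin 4 → Fin 4 → R
  | 0, 0 => (1 / 3 : ℝ) • (J.d 2 J.Q - J.d 2 (J.d 2 J.Q) * J.p)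
      + (1 / 6 : ℝ) • (J.d 2 (J.d 2 (J.d 2 J.Q)) * J.p ^ 2)
  | 0, 1 | 1, 0 => (1 / 6 : ℝ) • (J.d 2 (J.d 2 J.Q) - J.d 2 (J.d 2 (J.d 2 J.Q)) * J.p)
  | 0, 3 | 3, 0 => -((1 / 2 : ℝ) • 1)
  | 1, 1 => (1 / 6 : ℝ) • J.d 2 (J.d 2 (J.d 2 J.Q))
  | 0, 2 | 2, 0 => 0
  | 1, 2 | 2, 1 => 0
  | 1, 3 | 3, 1 => 0
  | 2, 2 => 0
  | 2, 3 | 3, 2 => 0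
  | 3, 3 => 0

/-- The Christoffel symbols `Γʸ` of `g`. -/
def gamY : Fin 4 → Fin 4 → R
  | 0, 0 => (1 / 3 : ℝ) • (J.d 2 J.Q * J.p - J.d 2 (J.d 2 J.Q) * J.p ^ 2)
      + (1 / 6 : ℝ) • (J.d 2 (J.d 2 (J.d 2 J.Q)) * J.p ^ 3)
  | 0, 1 | 1, 0 => (1 / 6 : ℝ) • (J.d 2 (J.d 2 J.Q) * J.p - J.d 2 (J.d 2 (J.d 2 J.Q)) * J.p ^ 2)
  | 0, 2 | 2, 0 => -((1 / 2 : ℝ) • 1)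
  | 0, 3 | 3, 0 => -((1 / 2 : ℝ) • J.p)
  | 1, 1 => (1 / 6 : ℝ) • (J.d 2 (J.d 2 (J.d 2 J.Q)) * J.p)
  | 1, 2 | 2, 1 => 0
  | 1, 3 | 3, 1 => 0
  | 2, 2 => 0
  | 2, 3 | 3, 2 => 0
  | 3, 3 => 0

/-- The Christoffel symbols `Γᵖ` of `g`. -/
def gamP : Fin 4 → Fin 4 → R
  | 0, 0 => (2 / 3 : ℝ) • (J.Q * J.d 2 J.Q - J.Q * J.d 2 (J.d 2 J.Q) * J.p)
      + (1 / 3 : ℝ) • (J.Q * J.d 2 (J.d 2 (J.d 2 J.Q)) * J.p ^ 2) + J.d 1 J.Q * J.p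
      - (2 / 3 : ℝ) • (J.d 1 (J.d 2 J.Q) * J.p ^ 2)
      + (1 / 6 : ℝ) • (J.d 1 (J.d 2 (J.d 2 J.Q)) * J.p ^ 3) - J.d 0 J.Q
      + (1 / 6 : ℝ) • (J.d 0 (J.d 2 (J.d 2 J.Q)) * J.p ^ 2)
  | 0, 1 | 1, 0 => (1 / 3 : ℝ) • (J.Q * J.d 2 (J.d 2 J.Q) - J.Q * J.d 2 (J.d 2 (J.d 2 J.Q)) * J.p)
      - J.d 1 J.Q + (2 / 3 : ℝ) • (J.d 1 (J.d 2 J.Q) * J.p)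
      - (1 / 6 : ℝ) • (J.d 1 (J.d 2 (J.d 2 J.Q)) * J.p ^ 2)
      - (1 / 6 : ℝ) • (J.d 0 (J.d 2 (J.d 2 J.Q)) * J.p)
  | 0, 2 | 2, 0 => (1 / 6 : ℝ) • (J.d 2 (J.d 2 J.Q) * J.p) - (2 / 3 : ℝ) • J.d 2 J.Q
  | 0, 3 | 3, 0 => -J.Q
  | 1, 1 => (1 / 3 : ℝ) • (J.Q * J.d 2 (J.d 2 (J.d 2 J.Q))) - (2 / 3 : ℝ) • J.d 1 (J.d 2 J.Q)
      + (1 / 6 : ℝ) • (J.d 1 (J.d 2 (J.d 2 J.Q)) * J.p) + (1 / 6 : ℝ) • J.d 0 (J.d 2 (J.d 2 J.Q))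
  | 1, 2 | 2, 1 => -((1 / 6 : ℝ) • J.d 2 (J.d 2 J.Q))
  | 2, 3 | 3, 2 => (1 / 2 : ℝ) • 1
  | 1, 3 | 3, 1 => 0
  | 2, 2 => 0
  | 3, 3 => 0

/-- The Christoffel symbols `Γ^ψ` of `g`. -/
def gamS : Fin 4 → Fin 4 → R
  | 0, 0 => (2 / 9 : ℝ) • (J.d 2 J.Q * J.d 2 (J.d 2 J.Q) * J.p)
      - (1 / 9 : ℝ) • (J.d 2 J.Q * J.d 2 (J.d 2 (J.d 2 J.Q)) * J.p ^ 2)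
      - (2 / 9 : ℝ) • J.d 2 J.Q ^ 2 - J.d 1 J.Q + (2 / 3 : ℝ) • (J.d 1 (J.d 2 J.Q) * J.p)
      - (1 / 6 : ℝ) • (J.d 1 (J.d 2 (J.d 2 J.Q)) * J.p ^ 2)
      + (2 / 3 : ℝ) • J.d 0 (J.d 2 J.Q) - (1 / 3 : ℝ) • (J.d 0 (J.d 2 (J.d 2 J.Q)) * J.p)
  | 0, 1 | 1, 0 => (1 / 6 : ℝ) • J.d 0 (J.d 2 (J.d 2 J.Q))
      - (1 / 9 : ℝ) • (J.d 2 J.Q * J.d 2 (J.d 2 J.Q) - J.d 2 J.Q * J.d 2 (J.d 2 (J.d 2 J.Q)) * J.p)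
  | 0, 2 | 2, 0 => (1 / 3 : ℝ) • J.d 2 (J.d 2 J.Q) - (1 / 6 : ℝ) • (J.d 2 (J.d 2 (J.d 2 J.Q)) * J.p)
  | 0, 3 | 3, 0 => (1 / 3 : ℝ) • J.d 2 J.Q
  | 1, 1 => (1 / 6 : ℝ) • J.d 1 (J.d 2 (J.d 2 J.Q))
      - (1 / 9 : ℝ) • (J.d 2 J.Q * J.d 2 (J.d 2 (J.d 2 J.Q)))
  | 1, 2 | 2, 1 => (1 / 6 : ℝ) • J.d 2 (J.d 2 (J.d 2 J.Q))
  | 1, 3 | 3, 1 => 0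
  | 2, 2 => 0
  | 2, 3 | 3, 2 => 0
  | 3, 3 => 0

/-- The Christoffel symbols of `g`. -/
def gam : Fin 4 → Fin 4 → Fin 4 → R
  | 0 => J.gamX
  | 1 => J.gamY
  | 2 => J.gamP
  | 3 => J.gamS

/-- The Schouten tensor of `g`. -/
def schouten (a b : Fin 4) : R :=
  let q := J.Q
  let q₁ := J.d 2 q
  let q₂ := J.d 2 q₁
  let q₃ := J.d 2 q₂
  (1 / 12 : ℝ) • (q₃ * (J.t1 a * J.t3 b + J.t3 a * J.t1 b))
    - (1 / 8 : ℝ) • (q₂ * (J.t1 a * J.t2 b + J.t2 a * J.t1 b))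
    - (1 / 2 : ℝ) • (J.d 1 q * (J.t2 a * J.t2 b))
    + ((1 / 3 : ℝ) • J.d 1 q₁ - (1 / 12 : ℝ) • J.D q₂) * (J.t2 a * J.t3 b + J.t3 a * J.t2 b)
    + ((1 / 6 : ℝ) • (J.D q₃ + q₁ * q₃) - (1 / 16 : ℝ) • q₂ ^ 2 - (1 / 4 : ℝ) • J.d 1 q₂)
        * (J.t3 a * J.t3 b)
    - (1 / 4 : ℝ) • (J.t4 a * J.t4 b)

theorem g_symm (a b : Fin 4) : J.g a b = J.g b a := by
  simp only [g, Matrix.of_apply]; ring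

theorem g_apply (a b : Fin 4) : J.g a b = J.gtab a b := by
  fin_cases a <;> fin_cases b <;> simp [g, gtab, t1, t2, t3, t4] <;> algebra

theorem h_apply (a b : Fin 4) : J.h a b = J.htab a b := by
  fin_cases a <;> fin_cases b <;> simp [h, htab, e1, e2, e3, e4] <;> algebra

theorem g_mul_h : J.g * J.h = 1 := by
  ext a b
  simp only [Matrix.mul_apply, g_apply, h_apply, Fin.sum_univ_four]
  fin_cases a <;> fin_cases b <;> simp [gtab, htab] <;> algebra

theorem h_mul_g : J.h * J.g = 1 := mul_eq_one_comm.mp J.g_mul_h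

-- With closed forms for the connection, its curvature below needs no inverse matrix and no further
-- simplification of sums.
set_option maxHeartbeats 4000000 in
theorem chr_g : chr J.d J.g J.h = J.gam := by
  funext a b c
  simp only [chr, g_apply, h_apply, Fin.sum_univ_four]
  fin_cases a <;> fin_cases b <;> fin_cases c <;>
    simp [gam, gamX, gamY, gamP, gamS, gtab, htab, J.d_ofNat,
      J.d32, J.d0_p, J.d1_p, J.d2_p, J.d3_p, J.d3_Q] <;> algebra

end JetAlgebra

/-! ### Schouten and Weyl tensors of the metric with `ρ = 1` -/

namespace JetAlgebra

variable {R : Type*} [CommRing R] [Algebra ℝ R] (J : JetAlgebra R)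

/-- The components of the Schouten tensor with the first index raised. -/
def mixedSchouten (a b : Fin 4) : R := ∑ f, J.h a f * J.schouten b f

/-- The Weyl tensor of `g`. -/
def weyl (a b c e : Fin 4) : R :=
  (1 / 6 : ℝ) • (J.w2 * (J.e2 a * J.t3 b - J.e4 a * J.t1 b) * (J.t1 c * J.t3 e - J.t3 c * J.t1 e)
    + J.w1 * (J.e1 a * J.t3 b - J.e4 a * J.t2 b) * (J.t2 c * J.t3 e - J.t3 c * J.t2 e))

theorem forall_fin_four {p : Fin 4 → Prop} : (∀ a, p a) ↔ p 0 ∧ p 1 ∧ p 2 ∧ p 3 :=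
  ⟨fun h => ⟨h 0, h 1, h 2, h 3⟩, fun ⟨h₀, h₁, h₂, h₃⟩ a => by
    fin_cases a <;> assumption⟩

-- The decomposition of the curvature into Schouten and Weyl parts, verified component by component.
-- The curvature is antisymmetric in `c, e`, so six index pairs suffice. Only `w1` and `w2` occur in
-- the Weyl part.
set_option maxHeartbeats 20000000 in
theorem curv_g_of_lt (a b c e : Fin 4) (hce : c < e) :
    curv J.d J.gam a b c e = (1 : Matrix (Fin 4) (Fin 4) R) a c * J.schouten b e
      - (1 : Matrix (Fin 4) (Fin 4) R) a e * J.schouten b c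
      + J.gtab b e * J.mixedSchouten a c - J.gtab b c * J.mixedSchouten a e + J.weyl a b c e := by
  simp only [curv, mixedSchouten, Fin.sum_univ_four, h_apply]
  revert a b
  fin_cases c <;> fin_cases e <;> try exact absurd hce (by decide)
  all_goals
    clear hce
    rw [forall_fin_four]
    simp only [forall_fin_four]
    simp [gam, gamX, gamY, gamP, gamS, gtab, htab, schouten, weyl, t1, t2, t3, t4, e1, e2, e4,
      w1, w2, D, Matrix.one_apply,
      J.d10, J.d20, J.d21, J.d30, J.d31,
      J.d32, J.d0_p, J.d1_p, J.d2_p, J.d3_p, J.d3_Q]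
    and_intros
    all_goals algebra

end JetAlgebra

/-! ### The almost Einstein equation in the null coframe -/

namespace JetAlgebra

variable {R : Type*} [CommRing R] [Algebra ℝ R] (J : JetAlgebra R)

theorem curv_g (a b c e : Fin 4) :
    curv J.d (chr J.d J.g J.h) a b c e = (1 : Matrix (Fin 4) (Fin 4) R) a c * J.schouten b e
      - (1 : Matrix (Fin 4) (Fin 4) R) a e * J.schouten b c
      + J.g b e * J.mixedSchouten a c - J.g b c * J.mixedSchouten a e + J.weyl a b c e := by
  rw [chr_g, g_apply, g_apply]
  rcases lt_trichotomy c e with hce | rfl | hce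
  · exact J.curv_g_of_lt a b c e hce
  · simp only [curv, weyl, sub_self, Finset.sum_const_zero]; algebra
  · have h1 := J.curv_g_of_lt a b e c hce
    have h2 : curv J.d J.gam a b c e = -curv J.d J.gam a b e c := by
      simp only [curv, Finset.sum_sub_distrib]; ring
    rw [h2, h1]; simp only [weyl]; algebra

/-- `∇∇s + s P`, whose trace-free part vanishes when `s⁻² g` is Einstein. -/
def almostEinstein (s : R) (a b : Fin 4) : R :=
  hess J.d (chr J.d J.g J.h) s a b + s * J.schouten a b

/-- The trace of `almostEinstein`. -/
def almostEinsteinTrace (s : R) : R := ∑ a, ∑ f, J.h a f * J.almostEinstein s a f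

/-- The square of the gradient of `s`. -/
def gradSq (s : R) : R := ∑ f, J.d f s * grad J.d J.h s f

/-- A symmetric tensor with given components in the frame. -/
def symTensor (f11 f12 f13 f14 f22 f23 f24 f33 f34 f44 : R) (a b : Fin 4) : R :=
  f11 * (J.t1 a * J.t1 b) + f12 * (J.t1 a * J.t2 b + J.t2 a * J.t1 b)
    + f13 * (J.t1 a * J.t3 b + J.t3 a * J.t1 b) + f14 * (J.t1 a * J.t4 b + J.t4 a * J.t1 b)
    + f22 * (J.t2 a * J.t2 b) + f23 * (J.t2 a * J.t3 b + J.t3 a * J.t2 b)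
    + f24 * (J.t2 a * J.t4 b + J.t4 a * J.t2 b) + f33 * (J.t3 a * J.t3 b)
    + f34 * (J.t3 a * J.t4 b + J.t4 a * J.t3 b) + f44 * (J.t4 a * J.t4 b)

/-- The functions `E11`, ..., `E44` are the components of `almostEinstein s` in the coframe `t1`,
..., `t4`, as `almostEinstein_eq` confirms. The metric has only the components 12 and 34, both equal
to 1, so the other eight components and `E12 - E34` make up the trace-free part. -/
def E11 (s : R) : R := J.d 2 (J.d 2 s)

def E12 (s : R) : R :=
  J.D (J.d 2 s) + J.d 2 J.Q * J.d 2 s + (1 / 2 : ℝ) • J.d 1 s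
    - (2 / 3 : ℝ) • (J.d 2 J.Q * J.d 2 (J.d 3 s)) - (1 / 8 : ℝ) • (J.d 2 (J.d 2 J.Q) * s)
    - (1 / 3 : ℝ) • (J.d 2 (J.d 2 J.Q) * J.d 3 s)

def E13 (s : R) : R :=
  -J.d 1 (J.d 2 s) - (1 / 4 : ℝ) • (J.d 2 (J.d 2 J.Q) * J.d 2 s)
    + (1 / 6 : ℝ) • (J.d 2 (J.d 2 J.Q) * J.d 2 (J.d 3 s))
    + (1 / 12 : ℝ) • (J.d 2 (J.d 2 (J.d 2 J.Q)) * s)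
    + (1 / 6 : ℝ) • (J.d 2 (J.d 2 (J.d 2 J.Q)) * J.d 3 s)

def E14 (s : R) : R := J.d 2 (J.d 3 s) - (1 / 2 : ℝ) • J.d 2 s

def E22 (s : R) : R :=
  J.D (J.D s) - J.d 2 J.Q * J.D s - (4 / 3 : ℝ) • (J.d 2 J.Q * J.D (J.d 3 s))
    - (1 / 2 : ℝ) • (J.d 1 J.Q * s)
    + (J.d 1 J.Q - (2 / 3 : ℝ) • J.D (J.d 2 J.Q) + (2 / 3 : ℝ) • J.d 2 J.Q ^ 2) * J.d 3 s
    + (4 / 9 : ℝ) • (J.d 2 J.Q ^ 2 * J.d 3 (J.d 3 s))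

def E23 (s : R) : R :=
  -J.D (J.d 1 s) - J.d 1 J.Q * J.d 2 s + (1 / 4 : ℝ) • (J.d 2 (J.d 2 J.Q) * J.D s)
    + (1 / 6 : ℝ) • (J.d 2 (J.d 2 J.Q) * J.D (J.d 3 s))
    + (2 / 3 : ℝ) • (J.d 2 J.Q * J.d 1 (J.d 3 s))
    - (1 / 6 : ℝ) • (J.d 2 J.Q * J.d 2 (J.d 2 J.Q) * J.d 3 s)
    - (1 / 9 : ℝ) • (J.d 2 J.Q * J.d 2 (J.d 2 J.Q) * J.d 3 (J.d 3 s))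
    + (1 / 3 : ℝ) • (J.d 1 (J.d 2 J.Q) * s)
    + J.D (J.d 2 (J.d 2 J.Q)) * ((1 / 6 : ℝ) • J.d 3 s - (1 / 12 : ℝ) • s)

def E24 (s : R) : R :=
  (1 / 2 : ℝ) • J.D s + J.D (J.d 3 s) - (1 / 3 : ℝ) • (J.d 2 J.Q * J.d 3 s)
    - (2 / 3 : ℝ) • (J.d 2 J.Q * J.d 3 (J.d 3 s))

def E33 (s : R) : R :=
  J.d 1 (J.d 1 s) + (2 / 3 : ℝ) • (J.d 1 (J.d 2 J.Q) * J.d 2 s)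
    - (1 / 6 : ℝ) • (J.D (J.d 2 (J.d 2 J.Q)) * J.d 2 s)
    - (1 / 6 : ℝ) • (J.d 2 (J.d 2 (J.d 2 J.Q)) * J.D s)
    + (1 / 6 : ℝ) • ((J.D (J.d 2 (J.d 2 (J.d 2 J.Q)))
        + J.d 2 J.Q * J.d 2 (J.d 2 (J.d 2 J.Q))) * s)
    + (1 / 9 : ℝ) • (J.d 2 J.Q * J.d 2 (J.d 2 (J.d 2 J.Q)) * J.d 3 s)
    - (1 / 3 : ℝ) • (J.d 2 (J.d 2 J.Q) * J.d 1 (J.d 3 s))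
    - (1 / 16 : ℝ) • (J.d 2 (J.d 2 J.Q) ^ 2 * s)
    + (1 / 36 : ℝ) • (J.d 2 (J.d 2 J.Q) ^ 2 * J.d 3 (J.d 3 s))
    - (1 / 4 : ℝ) • (J.d 1 (J.d 2 (J.d 2 J.Q)) * s)
    - (1 / 6 : ℝ) • (J.d 1 (J.d 2 (J.d 2 J.Q)) * J.d 3 s)

def E34 (s : R) : R := (1 / 6 : ℝ) • (J.d 2 (J.d 2 J.Q) * J.d 3 (J.d 3 s)) - J.d 1 (J.d 3 s)

def E44 (s : R) : R := J.d 3 (J.d 3 s) - (1 / 4 : ℝ) • s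

theorem almostEinstein_eq (s : R) (a b : Fin 4) : J.almostEinstein s a b =
    J.symTensor (J.E11 s) (J.E12 s) (J.E13 s) (J.E14 s) (J.E22 s) (J.E23 s) (J.E24 s) (J.E33 s)
      (J.E34 s) (J.E44 s) a b := by
  rw [almostEinstein, chr_g, hess, Fin.sum_univ_four]
  fin_cases a <;> fin_cases b <;>
    simp [gam, gamX, gamY, gamP, gamS, schouten, symTensor, t1, t2, t3, t4, E11, E12, E13, E14,
      E22, E23, E24, E33, E34, E44, D, J.d10, J.d20, J.d21, J.d30, J.d31, J.d32,
      J.d0_p, J.d1_p, J.d2_p] <;> algebra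

theorem g_eq_symTensor (k : R) (a b : Fin 4) :
    k * J.g a b = J.symTensor 0 k 0 0 0 0 0 0 k 0 a b := by
  simp only [g, symTensor, Matrix.of_apply]; ring

/-- The `t`'s form a coframe that is triangular in the coordinate basis, so the coefficients can be
read off one after another. -/
theorem symTensor_eq_zero {f11 f12 f13 f14 f22 f23 f24 f33 f34 f44 : R}
    (h : ∀ a b, J.symTensor f11 f12 f13 f14 f22 f23 f24 f33 f34 f44 a b = 0) :
    f11 = 0 ∧ f12 = 0 ∧ f13 = 0 ∧ f14 = 0 ∧ f22 = 0 ∧ f23 = 0 ∧ f24 = 0 ∧ f33 = 0 ∧ f34 = 0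
      ∧ f44 = 0 := by
  have h11 : f11 = 0 := by simpa [symTensor, t1, t2, t3, t4] using h 2 2
  have h14 : f14 = 0 := by simpa [symTensor, t1, t2, t3, t4] using h 2 3
  have h44 : f44 = 0 := by simpa [symTensor, t1, t2, t3, t4] using h 3 3
  have h13 : f13 = 0 := by simpa [symTensor, t1, t2, t3, t4, h11, h14, h44] using h 2 1
  have h34 : f34 = 0 := by simpa [symTensor, t1, t2, t3, t4, h11, h14, h44] using h 3 1
  have h33 : f33 = 0 := by simpa [symTensor, t1, t2, t3, t4, h11, h14, h44, h34, h13] using h 1 1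
  have h12 : f12 = 0 := by simpa [symTensor, t1, t2, t3, t4, h11, h14, h44, h34, h13] using h 2 0
  have h24 : f24 = 0 := by simpa [symTensor, t1, t2, t3, t4, h11, h14, h44, h34, h13] using h 3 0
  have h23 : f23 = 0 := by
    simpa [symTensor, t1, t2, t3, t4, h11, h14, h44, h34, h13, h33, h24, h12] using h 1 0
  have h22 : f22 = 0 := by
    simpa [symTensor, t1, t2, t3, t4, h11, h14, h44, h34, h13, h33, h24, h12, h23] using h 0 0
  exact ⟨h11, h12, h13, h14, h22, h23, h24, h33, h34, h44⟩

theorem almostEinstein_symm (s : R) (a b : Fin 4) :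
    J.almostEinstein s a b = J.almostEinstein s b a := by
  simp only [almostEinstein_eq, symTensor]; ring

theorem schouten_symm (a b : Fin 4) : J.schouten a b = J.schouten b a := by
  simp only [schouten, mul_comm (J.t1 b), mul_comm (J.t2 b), mul_comm (J.t3 b), mul_comm (J.t4 b)]
  algebra

theorem gradSq_eq (s : R) : J.gradSq s = 2 * (J.d 2 s * (J.D s - (2 / 3 : ℝ) • (J.d 2 J.Q * J.d 3 s)))
    + 2 * (J.d 3 s * ((1 / 6 : ℝ) • (J.d 2 (J.d 2 J.Q) * J.d 3 s) - J.d 1 s)) := by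
  simp only [gradSq, grad, h_apply, Fin.sum_univ_four]
  simp [htab, D]
  algebra

/-- The curvature of the metric `s⁻² g`. -/
theorem curv_rescaled {r s : R} (hrs : r * s = 1) (a b c e : Fin 4) :
    curv J.d (chr J.d (r ^ 2 • J.g) (s ^ 2 • J.h)) a b c e = J.weyl a b c e
      + r * ((1 : Matrix (Fin 4) (Fin 4) R) a c * J.almostEinstein s b e
        - (1 : Matrix (Fin 4) (Fin 4) R) a e * J.almostEinstein s b c
        + J.g b e * ∑ f, J.h a f * J.almostEinstein s c f
        - J.g b c * ∑ f, J.h a f * J.almostEinstein s e f)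
      + r ^ 2 * J.gradSq s * ((1 : Matrix (Fin 4) (Fin 4) R) a e * J.g b c
          - (1 : Matrix (Fin 4) (Fin 4) R) a c * J.g b e) := by
  rw [curv_conformal J.comm J.g_symm J.g_mul_h J.h_mul_g hrs, curv_g]
  rw [J.almostEinstein_symm s b e, J.almostEinstein_symm s b c]
  have h1 : ∀ c, ∑ f, J.h a f * J.almostEinstein s c f
      = ∑ f, J.h a f * hess J.d (chr J.d J.g J.h) s c f + s * J.mixedSchouten a c := fun c => by
    simp only [almostEinstein, mixedSchouten, mul_add, Finset.sum_add_distrib, Finset.mul_sum]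
    congr 1
    exact Finset.sum_congr rfl fun _ _ => by ring
  rw [h1 c, h1 e, J.schouten_symm b e, J.schouten_symm b c]
  simp only [almostEinstein, gradSq]
  linear_combination -(J.schouten e b * (1 : Matrix (Fin 4) (Fin 4) R) a c
    - J.schouten c b * (1 : Matrix (Fin 4) (Fin 4) R) a e + J.g b e * J.mixedSchouten a c
    - J.g b c * J.mixedSchouten a e) * hrs

theorem weyl_trace (b e : Fin 4) : ∑ a, J.weyl a b a e = 0 := by
  simp only [weyl, Fin.sum_univ_four]
  fin_cases b <;> fin_cases e <;> simp [t1, t2, t3, e1, e2, e4] <;> algebra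

/-- The Ricci tensor of the metric `s⁻² g`. -/
theorem ricci_rescaled {r s : R} (hrs : r * s = 1) (b e : Fin 4) :
    ∑ a, curv J.d (chr J.d (r ^ 2 • J.g) (s ^ 2 • J.h)) a b a e
      = 2 * r * J.almostEinstein s b e
        + (r * J.almostEinsteinTrace s - 3 * r ^ 2 * J.gradSq s) * J.g b e := by
  have h1 : ∑ a, J.g b a * ∑ f, J.h a f * J.almostEinstein s e f = J.almostEinstein s b e := by
    have h2 : ∀ f, ∑ a, J.g b a * J.h a f = (1 : Matrix (Fin 4) (Fin 4) R) b f := fun f => by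
      rw [← J.g_mul_h, Matrix.mul_apply]
    simp only [Finset.mul_sum]
    rw [Finset.sum_comm]
    simp only [← mul_assoc, ← Finset.sum_mul, h2, Matrix.one_apply, ite_mul, one_mul, zero_mul,
      Finset.sum_ite_eq, Finset.mem_univ, if_true]
    exact J.almostEinstein_symm s e b
  have h3 : ∀ u : Fin 4 → R, ∑ a, (1 : Matrix (Fin 4) (Fin 4) R) a e * u a = u e := fun u => by
    simp [Matrix.one_apply]
  simp only [J.curv_rescaled hrs, Matrix.one_apply_eq, Finset.sum_add_distrib, Finset.sum_sub_distrib,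
    ← Finset.mul_sum, weyl_trace, h1, h3, almostEinsteinTrace]
  simp only [Finset.sum_const, Finset.card_univ, Fintype.card_fin, nsmul_eq_mul]
  push_cast
  ring

end JetAlgebra

/-! ### The two kinds of Einstein scales and their integrability conditions -/

namespace JetAlgebra

variable {R : Type*} [CommRing R] [Algebra ℝ R] (J : JetAlgebra R)

theorem d_D (k : Fin 4) (f : R) :
    J.d k (J.D f) = J.D (J.d k f) + J.d k J.p * J.d 1 f + J.d k J.Q * J.d 2 f := by
  simp only [D, map_add, Derivation.leibniz, smul_eq_mul, J.comm k]
  ring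

theorem D_mul (f g : R) : J.D (f * g) = f * J.D g + g * J.D f := by
  simp only [D, Derivation.leibniz, smul_eq_mul]; ring

theorem D_add (f g : R) : J.D (f + g) = J.D f + J.D g := by simp only [D, map_add]; ring

theorem D_sub (f g : R) : J.D (f - g) = J.D f - J.D g := by simp only [D, map_sub]; ring

theorem D_neg (f : R) : J.D (-f) = -J.D f := by simp only [D, map_neg]; ring

theorem D_smul (c : ℝ) (f : R) : J.D (c • f) = c • J.D f := by
  simp only [D, Derivation.map_smul]; algebra

theorem D_zero : J.D 0 = 0 := by simp [D]

theorem D_one : J.D 1 = 0 := by simp [D]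

/-- `σ = A(x, y, p) e^{ψ/2}` is such that `σ⁻² g` is Einstein. -/
structure IsPlus (a : R) : Prop where
  d3 : J.d 3 a = (1 / 2 : ℝ) • a
  d22 : J.d 2 (J.d 2 a) = 0
  D : J.D a = (1 / 3 : ℝ) • (J.d 2 J.Q * a)

/-- The operator of the scale equation. -/
def L (b : R) : R :=
  J.D (J.D b) - (1 / 3 : ℝ) • (J.d 2 J.Q * J.D b)
    + ((1 / 3 : ℝ) • J.D (J.d 2 J.Q) - J.d 1 J.Q - (2 / 9 : ℝ) • J.d 2 J.Q ^ 2) * b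

/-- `σ = A(x, y, p) e^{-ψ/2}` is such that `σ⁻² g` is Einstein. -/
structure IsMinus (b : R) : Prop where
  d3 : J.d 3 b = -((1 / 2 : ℝ) • b)
  d2 : J.d 2 b = 0
  L : J.L b = 0

variable {J}

section IsPlus
variable {a : R} (ha : J.IsPlus a)
include ha

theorem IsPlus.E11 : J.E11 a = 0 := ha.d22

theorem IsPlus.E14 : J.E14 a = 0 := by
  rw [JetAlgebra.E14, ha.d3, Derivation.map_smul, sub_self]

theorem IsPlus.E44 : J.E44 a = 0 := by
  rw [JetAlgebra.E44, ha.d3, Derivation.map_smul, ha.d3]; algebra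

theorem IsPlus.E24 : J.E24 a = 0 := by
  simp only [JetAlgebra.E24, ha.d3, Derivation.map_smul, D_smul, ha.D]; algebra

theorem IsPlus.E22 : J.E22 a = 0 := by
  simp only [JetAlgebra.E22, ha.d3, Derivation.map_smul, D_smul, ha.D, D_mul]; algebra

/-- The `p`-derivative of `D a = Q_p a/3`, using `[∂_p, D] = ∂_y + Q_p ∂_p`. -/
theorem IsPlus.d2D : J.D (J.d 2 a) + J.d 1 a + J.d 2 J.Q * J.d 2 a
    = (1 / 3 : ℝ) • (J.d 2 J.Q * J.d 2 a + J.d 2 (J.d 2 J.Q) * a) := by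
  have h := congrArg (J.d 2) ha.D
  rw [d_D, J.d2_p] at h
  simp only [Derivation.map_smul, Derivation.leibniz, smul_eq_mul] at h
  linear_combination (norm := algebra) h

/-- The second `p`-derivative of the equation for `D a`. Because `a_pp = 0`, the only second
derivative left is `a_py`, which occurs twice. -/
theorem IsPlus.d12 : J.d 1 (J.d 2 a)
    = (1 / 6 : ℝ) • (J.d 2 (J.d 2 (J.d 2 J.Q)) * a) - (1 / 6 : ℝ) • (J.d 2 (J.d 2 J.Q) * J.d 2 a) := by
  have h := congrArg (J.d 2) ha.d2D
  simp only [map_add, d_D, J.d2_p, ha.d22, D_zero, J.d21] at h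
  simp only [Derivation.map_smul, Derivation.leibniz, smul_eq_mul, map_add, ha.d22] at h
  linear_combination (norm := algebra) (1 / 2 : ℝ) • h

theorem IsPlus.E13 : J.E13 a = 0 := by
  simp only [JetAlgebra.E13, ha.d3, Derivation.map_smul, ha.d12]; algebra

/-- A third `p`-derivative removes every derivative of `a`: the left side is `a_ppy = 0` and the two
terms `Q_ppp a_p` cancel, leaving `Q_pppp a`. -/
theorem IsPlus.w2_mul : J.w2 * a = 0 := by
  have h := congrArg (J.d 2) ha.d12
  simp only [J.d21, ha.d22, map_zero, Derivation.map_smul, Derivation.leibniz, smul_eq_mul,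
    map_sub] at h
  rw [w2]
  linear_combination (norm := algebra) -(6 : ℝ) • h

/-- The `y`-derivative of the equation for `D a`. -/
theorem IsPlus.E23 : J.E23 a = 0 := by
  have h := congrArg (J.d 1) ha.D
  simp only [d_D, J.d1_p, Derivation.map_smul, Derivation.leibniz, smul_eq_mul] at h
  simp only [JetAlgebra.E23, ha.d3, Derivation.map_smul, D_smul, ha.D]
  linear_combination (norm := algebra) -h

/-- The quantity `D a_py` is obtained in two ways, from `∂_y` of `d2D` and from `D` of `d12`.
Comparing them expresses `a_yy` through lower order terms. -/
theorem IsPlus.E33 : J.E33 a = 0 := by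
  have h1 := congrArg (J.d 1) ha.d2D
  have h2 := congrArg J.D ha.d12
  have h3 := ha.d2D
  have h4 := ha.d12
  simp only [map_add, d_D, J.d1_p, Derivation.map_smul, Derivation.leibniz, smul_eq_mul,
    ha.d22] at h1
  simp only [D_sub, D_mul, D_smul, ha.D] at h2
  simp only [JetAlgebra.E33, ha.d3, Derivation.map_smul, ha.D]
  linear_combination (norm := algebra) h1 - h2 + (1 / 6 : ℝ) • (J.d 2 (J.d 2 J.Q) * h3)
    - (2 / 3 : ℝ) • (J.d 2 J.Q * h4)

theorem IsPlus.E34_eq : J.E34 a = (1 / 24 : ℝ) • (J.d 2 (J.d 2 J.Q) * a) - (1 / 2 : ℝ) • J.d 1 a := by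
  simp only [JetAlgebra.E34, ha.d3, Derivation.map_smul]; algebra

theorem IsPlus.E12_eq : J.E12 a = J.E34 a := by
  rw [ha.E34_eq]
  simp only [JetAlgebra.E12, ha.d3, Derivation.map_smul]
  linear_combination (norm := algebra) ha.d2D

/-- The value of `|da|²` for which the scalar curvature of `a⁻² g` vanishes; it is used in
`ricci_rescaled_eq_zero`. -/
theorem IsPlus.gradSq : J.gradSq a = 2 * a * J.E34 a := by
  rw [ha.E34_eq, gradSq_eq, ha.d3, ha.D]; algebra

theorem IsPlus.almostEinstein (x y : Fin 4) : J.almostEinstein a x y = J.E34 a * J.g x y := by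
  rw [almostEinstein_eq, g_eq_symTensor, ha.E11, ha.E12_eq, ha.E13, ha.E14, ha.E22, ha.E23, ha.E24,
    ha.E33, ha.E44]

end IsPlus

section IsMinus
variable {b : R} (hb : J.IsMinus b)
include hb

theorem IsMinus.d2k (k : Fin 4) : J.d 2 (J.d k b) = 0 := by
  rw [J.comm, hb.d2, map_zero]

theorem IsMinus.E22_eq : J.E22 b = J.L b := by
  simp only [JetAlgebra.E22, JetAlgebra.L, hb.d3, Derivation.map_smul, D_smul, D_neg, map_neg]
  algebra

/-- As `b` is independent of `p`, the `p`-derivative of `L b = 0` is again an equation for `b`; it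
is `-2` times this component. -/
theorem IsMinus.E23 : J.E23 b = 0 := by
  have h := congrArg (J.d 2) hb.L
  simp only [JetAlgebra.L, map_add, map_sub, d_D, J.d2_p, Derivation.map_smul, Derivation.leibniz,
    smul_eq_mul, hb.d2, D_zero, J.d21, map_zero, Derivation.leibniz_pow, D_add, D_mul] at h
  simp [J.d1_p, D_one] at h
  simp only [JetAlgebra.E23, hb.d3, Derivation.map_smul, D_smul, D_neg, map_neg, hb.d2]
  linear_combination (norm := algebra) -(1 / 2 : ℝ) • h

theorem IsMinus.E23_eq : J.D (J.d 1 b) = -((1 / 3 : ℝ) • (J.d 2 J.Q * J.d 1 b))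
    + (1 / 6 : ℝ) • (J.d 2 (J.d 2 J.Q) * J.D b) + ((1 / 3 : ℝ) • J.d 1 (J.d 2 J.Q)
      - (1 / 6 : ℝ) • J.D (J.d 2 (J.d 2 J.Q))
      + (1 / 18 : ℝ) • (J.d 2 J.Q * J.d 2 (J.d 2 J.Q))) * b := by
  have h := hb.E23
  simp only [JetAlgebra.E23, hb.d3, Derivation.map_smul, D_smul, D_neg, map_neg, hb.d2] at h
  linear_combination (norm := algebra) -h

/-- The second `p`-derivative of `L b = 0`, taken from the solved form `E23_eq`. -/
theorem IsMinus.E33 : J.E33 b = 0 := by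
  have h := congrArg (J.d 2) hb.E23_eq
  simp only [map_add, map_sub, map_neg, d_D, J.d2_p, Derivation.map_smul, Derivation.leibniz,
    smul_eq_mul, hb.d2k, D_zero] at h
  simp only [hb.d2, J.d21, D_zero] at h
  simp only [JetAlgebra.E33, hb.d3, Derivation.map_smul, map_neg, hb.d2]
  linear_combination (norm := algebra) h

/-- `D² b_y` arises both from `∂_y (L b) = 0` and from `D` applied to `E23_eq`. Equating the two and
eliminating `D b_y` and `D² b` by `E23_eq` and `L b = 0` leaves a multiple of `b`, namely `w₁ b`. -/
theorem IsMinus.w1_mul : J.w1 * b = 0 := by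
  have h1 := congrArg (J.d 1) hb.L
  have h2 := congrArg J.D hb.E23_eq
  simp only [JetAlgebra.L, map_add, map_sub, d_D, J.d1_p, Derivation.map_smul, Derivation.leibniz,
    smul_eq_mul, D_zero, map_zero, Derivation.leibniz_pow, D_add, D_mul, J.d2_p, hb.d2,
    nsmul_eq_mul] at h1
  simp only [D_add, D_mul, D_neg, D_sub, D_smul] at h2
  have h3 := hb.E23_eq
  have h4 := hb.L
  rw [JetAlgebra.L] at h4
  rw [w1]
  linear_combination (norm := algebra) -(6 : ℝ) • h1 + (6 : ℝ) • h2 - (4 : ℝ) • (J.d 2 J.Q * h3)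
    + (J.d 2 (J.d 2 J.Q) * h4)

theorem IsMinus.E11 : J.E11 b = 0 := by rw [JetAlgebra.E11, hb.d2, map_zero]

theorem IsMinus.E13 : J.E13 b = 0 := by
  simp only [JetAlgebra.E13, hb.d3, hb.d2, map_neg, Derivation.map_smul, map_zero]; algebra

theorem IsMinus.E14 : J.E14 b = 0 := by
  simp only [JetAlgebra.E14, hb.d3, hb.d2, map_neg, Derivation.map_smul]; algebra

theorem IsMinus.E24 : J.E24 b = 0 := by
  simp only [JetAlgebra.E24, hb.d3, map_neg, Derivation.map_smul, D_neg, D_smul]; algebra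

theorem IsMinus.E44 : J.E44 b = 0 := by
  simp only [JetAlgebra.E44, hb.d3, map_neg, Derivation.map_smul]; algebra

theorem IsMinus.E34_eq : J.E34 b = (1 / 24 : ℝ) • (J.d 2 (J.d 2 J.Q) * b) + (1 / 2 : ℝ) • J.d 1 b := by
  simp only [JetAlgebra.E34, hb.d3, Derivation.map_smul, map_neg]; algebra

theorem IsMinus.E12_eq : J.E12 b = J.E34 b := by
  rw [hb.E34_eq]
  simp only [JetAlgebra.E12, hb.d3, Derivation.map_smul, map_neg, hb.d2, D_zero]; algebra

theorem IsMinus.gradSq : J.gradSq b = 2 * b * J.E34 b := by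
  rw [hb.E34_eq, gradSq_eq, hb.d3, hb.d2]; algebra

theorem IsMinus.almostEinstein (x y : Fin 4) : J.almostEinstein b x y = J.E34 b * J.g x y := by
  rw [almostEinstein_eq, g_eq_symTensor, hb.E11, hb.E12_eq, hb.E13, hb.E14, hb.E22_eq, hb.L, hb.E23,
    hb.E24, hb.E33, hb.E44]

end IsMinus

end JetAlgebra

/-! ### Ricci flatness, splitting of the scale, and closed systems -/

namespace JetAlgebra

variable {R : Type*} [CommRing R] [Algebra ℝ R] {J : JetAlgebra R}

theorem sum_h_mul_g (a c : Fin 4) : ∑ f, J.h a f * J.g c f = (1 : Matrix (Fin 4) (Fin 4) R) a c := by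
  rw [← J.h_mul_g, Matrix.mul_apply]
  exact Finset.sum_congr rfl fun f _ => by rw [J.g_symm c f]

theorem almostEinsteinTrace_of {s k : R} (hk : ∀ x y, J.almostEinstein s x y = k * J.g x y) :
    J.almostEinsteinTrace s = 4 * k := by
  have h : ∀ a, ∑ f, J.h a f * J.almostEinstein s a f = k := fun a => by
    simp only [hk, mul_left_comm _ k, ← Finset.mul_sum, sum_h_mul_g, Matrix.one_apply_eq, mul_one]
  simp [almostEinsteinTrace, h]

/-- If `∇∇s + s P` is pure trace and `|ds|²` has the matching value then `s⁻² g` is Ricci flat. -/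
theorem ricci_rescaled_eq_zero {r s k : R} (hrs : r * s = 1)
    (hk : ∀ x y, J.almostEinstein s x y = k * J.g x y) (hN : J.gradSq s = 2 * s * k)
    (b e : Fin 4) : ∑ a, curv J.d (chr J.d (r ^ 2 • J.g) (s ^ 2 • J.h)) a b a e = 0 := by
  rw [J.ricci_rescaled hrs, almostEinsteinTrace_of hk, hk, hN]
  linear_combination -(6 * r * k * J.g b e) * hrs

theorem IsPlus.ricci {r s : R} (hs : J.IsPlus s) (hrs : r * s = 1) (b e : Fin 4) :
    ∑ a, curv J.d (chr J.d (r ^ 2 • J.g) (s ^ 2 • J.h)) a b a e = 0 :=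
  ricci_rescaled_eq_zero hrs hs.almostEinstein hs.gradSq b e

theorem IsMinus.ricci {r s : R} (hs : J.IsMinus s) (hrs : r * s = 1) (b e : Fin 4) :
    ∑ a, curv J.d (chr J.d (r ^ 2 • J.g) (s ^ 2 • J.h)) a b a e = 0 :=
  ricci_rescaled_eq_zero hrs hs.almostEinstein hs.gradSq b e

/-- With zero Weyl tensor the curvature is determined by `∇∇s + s P = k g` and `|ds|² = 2sk`, and
these contributions cancel. -/
theorem IsMinus.curv_eq_zero {r s : R} (hs : J.IsMinus s) (hrs : r * s = 1) (h1 : J.w1 = 0)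
    (h2 : J.w2 = 0) (a b c e : Fin 4) :
    curv J.d (chr J.d (r ^ 2 • J.g) (s ^ 2 • J.h)) a b c e = 0 := by
  have h : ∀ c, ∑ f, J.h a f * J.almostEinstein s c f
      = J.E34 s * (1 : Matrix (Fin 4) (Fin 4) R) a c := fun c => by
    simp only [hs.almostEinstein, mul_left_comm _ (J.E34 s), ← Finset.mul_sum, sum_h_mul_g]
  rw [curv_rescaled J hrs, h, h, hs.gradSq, weyl, h1, h2, hs.almostEinstein, hs.almostEinstein]
  simp only [zero_mul, add_zero, smul_zero]
  linear_combination -(2 * r * J.E34 s * ((1 : Matrix (Fin 4) (Fin 4) R) a c * J.g b e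
    - (1 : Matrix (Fin 4) (Fin 4) R) a e * J.g b c)) * hrs

theorem eq_zero_of_two_mul {x : R} (h : 2 * x = 0) : x = 0 := by
  linear_combination (norm := algebra) (1 / 2 : ℝ) • h

/-- Only the trace-free part is used: `k` absorbs every multiple of `g`, so `m` may be any element
of the ring. The five components listed do not involve the trace and already imply the rest. -/
theorem almostEinstein_components {r s m : R} (hrs : r * s = 1)
    (h : ∀ b e, ∑ a, curv J.d (chr J.d (r ^ 2 • J.g) (s ^ 2 • J.h)) a b a e = m * J.g b e) :
    J.E11 s = 0 ∧ J.E14 s = 0 ∧ J.E22 s = 0 ∧ J.E24 s = 0 ∧ J.E44 s = 0 := by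
  set k := s * (r * J.almostEinsteinTrace s - 3 * r ^ 2 * J.gradSq s - m) with hk
  have h1 : ∀ a b, J.symTensor (2 * J.E11 s) (2 * J.E12 s + k) (2 * J.E13 s) (2 * J.E14 s)
      (2 * J.E22 s) (2 * J.E23 s) (2 * J.E24 s) (2 * J.E33 s) (2 * J.E34 s + k) (2 * J.E44 s) a b
      = 0 := fun a b => by
    have h2 := h a b
    rw [J.ricci_rescaled hrs] at h2
    have h3 : 2 * J.almostEinstein s a b + k * J.g a b = 0 := by
      rw [hk]; linear_combination s * h2 - 2 * J.almostEinstein s a b * hrs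
    rw [almostEinstein_eq, g_eq_symTensor] at h3
    rw [← h3, symTensor, symTensor, symTensor]; ring
  obtain ⟨h11, -, -, h14, h22, -, h24, -, -, h44⟩ := J.symTensor_eq_zero h1
  exact ⟨eq_zero_of_two_mul h11, eq_zero_of_two_mul h14, eq_zero_of_two_mul h22,
    eq_zero_of_two_mul h24, eq_zero_of_two_mul h44⟩

/-- The component of `s` that scales as `e^{ψ/2}`. -/
def plus (J : JetAlgebra R) (s : R) : R := (1 / 2 : ℝ) • s + J.d 3 s

/-- The component of `s` that scales as `e^{-ψ/2}`. -/
def minus (J : JetAlgebra R) (s : R) : R := (1 / 2 : ℝ) • s - J.d 3 s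

theorem plus_add_minus (s : R) : J.plus s + J.minus s = s := by
  simp only [plus, minus]; algebra

/-- By `E44`, `∂_ψ` acts on `s` with eigenvalues `±1/2`, and `plus`, `minus` are the
eigencomponents. `E14` says that `minus s` is independent of `p`, and `E24` gives the first order
equation for `plus s`. As `E22` is additive and vanishes on `plus s`, it leaves `L (minus s) = 0`.
-/
theorem isPlus_isMinus {s : R} (h11 : J.E11 s = 0) (h14 : J.E14 s = 0) (h22 : J.E22 s = 0)
    (h24 : J.E24 s = 0) (h44 : J.E44 s = 0) : J.IsPlus (J.plus s) ∧ J.IsMinus (J.minus s) := by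
  rw [E11] at h11
  have h33 : J.d 3 (J.d 3 s) = (1 / 4 : ℝ) • s := by
    rw [E44] at h44; linear_combination h44
  have h23 : J.d 2 (J.d 3 s) = (1 / 2 : ℝ) • J.d 2 s := by
    rw [E14] at h14; linear_combination h14
  have hp : J.IsPlus (J.plus s) := by
    refine ⟨?_, ?_, ?_⟩
    · simp only [plus, map_add, Derivation.map_smul, h33]; algebra
    · simp only [plus, map_add, Derivation.map_smul, h23, h11]; algebra
    · rw [E24, h33] at h24
      simp only [plus, D_add, D_smul]
      linear_combination (norm := algebra) h24
  have hm3 : J.d 3 (J.minus s) = -((1 / 2 : ℝ) • J.minus s) := by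
    simp only [minus, map_sub, Derivation.map_smul, h33]; algebra
  have hm2 : J.d 2 (J.minus s) = 0 := by
    simp only [minus, map_sub, Derivation.map_smul, h23]; algebra
  refine ⟨hp, hm3, hm2, ?_⟩
  have hE : J.L (J.minus s) = J.E22 (J.minus s) := by
    simp only [E22, L, hm3, Derivation.map_smul, D_smul, D_neg, map_neg]
    algebra
  have hadd : J.E22 s = J.E22 (J.plus s) + J.E22 (J.minus s) := by
    conv_lhs => rw [← J.plus_add_minus s]
    simp only [E22, map_add, D_add]; algebra
  rw [hE]
  linear_combination h22 - hadd - hp.E22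

/-- The derivatives of `a`, `a_p`, `a_y` are combinations of these functions. -/
theorem IsPlus.closed {a : R} (ha : J.IsPlus a) (k : Fin 4) (j : Fin 3) :
    J.d k (![a, J.d 2 a, J.d 1 a] j) ∈ Ideal.span (Set.range ![a, J.d 2 a, J.d 1 a]) := by
  set I := Ideal.span (Set.range ![a, J.d 2 a, J.d 1 a]) with hI
  -- Membership in the ideal is tested in the quotient ring, where the three generators vanish.
  -- Derivations do not descend to the quotient, so all differentiation takes place before
  -- projecting.
  set π := Ideal.Quotient.mkₐ ℝ I with hπ
  have hmem : ∀ f, f ∈ I ↔ π f = 0 := fun f => Ideal.Quotient.eq_zero_iff_mem.symm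
  have hv : ∀ j, π (![a, J.d 2 a, J.d 1 a] j) = 0 := fun j =>
    (hmem _).1 (Ideal.subset_span ⟨j, rfl⟩)
  have v0 : π a = 0 := hv 0
  have v1 : π (J.d 2 a) = 0 := hv 1
  have v2 : π (J.d 1 a) = 0 := hv 2
  have h0 : J.d 0 a = (1 / 3 : ℝ) • (J.d 2 J.Q * a) - J.p * J.d 1 a - J.Q * J.d 2 a := by
    rw [← ha.D, JetAlgebra.D]; ring
  have h02 : J.d 0 (J.d 2 a) = (1 / 3 : ℝ) • (J.d 2 J.Q * J.d 2 a + J.d 2 (J.d 2 J.Q) * a)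
      - J.d 1 a - J.d 2 J.Q * J.d 2 a - J.p * J.d 1 (J.d 2 a) := by
    have h := ha.d2D
    rw [JetAlgebra.D, ha.d22] at h
    linear_combination h
  have p12 := congrArg π ha.d12
  have p11 := congrArg π ha.E33
  have p02 := congrArg π h02
  have p01 := congrArg π (congrArg (J.d 1) h0)
  rw [J.d10] at p01
  simp only [JetAlgebra.E33, ha.d3, Derivation.map_smul, ha.D, map_add, map_sub, map_smul,
    map_mul, map_zero, Derivation.leibniz, smul_eq_mul, v0, v1, v2, mul_zero, smul_zero, add_zero,
    sub_zero, zero_mul, zero_sub] at p12 p11 p02 p01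
  rw [p12] at p02 p01
  rw [p11] at p01
  rw [hmem]
  fin_cases j <;> fin_cases k <;>
    simp [J.d21, J.d31, J.d32, ha.d3, ha.d22, v0, v1, v2, p12, p11, p02, p01, h0]

/-- The derivatives of `b`, `b_x`, `b_y` are combinations of these functions. -/
theorem IsMinus.closed {b : R} (hb : J.IsMinus b) (k : Fin 4) (j : Fin 3) :
    J.d k (![b, J.d 0 b, J.d 1 b] j) ∈ Ideal.span (Set.range ![b, J.d 0 b, J.d 1 b]) := by
  set I := Ideal.span (Set.range ![b, J.d 0 b, J.d 1 b]) with hI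
  set π := Ideal.Quotient.mkₐ ℝ I with hπ
  have hmem : ∀ f, f ∈ I ↔ π f = 0 := fun f => Ideal.Quotient.eq_zero_iff_mem.symm
  have hv : ∀ j, π (![b, J.d 0 b, J.d 1 b] j) = 0 := fun j =>
    (hmem _).1 (Ideal.subset_span ⟨j, rfl⟩)
  have v0 : π b = 0 := hv 0
  have v1 : π (J.d 0 b) = 0 := hv 1
  have v2 : π (J.d 1 b) = 0 := hv 2
  have p11 := congrArg π hb.E33
  have p01 := congrArg π hb.E23
  have p00 := congrArg π hb.L
  simp only [JetAlgebra.E33, JetAlgebra.E23, JetAlgebra.L, hb.d3, Derivation.map_smul, D_smul,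
    D_neg, map_neg, hb.d2] at p11 p01 p00
  simp only [D, map_add, Derivation.leibniz, smul_eq_mul, hb.d2k, J.d0_p, J.d1_p, J.d2_p,
    hb.d2, map_sub, map_smul, map_mul, map_zero, map_neg, map_pow, v0, v1, v2, mul_zero, smul_zero,
    add_zero, sub_zero, zero_mul, zero_add, neg_zero, J.d10] at p11 p01 p00
  simp only [p11, mul_zero, add_zero, neg_eq_zero] at p01
  simp only [p11, p01, mul_zero, add_zero] at p00
  rw [hmem]
  fin_cases j <;> fin_cases k <;>
    simp [J.d10, J.d30, J.d31, hb.d3, hb.d2, hb.d2k, v0, v1, v2, p11, p01, p00]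

end JetAlgebra

/-! ### Rescaling of coordinates -/

section Rescale

variable {R : Type*} [CommRing R] [Algebra ℝ R] {n : ℕ}

/-- A diagonal linear change of coordinates with constant factors produces no inhomogeneous term, so
the Christoffel symbols scale like a tensor. It is needed for `ψ = (2i/3)φ`. -/
theorem chr_rescale {d d' : Fin n → Derivation ℝ R R} {g h g' h' : Matrix (Fin n) (Fin n) R}
    {s t : Fin n → ℝ} (hst : ∀ k, s k * t k = 1) (hd : ∀ k f, d k f = t k • d' k f)
    (hg : ∀ a b, g a b = (t a * t b) • g' a b) (hh : ∀ a b, h a b = (s a * s b) • h' a b)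
    (a b c : Fin n) : chr d g h a b c = (s a * t b * t c) • chr d' g' h' a b c := by
  unfold chr
  rw [smul_comm (s a * t b * t c) (1 / 2 : ℝ) (_ : R),
    Finset.smul_sum (r := s a * t b * t c)]
  congr 1
  refine Finset.sum_congr rfl fun e _ => ?_
  simp only [hd, hg, hh, Derivation.map_smul]
  have key : ∀ x y : R, (s a * s e * (t e * (t b * t c))) • (x * y) = (s a * t b * t c) • (x * y) :=
    fun x y => by
    congr 1
    linear_combination s a * t b * t c * hst e
  have := key (h' a e) (d' c (g' e b) + d' b (g' e c) - d' e (g' b c))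
  rw [← this]
  algebra

theorem curv_rescale {d d' : Fin n → Derivation ℝ R R} {Γ Γ' : Fin n → Fin n → Fin n → R}
    {s t : Fin n → ℝ} (hst : ∀ k, s k * t k = 1) (hd : ∀ k f, d k f = t k • d' k f)
    (hΓ : ∀ a b c, Γ a b c = (s a * t b * t c) • Γ' a b c) (a b c e : Fin n) :
    curv d Γ a b c e = (s a * t b * t c * t e) • curv d' Γ' a b c e := by
  unfold curv
  rw [smul_add, Finset.smul_sum]
  congr 1
  · simp only [hd, hΓ, Derivation.map_smul]; algebra
  · refine Finset.sum_congr rfl fun f _ => ?_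
    have key : ∀ x : R, (s a * t c * t b * t e * (s f * t f)) • x
        = (s a * t b * t c * t e) • x := fun x => by rw [hst f]; congr 1; ring
    rw [← key, hΓ, hΓ, hΓ, hΓ]
    algebra

end Rescale

/-! ### The ring of smooth functions on an open set -/

section Smooth

variable {n : ℕ} {U : Set (Fin n → ℝ)}

theorem pd_congr (hU : IsOpen U) {F G : (Fin n → ℝ) → ℝ} (h : ∀ z ∈ U, F z = G z) (k : Fin n)
    {z : Fin n → ℝ} (hz : z ∈ U) : pd k F z = pd k G z := by
  unfold pd
  rw [(Filter.eventuallyEq_of_mem (hU.mem_nhds hz) h).fderiv_eq]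

theorem contDiffOn_pd (hU : IsOpen U) {F : (Fin n → ℝ) → ℝ} (hF : ContDiffOn ℝ ∞ F U) (k : Fin n) :
    ContDiffOn ℝ ∞ (pd k F) U :=
  (hF.fderiv_of_isOpen hU le_rfl).clm_apply contDiffOn_const

theorem differentiableAt_of_contDiffOn (hU : IsOpen U) {F : (Fin n → ℝ) → ℝ}
    (hF : ContDiffOn ℝ ∞ F U) {z : Fin n → ℝ} (hz : z ∈ U) : DifferentiableAt ℝ F z :=
  (hF.contDiffAt (hU.mem_nhds hz)).differentiableAt (by simp)

theorem pd_add (k : Fin n) {F G : (Fin n → ℝ) → ℝ} {z : Fin n → ℝ} (hF : DifferentiableAt ℝ F z)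
    (hG : DifferentiableAt ℝ G z) : pd k (fun w => F w + G w) z = pd k F z + pd k G z := by
  unfold pd
  rw [fderiv_fun_add hF hG]; rfl

theorem pd_mul (k : Fin n) {F G : (Fin n → ℝ) → ℝ} {z : Fin n → ℝ} (hF : DifferentiableAt ℝ F z)
    (hG : DifferentiableAt ℝ G z) :
    pd k (fun w => F w * G w) z = F z * pd k G z + G z * pd k F z := by
  unfold pd
  rw [fderiv_fun_mul hF hG]; rfl

theorem pd_const (k : Fin n) (c : ℝ) (z : Fin n → ℝ) : pd k (fun _ => c) z = 0 := by
  simp [pd]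

theorem pd_comm (hU : IsOpen U) {F : (Fin n → ℝ) → ℝ} (hF : ContDiffOn ℝ ∞ F U) (k l : Fin n)
    {z : Fin n → ℝ} (hz : z ∈ U) : pd k (pd l F) z = pd l (pd k F) z := by
  have hz' := hU.mem_nhds hz
  have hd : DifferentiableAt ℝ (fderiv ℝ F) z :=
    ((hF.fderiv_of_isOpen hU (m := ∞) le_rfl).contDiffAt hz').differentiableAt (by simp)
  have key : ∀ k l, pd k (pd l F) z
      = fderiv ℝ (fderiv ℝ F) z (Pi.single k 1) (Pi.single l 1) := fun k l => by
    unfold pd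
    rw [fderiv_clm_apply hd (differentiableAt_const _)]
    simp
  rw [key, key]
  exact ((hF.contDiffAt hz').isSymmSndFDerivAt (by simpa using WithTop.coe_le_coe.2 (le_top (a := (2 : ℕ∞))))) _ _

/-- The algebra of smooth functions on `U`. -/
def smoothFn (U : Set (Fin n → ℝ)) : Subalgebra ℝ (U → ℝ) where
  carrier := {f | ∃ F : (Fin n → ℝ) → ℝ, ContDiffOn ℝ ∞ F U ∧ ∀ z : U, f z = F z}
  mul_mem' := by
    rintro f g ⟨F, hF, hf⟩ ⟨G, hG, hg⟩
    exact ⟨fun z => F z * G z, hF.mul hG, fun z => by simp [hf, hg]⟩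
  add_mem' := by
    rintro f g ⟨F, hF, hf⟩ ⟨G, hG, hg⟩
    exact ⟨fun z => F z + G z, hF.add hG, fun z => by simp [hf, hg]⟩
  algebraMap_mem' c := ⟨fun _ => c, contDiffOn_const, fun _ => rfl⟩

namespace smoothFn

/-- The element of `smoothFn U` given by a function that is smooth on `U`. -/
def mk (F : (Fin n → ℝ) → ℝ) (hF : ContDiffOn ℝ ∞ F U) : smoothFn U :=
  ⟨fun z => F z, F, hF, fun _ => rfl⟩

/-- A function that represents `f`. -/
def out (f : smoothFn U) : (Fin n → ℝ) → ℝ := f.2.choose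

theorem contDiffOn_out (f : smoothFn U) : ContDiffOn ℝ ∞ (out f) U := f.2.choose_spec.1

theorem out_apply (f : smoothFn U) (z : U) : (out f) z = f.1 z := (f.2.choose_spec.2 z).symm

theorem mk_apply (F : (Fin n → ℝ) → ℝ) (hF : ContDiffOn ℝ ∞ F U) (z : U) : (mk F hF).1 z = F z :=
  rfl

theorem ext_iff' {f g : smoothFn U} : f = g ↔ ∀ z : U, f.1 z = g.1 z := by
  rw [Subtype.ext_iff, funext_iff]

theorem ext {f g : smoothFn U} (h : ∀ z : U, f.1 z = g.1 z) : f = g := ext_iff'.2 h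

theorem add_apply (f g : smoothFn U) (z : U) : (f + g).1 z = f.1 z + g.1 z := rfl
theorem sub_apply (f g : smoothFn U) (z : U) : (f - g).1 z = f.1 z - g.1 z := rfl
theorem mul_apply (f g : smoothFn U) (z : U) : (f * g).1 z = f.1 z * g.1 z := rfl
theorem neg_apply (f : smoothFn U) (z : U) : (-f).1 z = -f.1 z := rfl
theorem smul_apply (c : ℝ) (f : smoothFn U) (z : U) : (c • f).1 z = c * f.1 z := rfl
theorem pow_apply (f : smoothFn U) (m : ℕ) (z : U) : (f ^ m).1 z = f.1 z ^ m := rfl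
theorem zero_apply (z : U) : (0 : smoothFn U).1 z = 0 := rfl
theorem one_apply (z : U) : (1 : smoothFn U).1 z = 1 := rfl

/-- Evaluation at a point, as a ring homomorphism. -/
def eval (z : U) : smoothFn U →ₐ[ℝ] ℝ :=
  (Pi.evalAlgHom ℝ (fun _ : U => ℝ) z).comp (smoothFn U).val

theorem sum_apply {ι : Type*} (s : Finset ι) (f : ι → smoothFn U) (z : U) :
    (∑ j ∈ s, f j).1 z = ∑ j ∈ s, (f j).1 z :=
  map_sum (eval z) f s

/-- The partial derivatives as derivations of `smoothFn U`. -/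
def der (hU : IsOpen U) (k : Fin n) : Derivation ℝ (smoothFn U) (smoothFn U) :=
  Derivation.mk'
    { toFun := fun f => mk (pd k (out f)) (contDiffOn_pd hU (contDiffOn_out f) k)
      map_add' := fun f g => ext fun z => by
        have h : ∀ w ∈ U, (out (f + g)) w = (out f) w + (out g) w := fun w hw => by
          rw [out_apply _ ⟨w, hw⟩, out_apply _ ⟨w, hw⟩, out_apply _ ⟨w, hw⟩, add_apply]
        rw [mk_apply, add_apply, mk_apply, mk_apply, pd_congr hU h k z.2,
          pd_add k (differentiableAt_of_contDiffOn hU (contDiffOn_out f) z.2)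
            (differentiableAt_of_contDiffOn hU (contDiffOn_out g) z.2)]
      map_smul' := fun c f => ext fun z => by
        have h : ∀ w ∈ U, (out (c • f)) w = c * (out f) w := fun w hw => by
          rw [out_apply _ ⟨w, hw⟩, out_apply _ ⟨w, hw⟩, smul_apply]
        rw [mk_apply, RingHom.id_apply, smul_apply, mk_apply, pd_congr hU h k z.2,
          pd_mul k (differentiableAt_const c)
            (differentiableAt_of_contDiffOn hU (contDiffOn_out f) z.2), pd_const]
        ring }
    fun f g => ext fun z => by
      have h : ∀ w ∈ U, (out (f * g)) w = (out f) w * (out g) w := fun w hw => by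
        rw [out_apply _ ⟨w, hw⟩, out_apply _ ⟨w, hw⟩, out_apply _ ⟨w, hw⟩, mul_apply]
      change pd k (out (f * g)) z = f.1 z * pd k (out g) z + g.1 z * pd k (out f) z
      rw [pd_congr hU h k z.2,
          pd_mul k (differentiableAt_of_contDiffOn hU (contDiffOn_out f) z.2)
            (differentiableAt_of_contDiffOn hU (contDiffOn_out g) z.2), out_apply, out_apply]

/-- `der` is computed from a chosen representative, but on an open set the derivative depends only
on the values there. -/
theorem pd_eq_der (hU : IsOpen U) {F : (Fin n → ℝ) → ℝ} {f : smoothFn U}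
    (h : ∀ z : U, F z = f.1 z) (k : Fin n) (z : U) : pd k F z = (der hU k f).1 z :=
  pd_congr hU (fun w hw => (h ⟨w, hw⟩).trans ((out_apply f) ⟨w, hw⟩).symm) k z.2

theorem der_comm (hU : IsOpen U) (k l : Fin n) (f : smoothFn U) :
    der hU k (der hU l f) = der hU l (der hU k f) := ext fun z => by
  have h : ∀ l, ∀ w : U, pd l (out f) w = (der hU l f).1 w := fun l w =>
    pd_eq_der hU (out_apply f) l w
  rw [← pd_eq_der hU (h l), ← pd_eq_der hU (h k), pd_comm hU (contDiffOn_out f) k l z.2]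

end smoothFn

open smoothFn

/-- The bridge from analysis to algebra: any inverse over the ring of smooth functions evaluates
pointwise to the matrix inverse. -/
theorem christoffel_eq_chr (hU : IsOpen U) {g : (Fin n → ℝ) → Matrix (Fin n) (Fin n) ℝ}
    {g' h' : Matrix (Fin n) (Fin n) (smoothFn U)} (hg : ∀ (z : U) a b, g z a b = (g' a b).1 z)
    (hgh : g' * h' = 1) (a b c : Fin n) (z : U) :
    christoffel g a b c z = (chr (der hU) g' h' a b c).1 z := by
  have hinv : (g z)⁻¹ = Matrix.of fun a b => (h' a b).1 z := by
    refine Matrix.inv_eq_right_inv ?_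
    ext a b
    have h1 := congrArg (fun M : Matrix (Fin n) (Fin n) (smoothFn U) => (M a b).1 z) hgh
    simp only [Matrix.mul_apply, sum_apply, smoothFn.mul_apply] at h1
    simp only [Matrix.mul_apply, hg, Matrix.of_apply]
    rw [h1, Matrix.one_apply, Matrix.one_apply]
    split_ifs <;> rfl
  simp only [christoffel, chr, smul_apply, sum_apply, smoothFn.mul_apply, smoothFn.add_apply,
    smoothFn.sub_apply, hinv, Matrix.of_apply]
  congr 1
  refine Finset.sum_congr rfl fun e _ => ?_
  rw [pd_eq_der hU (fun w => hg w e b), pd_eq_der hU (fun w => hg w e c),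
    pd_eq_der hU (fun w => hg w b c)]

theorem riemann_eq_curv (hU : IsOpen U) {g : (Fin n → ℝ) → Matrix (Fin n) (Fin n) ℝ}
    {g' h' : Matrix (Fin n) (Fin n) (smoothFn U)} (hg : ∀ (z : U) a b, g z a b = (g' a b).1 z)
    (hgh : g' * h' = 1) (a b c e : Fin n) (z : U) :
    riemann g a b c e z = (curv (der hU) (chr (der hU) g' h') a b c e).1 z := by
  have hc := christoffel_eq_chr hU hg hgh
  simp only [riemann, curv, smoothFn.add_apply, smoothFn.sub_apply, sum_apply, smoothFn.mul_apply,
    hc]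
  rw [pd_eq_der hU (hc a b e), pd_eq_der hU (hc a b c)]

end Smooth

open smoothFn

/-! ### Closed linear systems along line segments -/

section Path

variable {n : ℕ} {U : Set (Fin n → ℝ)}

theorem fderiv_eq_sum_pd (F : (Fin n → ℝ) → ℝ) (z w : Fin n → ℝ) :
    fderiv ℝ F z w = ∑ k, w k * pd k F z := by
  conv_lhs => rw [pi_eq_sum_univ' w, map_sum]
  refine Finset.sum_congr rfl fun k _ => ?_
  rw [map_smul, smul_eq_mul, pd]

theorem hasDerivAt_out_segment (hU : IsOpen U) (f : smoothFn U) (z w : Fin n → ℝ) {t : ℝ}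
    (ht : z + t • w ∈ U) :
    HasDerivAt (fun t => out f (z + t • w)) (∑ k, w k * (der hU k f).1 ⟨z + t • w, ht⟩) t := by
  have h1 := (differentiableAt_of_contDiffOn hU (contDiffOn_out f) ht).hasFDerivAt
  have h2 : HasDerivAt (fun t : ℝ => z + t • w) w t := by
    simpa using ((hasDerivAt_id t).smul_const w).const_add z
  have h3 := h1.comp_hasDerivAt t h2
  rw [fderiv_eq_sum_pd] at h3
  exact h3

theorem segment_mem (hc : Convex ℝ U) {z z' : Fin n → ℝ} (hz : z ∈ U) (hz' : z' ∈ U) {t : ℝ}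
    (ht : t ∈ Set.Icc (0 : ℝ) 1) : z + t • (z' - z) ∈ U := by
  have := hc hz hz' (sub_nonneg.2 ht.2) ht.1 (by ring)
  convert this using 1
  module

/-- A solution of a closed linear first order system that vanishes at a point is zero. -/
theorem eq_zero_of_closed (hU : IsOpen U) (hc : Convex ℝ U) {m : ℕ} {v : Fin m → smoothFn U}
    (hv : ∀ k j, der hU k (v j) ∈ Ideal.span (Set.range v)) {z₀ : U} (h₀ : ∀ j, (v j).1 z₀ = 0)
    (j : Fin m) : v j = 0 := by
  have h1 : ∀ k j, ∃ c : Fin m → smoothFn U, ∑ l, c l * v l = der hU k (v j) := fun k j =>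
    Ideal.mem_span_range_iff_exists_fun.1 (hv k j)
  choose A hA using h1
  refine smoothFn.ext fun z => ?_
  set w : Fin n → ℝ := z.1 - z₀.1 with hw
  have hmem : ∀ t ∈ Set.Icc (0 : ℝ) 1, z₀.1 + t • w ∈ U := fun t ht =>
    segment_mem hc z₀.2 z.2 ht
  -- Along the segment from `z₀` to `z` the closed system becomes a linear ordinary differential
  -- equation with matrix `B`, which is bounded by compactness; zero initial values then force the
  -- zero solution.
  set B : ℝ → Fin m → Fin m → ℝ := fun t j l => ∑ k, w k * out (A k j l) (z₀.1 + t • w) with hB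
  have hpath : Continuous fun t : ℝ => z₀.1 + t • w := by fun_prop
  have hBc : ContinuousOn B (Set.Icc 0 1) := by
    refine continuousOn_pi.2 fun j => continuousOn_pi.2 fun l => ?_
    refine continuousOn_finsetSum _ fun k _ => continuousOn_const.mul ?_
    exact (contDiffOn_out (A k j l)).continuousOn.comp hpath.continuousOn hmem
  obtain ⟨C, hC⟩ := isCompact_Icc.exists_bound_of_continuousOn hBc
  set f : ℝ → Fin m → ℝ := fun t j => out (v j) (z₀.1 + t • w) with hf
  set f' : ℝ → Fin m → ℝ := fun t j => ∑ l, B t j l * f t l with hf'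
  have hder : ∀ t ∈ Set.Icc (0 : ℝ) 1, HasDerivAt f (f' t) t := fun t ht => by
    refine hasDerivAt_pi.2 fun j => ?_
    have h2 : f' t j = ∑ k, w k * (der hU k (v j)).1 ⟨z₀.1 + t • w, hmem t ht⟩ := by
      simp only [hf', hB, ← hA, sum_apply, smoothFn.mul_apply, hf, Finset.sum_mul, Finset.mul_sum]
      rw [Finset.sum_comm]
      refine Finset.sum_congr rfl fun k _ => Finset.sum_congr rfl fun l _ => ?_
      rw [out_apply _ ⟨_, hmem t ht⟩, out_apply _ ⟨_, hmem t ht⟩, mul_assoc]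
    rw [h2]
    exact hasDerivAt_out_segment hU (v j) z₀.1 w (hmem t ht)
  have hC0 : 0 ≤ C := (norm_nonneg _).trans (hC 0 (by simp))
  -- The sup norm is used, so summing `m` entries costs the factor `m`.
  have hbound : ∀ t ∈ Set.Ico (0 : ℝ) 1, ‖f' t‖ ≤ (m * C) * ‖f t‖ := fun t ht => by
    refine (pi_norm_le_iff_of_nonneg (by positivity)).2 fun j => ?_
    calc ‖f' t j‖ ≤ ∑ l, ‖B t j l * f t l‖ := norm_sum_le _ _
      _ ≤ ∑ _l : Fin m, C * ‖f t‖ := by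
          refine Finset.sum_le_sum fun l _ => ?_
          rw [norm_mul]
          gcongr
          · exact ((norm_le_pi_norm _ l).trans (norm_le_pi_norm _ j)).trans
              (hC t (Set.Ico_subset_Icc_self ht))
          · exact norm_le_pi_norm _ l
      _ = (m * C) * ‖f t‖ := by simp [mul_assoc]
  have hzero := eq_zero_of_abs_deriv_le_mul_abs_self_of_eq_zero_right (f := f) (f' := f')
    (fun t ht => (hder t ht).continuousAt.continuousWithinAt)
    (fun t ht => (hder t (Set.Ico_subset_Icc_self ht)).hasDerivWithinAt)
    (by
      funext j
      have := out_apply (v j) z₀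
      simp only [hf, zero_smul, add_zero, this, h₀, Pi.zero_apply])
    hbound 1 (by simp)
  have h2 := congrFun hzero j
  simp only [hf, hw, one_smul, add_sub_cancel] at h2
  rw [← out_apply, h2]; rfl

/-- A function does not depend on the coordinates in which its derivative vanishes. -/
theorem apply_eq_of_der_eq_zero (hU : IsOpen U) (hc : Convex ℝ U) {f : smoothFn U} {z z' : U}
    (h : ∀ k, z.1 k = z'.1 k ∨ der hU k f = 0) : f.1 z = f.1 z' := by
  set w : Fin n → ℝ := z'.1 - z.1 with hw
  have hmem : ∀ t ∈ Set.Icc (0 : ℝ) 1, z.1 + t • w ∈ U := fun t ht => segment_mem hc z.2 z'.2 ht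
  have hder : ∀ t ∈ Set.Icc (0 : ℝ) 1,
      HasDerivAt (fun t => out f (z.1 + t • w) - f.1 z) 0 t := fun t ht => by
    have h2 : ∑ k, w k * (der hU k f).1 ⟨z.1 + t • w, hmem t ht⟩ = 0 := by
      refine Finset.sum_eq_zero fun k _ => ?_
      rcases h k with h | h
      · simp [hw, h]
      · rw [h]; simp [zero_apply]
    rw [← h2]
    exact (hasDerivAt_out_segment hU f z.1 w (hmem t ht)).sub_const (f.1 z)
  have hzero := eq_zero_of_abs_deriv_le_mul_abs_self_of_eq_zero_right (K := 0) (a := 0) (b := 1)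
    (fun t ht => (hder t ht).continuousAt.continuousWithinAt)
    (fun t ht => (hder t (Set.Ico_subset_Icc_self ht)).hasDerivWithinAt)
    (by simp [out_apply]) (by simp) 1 (by simp)
  simp only [hw, one_smul, add_sub_cancel] at hzero
  rw [out_apply] at hzero
  linarith

end Path

/-! ### Boxes, projections and their sections -/

section Boxes

variable {X Y P Φ : Set ℝ}

theorem isOpen_fefBox (hX : IsOpen X) (hY : IsOpen Y) (hP : IsOpen P) (hΦ : IsOpen Φ) :
    IsOpen (fefBox X Y P Φ) :=
  (hX.preimage (continuous_apply 0)).inter ((hY.preimage (continuous_apply 1)).inter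
    ((hP.preimage (continuous_apply 2)).inter (hΦ.preimage (continuous_apply 3))))

theorem isOpen_jetBox (hX : IsOpen X) (hY : IsOpen Y) (hP : IsOpen P) : IsOpen (jetBox X Y P) :=
  (hX.preimage (continuous_apply 0)).inter ((hY.preimage (continuous_apply 1)).inter
    (hP.preimage (continuous_apply 2)))

theorem isOpen_planeBox (hX : IsOpen X) (hY : IsOpen Y) : IsOpen (planeBox X Y) :=
  (hX.preimage (continuous_apply 0)).inter (hY.preimage (continuous_apply 1))

theorem convex_fefBox (hX : X.OrdConnected) (hY : Y.OrdConnected) (hP : P.OrdConnected)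
    (hΦ : Φ.OrdConnected) : Convex ℝ (fefBox X Y P Φ) := by
  intro z hz w hw a b ha hb hab
  exact ⟨hX.convex hz.1 hw.1 ha hb hab, hY.convex hz.2.1 hw.2.1 ha hb hab,
    hP.convex hz.2.2.1 hw.2.2.1 ha hb hab, hΦ.convex hz.2.2.2 hw.2.2.2 ha hb hab⟩

theorem toJet_mem {z : Fin 4 → ℝ} (hz : z ∈ fefBox X Y P Φ) : toJet z ∈ jetBox X Y P :=
  ⟨hz.1, hz.2.1, hz.2.2.1⟩

theorem toPlane_mem {z : Fin 3 → ℝ} (hz : z ∈ jetBox X Y P) : toPlane z ∈ planeBox X Y :=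
  ⟨hz.1, hz.2.1⟩

/-- `(x, y, p, φ)` from `(x, y, p)` and `φ`. -/
def ofJet (φ : ℝ) (z : Fin 3 → ℝ) : Fin 4 → ℝ := ![z 0, z 1, z 2, φ]

/-- `(x, y, p)` from `(x, y)` and `p`. -/
def ofPlane (p : ℝ) (z : Fin 2 → ℝ) : Fin 3 → ℝ := ![z 0, z 1, p]

theorem ofJet_mem {φ : ℝ} (hφ : φ ∈ Φ) {z : Fin 3 → ℝ} (hz : z ∈ jetBox X Y P) :
    ofJet φ z ∈ fefBox X Y P Φ := ⟨hz.1, hz.2.1, hz.2.2, hφ⟩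

theorem ofPlane_mem {p : ℝ} (hp : p ∈ P) {z : Fin 2 → ℝ} (hz : z ∈ planeBox X Y) :
    ofPlane p z ∈ jetBox X Y P := ⟨hz.1, hz.2, hp⟩

theorem toJet_ofJet (φ : ℝ) (z : Fin 3 → ℝ) : toJet (ofJet φ z) = z := by
  ext k; fin_cases k <;> rfl

theorem toPlane_ofPlane (p : ℝ) (z : Fin 2 → ℝ) : toPlane (ofPlane p z) = z := by
  ext k; fin_cases k <;> rfl

theorem contDiff_toJet : ContDiff ℝ ∞ toJet := by
  refine contDiff_pi.2 fun k => ?_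
  fin_cases k <;> simp only [toJet] <;> exact contDiff_apply ℝ ℝ _

theorem contDiff_toPlane : ContDiff ℝ ∞ toPlane := by
  refine contDiff_pi.2 fun k => ?_
  fin_cases k <;> simp only [toPlane] <;> exact contDiff_apply ℝ ℝ _

theorem contDiff_ofJet (φ : ℝ) : ContDiff ℝ ∞ (ofJet φ) := by
  refine contDiff_pi.2 fun k => ?_
  fin_cases k
  · exact contDiff_apply ℝ ℝ (0 : Fin 3)
  · exact contDiff_apply ℝ ℝ (1 : Fin 3)
  · exact contDiff_apply ℝ ℝ (2 : Fin 3)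
  · exact contDiff_const

theorem contDiff_ofPlane (p : ℝ) : ContDiff ℝ ∞ (ofPlane p) := by
  refine contDiff_pi.2 fun k => ?_
  fin_cases k
  · exact contDiff_apply ℝ ℝ (0 : Fin 2)
  · exact contDiff_apply ℝ ℝ (1 : Fin 2)
  · exact contDiff_const

theorem contDiffOn_comp_toJet {F : (Fin 3 → ℝ) → ℝ} (hF : ContDiffOn ℝ ∞ F (jetBox X Y P)) :
    ContDiffOn ℝ ∞ (fun z => F (toJet z)) (fefBox X Y P Φ) :=
  hF.comp contDiff_toJet.contDiffOn fun _ hz => toJet_mem hz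

theorem contDiffOn_comp_toPlane {F : (Fin 2 → ℝ) → ℝ} (hF : ContDiffOn ℝ ∞ F (planeBox X Y)) :
    ContDiffOn ℝ ∞ (fun z => F (toPlane z)) (jetBox X Y P) :=
  hF.comp contDiff_toPlane.contDiffOn fun _ hz => toPlane_mem hz

/-- `toJet` as a linear map. -/
def toJetL : (Fin 4 → ℝ) →L[ℝ] (Fin 3 → ℝ) :=
  ContinuousLinearMap.pi ![ContinuousLinearMap.proj 0, ContinuousLinearMap.proj 1,
    ContinuousLinearMap.proj 2]

theorem toJetL_apply (z : Fin 4 → ℝ) : toJetL z = toJet z := by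
  ext k; fin_cases k <;> rfl

/-- `toPlane` as a linear map. -/
def toPlaneL : (Fin 3 → ℝ) →L[ℝ] (Fin 2 → ℝ) :=
  ContinuousLinearMap.pi ![ContinuousLinearMap.proj 0, ContinuousLinearMap.proj 1]

theorem toPlaneL_apply (z : Fin 3 → ℝ) : toPlaneL z = toPlane z := by
  ext k; fin_cases k <;> rfl

theorem fderiv_comp_toJet {F : (Fin 3 → ℝ) → ℝ} {z : Fin 4 → ℝ}
    (hF : DifferentiableAt ℝ F (toJet z)) (w : Fin 4 → ℝ) :
    fderiv ℝ (fun z => F (toJet z)) z w = fderiv ℝ F (toJet z) (toJet w) := by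
  simp only [← toJetL_apply] at hF ⊢
  rw [show (fun z => F (toJetL z)) = F ∘ toJetL from rfl,
    (hF.hasFDerivAt.comp z toJetL.hasFDerivAt).fderiv]
  rfl

theorem fderiv_comp_toPlane {F : (Fin 2 → ℝ) → ℝ} {z : Fin 3 → ℝ}
    (hF : DifferentiableAt ℝ F (toPlane z)) (w : Fin 3 → ℝ) :
    fderiv ℝ (fun z => F (toPlane z)) z w = fderiv ℝ F (toPlane z) (toPlane w) := by
  simp only [← toPlaneL_apply] at hF ⊢
  rw [show (fun z => F (toPlaneL z)) = F ∘ toPlaneL from rfl,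
    (hF.hasFDerivAt.comp z toPlaneL.hasFDerivAt).fderiv]
  rfl

theorem pd_comp_toJet {F : (Fin 3 → ℝ) → ℝ} {z : Fin 4 → ℝ} (hF : DifferentiableAt ℝ F (toJet z))
    (k : Fin 3) : pd k.castSucc (fun z => F (toJet z)) z = pd k F (toJet z) := by
  rw [pd, fderiv_comp_toJet hF, pd]
  congr 1
  ext j
  fin_cases k <;> fin_cases j <;> simp [toJet]

theorem pd_three_comp_toJet {F : (Fin 3 → ℝ) → ℝ} {z : Fin 4 → ℝ}
    (hF : DifferentiableAt ℝ F (toJet z)) : pd 3 (fun z => F (toJet z)) z = 0 := by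
  rw [pd, fderiv_comp_toJet hF]
  convert map_zero (fderiv ℝ F (toJet z))
  ext j
  fin_cases j <;> simp [toJet]

theorem pd_comp_toPlane {F : (Fin 2 → ℝ) → ℝ} {z : Fin 3 → ℝ}
    (hF : DifferentiableAt ℝ F (toPlane z)) (k : Fin 2) :
    pd k.castSucc (fun z => F (toPlane z)) z = pd k F (toPlane z) := by
  rw [pd, fderiv_comp_toPlane hF, pd]
  congr 1
  ext j
  fin_cases k <;> fin_cases j <;> simp [toPlane]

theorem pd_two_comp_toPlane {F : (Fin 2 → ℝ) → ℝ} {z : Fin 3 → ℝ}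
    (hF : DifferentiableAt ℝ F (toPlane z)) : pd 2 (fun z => F (toPlane z)) z = 0 := by
  rw [pd, fderiv_comp_toPlane hF]
  convert map_zero (fderiv ℝ F (toPlane z))
  ext j
  fin_cases j <;> simp [toPlane]

end Boxes

/-! ### Linear total differential equations in two variables -/

section Frobenius

open Set Metric

variable {F : Type*} [NormedAddCommGroup F] [NormedSpace ℝ F]

/-- Grönwall's inequality in both time directions; the backward half comes from the reflection `t ↦
-t`. The bounds `ε ≤ 1` and `K ≥ 1` turn the time-dependent estimate into one constant that is
linear in `δ + η`. -/
theorem gronwall_two_sided {f f' : ℝ → F} {t₀ ε K δ η : ℝ} (hε : ε ≤ 1) (hK : 1 ≤ K) (hδ : 0 ≤ δ)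
    (hη : 0 ≤ η) (hf : ∀ t ∈ Ioo (t₀ - ε) (t₀ + ε), HasDerivAt f (f' t) t)
    (hbound : ∀ t ∈ Ioo (t₀ - ε) (t₀ + ε), ‖f' t‖ ≤ K * ‖f t‖ + η) (h₀ : ‖f t₀‖ ≤ δ)
    {t : ℝ} (ht : t ∈ Ioo (t₀ - ε) (t₀ + ε)) : ‖f t‖ ≤ (δ + η) * Real.exp K := by
  have hgr : ∀ x, x ≤ 1 → gronwallBound δ K η x ≤ (δ + η) * Real.exp K := fun x hx => by
    have hexp : Real.exp (K * x) ≤ Real.exp K := Real.exp_le_exp.2 (by nlinarith)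
    rw [gronwallBound_of_K_ne_0 (by linarith)]
    have h1 : η / K ≤ η := div_le_self hη hK
    have h2 : 0 ≤ η / K := by positivity
    have h3 := Real.exp_pos (K * x)
    have h4 : η / K * (Real.exp (K * x) - 1) ≤ η * Real.exp K :=
      calc η / K * (Real.exp (K * x) - 1) ≤ η / K * Real.exp K := by gcongr; linarith
        _ ≤ η * Real.exp K := by gcongr
    have h5 : δ * Real.exp (K * x) ≤ δ * Real.exp K := by gcongr
    simp only
    linarith
  rcases le_total t₀ t with h | h
  · have hsub : ∀ x ∈ Icc t₀ t, x ∈ Ioo (t₀ - ε) (t₀ + ε) := fun x hx =>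
      ⟨by linarith [hx.1, ht.1, ht.2], lt_of_le_of_lt hx.2 ht.2⟩
    exact (norm_le_gronwallBound_of_norm_deriv_right_le
      (fun x hx => (hf x (hsub x hx)).continuousAt.continuousWithinAt)
      (fun x hx => (hf x (hsub x (Ico_subset_Icc_self hx))).hasDerivWithinAt) h₀
      (fun x hx => hbound x (hsub x (Ico_subset_Icc_self hx))) t ⟨h, le_rfl⟩).trans
      (hgr _ (by linarith [ht.2]))
  · have hsub : ∀ x ∈ Icc (-t₀) (-t), -x ∈ Ioo (t₀ - ε) (t₀ + ε) := fun x hx =>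
      ⟨by linarith [hx.2, ht.1], by linarith [hx.1, ht.1, ht.2]⟩
    have hder : ∀ x ∈ Icc (-t₀) (-t), HasDerivAt (fun x => f (-x)) (-f' (-x)) x := fun x hx => by
      simpa [Function.comp_def] using (hf (-x) (hsub x hx)).scomp x (hasDerivAt_neg x)
    have := norm_le_gronwallBound_of_norm_deriv_right_le (δ := δ) (K := K) (ε := η)
      (fun x hx => (hder x hx).continuousAt.continuousWithinAt)
      (fun x hx => (hder x (Ico_subset_Icc_self hx)).hasDerivWithinAt) (by simpa using h₀)
      (fun x hx => by simpa using hbound (-x) (hsub x (Ico_subset_Icc_self hx))) (-t)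
      ⟨by linarith, le_rfl⟩
    rw [neg_neg] at this
    exact this.trans (hgr _ (by linarith [ht.1]))

/-- For a linear equation the existence interval can be chosen independently of the initial value,
which allows all columns of the Frobenius construction to be solved on one interval. -/
theorem exists_linear_ode [CompleteSpace F] {A : ℝ → F →L[ℝ] F} {t₀ ε K : ℝ} (hε : 0 < ε)
    (hK : 0 ≤ K) (hεK : ε * K ≤ 1 / 2) (hA : ContinuousOn A (Icc (t₀ - ε) (t₀ + ε)))
    (hAK : ∀ t ∈ Icc (t₀ - ε) (t₀ + ε), ‖A t‖ ≤ K) (v : F) :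
    ∃ f : ℝ → F, f t₀ = v ∧ ∀ t ∈ Ioo (t₀ - ε) (t₀ + ε), HasDerivAt f (A t (f t)) t := by
  have ht₀ : t₀ ∈ Icc (t₀ - ε) (t₀ + ε) := ⟨by linarith, by linarith⟩
  -- The ball of radius `‖v‖ + 1` about `v` lies in `‖x‖ ≤ 2‖v‖ + 1`, so the speed is at most
  -- `K(2‖v‖ + 1)`. By `εK ≤ 1/2` the path moves at most `‖v‖ + 1/2` and stays in the ball.
  have hPL : IsPicardLindelof (fun t x => A t x) (⟨t₀, ht₀⟩ : Icc (t₀ - ε) (t₀ + ε)) v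
      (‖v‖₊ + 1) 0 (Real.toNNReal K * (2 * ‖v‖₊ + 1)) (Real.toNNReal K) := by
    refine ⟨fun t ht => ?_, fun x _ => hA.clm_apply continuousOn_const, fun t ht x hx => ?_, ?_⟩
    · refine ((A t).lipschitz.weaken ?_).lipschitzOnWith
      rw [← NNReal.coe_le_coe, Real.coe_toNNReal _ hK]
      exact hAK t ht
    · have h1 : ‖x‖ ≤ 2 * ‖v‖ + 1 := by
        have h2 := norm_le_norm_add_norm_sub' x v
        rw [mem_closedBall, dist_eq_norm] at hx
        simp at hx
        linarith
      simp only [NNReal.coe_mul, NNReal.coe_add, NNReal.coe_one, NNReal.coe_ofNat, coe_nnnorm,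
        Real.coe_toNNReal _ hK]
      calc ‖A t x‖ ≤ ‖A t‖ * ‖x‖ := (A t).le_opNorm x
        _ ≤ K * (2 * ‖v‖ + 1) := by gcongr; exact hAK t ht
    · simp only [NNReal.coe_mul, NNReal.coe_add, NNReal.coe_one, NNReal.coe_ofNat, coe_nnnorm,
        Real.coe_toNNReal _ hK, add_sub_cancel_left, sub_sub_cancel, max_self, NNReal.coe_zero,
        sub_zero]
      nlinarith [norm_nonneg v]
  obtain ⟨f, hf, hf'⟩ := hPL.exists_eq_forall_mem_Icc_hasDerivWithinAt₀
  exact ⟨f, hf, fun t ht => (hf' t (Ioo_subset_Icc_self ht)).hasDerivAt (Icc_mem_nhds ht.1 ht.2)⟩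

/-- Uniform first order Taylor estimates on a compact convex set. -/
theorem exists_taylor_bound {E G : Type*} [NormedAddCommGroup E] [NormedSpace ℝ E]
    [NormedAddCommGroup G] [NormedSpace ℝ G] {U B : Set E} (hU : IsOpen U) (hB : IsCompact B)
    (hBc : Convex ℝ B) (hBU : B ⊆ U) {N : E → G} (hN : ContDiffOn ℝ ∞ N U) :
    ∃ C, 0 ≤ C ∧ (∀ z ∈ B, ∀ z' ∈ B, ‖N z' - N z‖ ≤ C * ‖z' - z‖) ∧
      ∀ z ∈ B, ∀ z' ∈ B, ‖N z' - N z - fderiv ℝ N z (z' - z)‖ ≤ C * ‖z' - z‖ ^ 2 := by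
  have hN' : ContDiffOn ℝ ∞ (fderiv ℝ N) U := hN.fderiv_of_isOpen hU le_rfl
  have hN'' : ContDiffOn ℝ ∞ (fderiv ℝ (fderiv ℝ N)) U := hN'.fderiv_of_isOpen hU le_rfl
  obtain ⟨C₁, hC₁⟩ := hB.exists_bound_of_continuousOn (f := fderiv ℝ N) (hN'.continuousOn.mono hBU)
  obtain ⟨C₂, hC₂⟩ := hB.exists_bound_of_continuousOn (f := fderiv ℝ (fderiv ℝ N))
    (hN''.continuousOn.mono hBU)
  have hd : ∀ z ∈ B, DifferentiableAt ℝ N z := fun z hz =>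
    (hN.contDiffAt (hU.mem_nhds (hBU hz))).differentiableAt (by simp)
  have hd' : ∀ z ∈ B, DifferentiableAt ℝ (fderiv ℝ N) z := fun z hz =>
    (hN'.contDiffAt (hU.mem_nhds (hBU hz))).differentiableAt (by simp)
  refine ⟨max 0 (max C₁ C₂), le_max_left _ _, fun z hz z' hz' => ?_, fun z hz z' hz' => ?_⟩
  · refine (hBc.norm_image_sub_le_of_norm_fderiv_le hd hC₁ hz hz').trans ?_
    gcongr
    exact (le_max_left _ _).trans (le_max_right _ _)
  · have hseg : segment ℝ z z' ⊆ B := hBc.segment_subset hz hz'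
    have h1 : ∀ w ∈ segment ℝ z z', ‖fderiv ℝ N w - fderiv ℝ N z‖
        ≤ max 0 (max C₁ C₂) * ‖z' - z‖ := fun w hw => by
      refine (hBc.norm_image_sub_le_of_norm_fderiv_le hd' hC₂ hz (hseg hw)).trans ?_
      have h2 : ‖w - z‖ ≤ ‖z' - z‖ := by
        have := norm_sub_le_of_mem_segment hw
        simpa [norm_sub_rev] using this
      have : C₂ ≤ max 0 (max C₁ C₂) := (le_max_right _ _).trans (le_max_right _ _)
      have h3 : 0 ≤ C₂ := (norm_nonneg _).trans (hC₂ z hz)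
      gcongr
    have := (convex_segment z z').norm_image_sub_le_of_norm_fderiv_le'
      (fun w hw => hd w (hseg hw)) h1 (left_mem_segment ℝ z z') (right_mem_segment ℝ z z')
    rw [sq, ← mul_assoc]
    exact this

/-- A differentiable solution of a smooth linear total differential equation is smooth. -/
theorem contDiffOn_of_total {W : Set (ℝ × ℝ)} (hW : IsOpen W) {M N : ℝ × ℝ → F →L[ℝ] F}
    (hM : ContDiffOn ℝ ∞ M W) (hN : ContDiffOn ℝ ∞ N W) {V : ℝ × ℝ → F}
    (hV : ∀ z ∈ W, HasFDerivAt V ((ContinuousLinearMap.fst ℝ ℝ ℝ).smulRight (M z (V z))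
      + (ContinuousLinearMap.snd ℝ ℝ ℝ).smulRight (N z (V z))) z) : ContDiffOn ℝ ∞ V W := by
  refine contDiffOn_infty.2 fun n => ?_
  -- The derivative of `V` is a smooth expression in `V`, so each order of differentiability yields
  -- the next.
  induction n with
  | zero =>
    exact contDiffOn_zero.2 fun z hz => (hV z hz).continuousAt.continuousWithinAt
  | succ n ih =>
    rw [Nat.cast_succ, contDiffOn_succ_iff_fderiv_of_isOpen hW]
    refine ⟨fun z hz => (hV z hz).differentiableAt.differentiableWithinAt, fun h => by simp at h, ?_⟩
    refine ContDiffOn.congr ?_ fun z hz => (hV z hz).fderiv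
    have hn : (n : ℕ∞ω) ≤ ∞ := WithTop.coe_le_coe.2 le_top
    exact (contDiffOn_const.smulRight ((hM.of_le hn).clm_apply ih)).add
      (contDiffOn_const.smulRight ((hN.of_le hn).clm_apply ih))

end Frobenius

/-! ### Frobenius theorem for linear systems in two variables -/

section Frobenius

open Set Metric Filter Topology Asymptotics

variable {F : Type*} [NormedAddCommGroup F] [NormedSpace ℝ F]

/-- If every column `V x` solves the linear equation `∂V/∂y = N V`, if the row `y = y₀` solves
`∂V/∂x = M V` and if the system is integrable, then every row solves `∂V/∂x = M V`. -/
theorem hasDerivAt_row {U : Set (ℝ × ℝ)} (hU : IsOpen U) {M N : ℝ × ℝ → F →L[ℝ] F}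
    (hM : ContDiffOn ℝ ∞ M U) (hN : ContDiffOn ℝ ∞ N U)
    (hMN : ∀ z ∈ U, fderiv ℝ M z (0, 1) + (M z).comp (N z)
      = fderiv ℝ N z (1, 0) + (N z).comp (M z))
    {x₀ y₀ ε K S : ℝ} (hε : 0 < ε) (hε' : ε ≤ 1) (hK : 1 ≤ K)
    (hB : closedBall (x₀, y₀) ε ⊆ U) (hMK : ∀ z ∈ closedBall (x₀, y₀) ε, ‖M z‖ ≤ K)
    (hNK : ∀ z ∈ closedBall (x₀, y₀) ε, ‖N z‖ ≤ K) {V : ℝ → ℝ → F}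
    (hVS : ∀ x ∈ Ioo (x₀ - ε) (x₀ + ε), ∀ y ∈ Ioo (y₀ - ε) (y₀ + ε), ‖V x y‖ ≤ S)
    (hVy : ∀ x ∈ Ioo (x₀ - ε) (x₀ + ε), ∀ y ∈ Ioo (y₀ - ε) (y₀ + ε),
      HasDerivAt (V x) (N (x, y) (V x y)) y)
    (hVx : ∀ x ∈ Ioo (x₀ - ε) (x₀ + ε), HasDerivAt (fun x => V x y₀) (M (x, y₀) (V x y₀)) x)
    {x : ℝ} (hx : x ∈ Ioo (x₀ - ε) (x₀ + ε)) {y : ℝ} (hy : y ∈ Ioo (y₀ - ε) (y₀ + ε)) :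
    HasDerivAt (fun x => V x y) (M (x, y) (V x y)) x := by
  have hmem : ∀ {x y}, x ∈ Ioo (x₀ - ε) (x₀ + ε) → y ∈ Ioo (y₀ - ε) (y₀ + ε) →
      (x, y) ∈ closedBall (x₀, y₀) ε := fun {x y} hx hy => by
    rw [← closedBall_prod_same, Real.closedBall_eq_Icc, Real.closedBall_eq_Icc]
    exact ⟨Ioo_subset_Icc_self hx, Ioo_subset_Icc_self hy⟩
  have hS : 0 ≤ S := (norm_nonneg _).trans (hVS x hx y hy)
  obtain ⟨C, hC, hN1, hN2⟩ := exists_taylor_bound hU (isCompact_closedBall (x₀, y₀) ε)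
    (convex_closedBall _ _) hB hN
  have hy₀ : y₀ ∈ Ioo (y₀ - ε) (y₀ + ε) := ⟨by linarith, by linarith⟩
  -- `E h y` is the error of the first order expansion in `x` at height `y`. By integrability it
  -- solves `∂E/∂y = N E` up to an error `O(h²)`, so Grönwall transports the smallness of `E h y₀`
  -- to every `y`.
  set E : ℝ → ℝ → F := fun h y => V (x + h) y - V x y - h • M (x, y) (V x y) with hE
  have hest : ∀ h, x + h ∈ Ioo (x₀ - ε) (x₀ + ε) →
      ‖E h y‖ ≤ (‖E h y₀‖ + C * S * (1 + K) * h ^ 2) * Real.exp K := fun h hh => by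
    have hdiff : ∀ y, ((x + h, y) : ℝ × ℝ) - (x, y) = h • ((1, 0) : ℝ × ℝ) := fun y => by
      ext <;> simp
    have hnorm : ∀ y, ‖((x + h, y) : ℝ × ℝ) - (x, y)‖ = |h| := fun y => by
      rw [hdiff, norm_smul]; simp
    have hder : ∀ y ∈ Ioo (y₀ - ε) (y₀ + ε), HasDerivAt (E h)
        (N (x + h, y) (E h y)
          + ((N (x + h, y) - N (x, y) - fderiv ℝ N (x, y) ((x + h, y) - (x, y))) (V x y)
            + h • (N (x + h, y) - N (x, y)) (M (x, y) (V x y)))) y := fun y hy => by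
      have hMy : HasDerivAt (fun y => M (x, y)) (fderiv ℝ M (x, y) (0, 1)) y := by
        have h1 : DifferentiableAt ℝ M (x, y) :=
          (hM.contDiffAt (hU.mem_nhds (hB (hmem hx hy)))).differentiableAt (by simp)
        exact h1.hasFDerivAt.comp_hasDerivAt y
          ((hasDerivAt_const y x).prodMk (hasDerivAt_id y))
      have h2 := ((hVy (x + h) hh y hy).sub (hVy x hx y hy)).sub
        ((hMy.clm_apply (hVy x hx y hy)).const_smul h)
      refine h2.congr_deriv ?_
      -- Integrability replaces `M_y + M N` by `N_x + N M`; the `N_x` term then completes the Taylor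
      -- remainder of `N`.
      have h3 := congrArg (fun A : F →L[ℝ] F => h • A (V x y)) (hMN (x, y) (hB (hmem hx hy)))
      simp only [_root_.add_apply, ContinuousLinearMap.comp_apply] at h3
      rw [h3, hdiff, map_smul]
      simp only [hE, map_sub, map_smul, _root_.sub_apply,
        _root_.smul_apply, smul_add, smul_sub]
      abel
    refine gronwall_two_sided hε' hK (norm_nonneg _) (by positivity) hder (fun y hy => ?_) le_rfl hy
    have hz := hmem hx hy
    have hz' := hmem hh hy
    have hn1 := hN1 _ hz _ hz'
    have hn2 := hN2 _ hz _ hz'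
    rw [hnorm] at hn1 hn2
    refine (norm_add_le _ _).trans (add_le_add ?_ ((norm_add_le _ _).trans ?_))
    · exact ((N _).le_opNorm _).trans (by gcongr; exact hNK _ hz')
    · have hVs := hVS x hx y hy
      have a1 : ‖(N (x + h, y) - N (x, y) - fderiv ℝ N (x, y) ((x + h, y) - (x, y))) (V x y)‖
          ≤ C * |h| ^ 2 * S := (ContinuousLinearMap.le_opNorm _ _).trans (by gcongr)
      have a2 : ‖M (x, y) (V x y)‖ ≤ K * S :=
        (ContinuousLinearMap.le_opNorm _ _).trans (by gcongr; exact hMK _ hz)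
      have a3 : ‖h • (N (x + h, y) - N (x, y)) (M (x, y) (V x y))‖ ≤ |h| * (C * |h| * (K * S)) := by
        rw [norm_smul, Real.norm_eq_abs]
        gcongr
        exact (ContinuousLinearMap.le_opNorm _ _).trans (by gcongr)
      calc _ ≤ C * |h| ^ 2 * S + |h| * (C * |h| * (K * S)) := add_le_add a1 a3
        _ = C * S * (1 + K) * |h| ^ 2 := by ring
        _ = C * S * (1 + K) * h ^ 2 := by rw [sq_abs]
  -- `E h y₀ = o(h)` by the equation on the row `y = y₀`, and the accumulated error is `O(h²)`.
  rw [hasDerivAt_iff_isLittleO_nhds_zero]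
  have hrow := (hasDerivAt_iff_isLittleO_nhds_zero.1 (hVx x hx)).norm_left
  have hsq : (fun h : ℝ => C * S * (1 + K) * h ^ 2) =o[𝓝 0] fun h => h := by
    refine IsLittleO.const_mul_left ?_ _
    simpa [sq] using ((isLittleO_one_iff ℝ).2 (tendsto_id (α := ℝ) (x := 𝓝 0))).mul_isBigO
      (isBigO_refl (fun h : ℝ => h) (𝓝 0))
  have hsum := (hrow.add hsq).const_mul_left (Real.exp K)
  refine IsBigO.trans_isLittleO (IsBigO.of_bound 1 ?_) hsum
  have hev : ∀ᶠ h in 𝓝 (0 : ℝ), x + h ∈ Ioo (x₀ - ε) (x₀ + ε) := by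
    have : Tendsto (fun h => x + h) (𝓝 0) (𝓝 x) := by
      simpa using (tendsto_const_nhds (x := x)).add (tendsto_id (α := ℝ) (x := 𝓝 0))
    exact this.eventually (isOpen_Ioo.mem_nhds hx)
  filter_upwards [hev] with h hh
  rw [one_mul, Real.norm_eq_abs]
  refine (hest h hh).trans (le_trans (le_of_eq ?_) (le_abs_self _))
  simp only [hE]
  ring

/-- Local solvability of integrable linear total differential equations in two variables. -/
theorem exists_total_solution [CompleteSpace F] {U : Set (ℝ × ℝ)} (hU : IsOpen U)
    {M N : ℝ × ℝ → F →L[ℝ] F} (hM : ContDiffOn ℝ ∞ M U) (hN : ContDiffOn ℝ ∞ N U)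
    (hMN : ∀ z ∈ U, fderiv ℝ M z (0, 1) + (M z).comp (N z)
      = fderiv ℝ N z (1, 0) + (N z).comp (M z)) {z₀ : ℝ × ℝ} (hz₀ : z₀ ∈ U) (v : F) :
    ∃ W, IsOpen W ∧ z₀ ∈ W ∧ W ⊆ U ∧ ∃ V : ℝ × ℝ → F, ContDiffOn ℝ ∞ V W ∧ V z₀ = v ∧
      ∀ z ∈ W, HasFDerivAt V ((ContinuousLinearMap.fst ℝ ℝ ℝ).smulRight (M z (V z))
        + (ContinuousLinearMap.snd ℝ ℝ ℝ).smulRight (N z (V z))) z := by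
  obtain ⟨x₀, y₀⟩ := z₀
  obtain ⟨r, hr, hrU⟩ := nhds_basis_closedBall.mem_iff.1 (hU.mem_nhds hz₀)
  obtain ⟨K₁, hK₁⟩ := (isCompact_closedBall (x₀, y₀) r).exists_bound_of_continuousOn
    (hM.continuousOn.mono hrU)
  obtain ⟨K₂, hK₂⟩ := (isCompact_closedBall (x₀, y₀) r).exists_bound_of_continuousOn
    (hN.continuousOn.mono hrU)
  set K := max 1 (max K₁ K₂) with hKdef
  have hK : 1 ≤ K := le_max_left _ _
  have hK0 : 0 < K := by linarith
  -- Small enough for the box to stay in the compact ball and for `εK ≤ 1/2`, as `exists_linear_ode`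
  -- requires.
  set ε := min r (1 / (2 * K)) with hεdef
  have hε : 0 < ε := lt_min hr (by positivity)
  have hεr : ε ≤ r := min_le_left _ _
  have hε2 : ε ≤ 1 / (2 * K) := min_le_right _ _
  have hεK : ε * K ≤ 1 / 2 := by
    calc ε * K ≤ 1 / (2 * K) * K := by gcongr
      _ = 1 / 2 := by field_simp
  have hε1 : ε ≤ 1 := by nlinarith
  have hsub : closedBall (x₀, y₀) ε ⊆ closedBall (x₀, y₀) r := closedBall_subset_closedBall hεr
  have hBU := hsub.trans hrU
  have hMK : ∀ z ∈ closedBall (x₀, y₀) ε, ‖M z‖ ≤ K := fun z hz =>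
    (hK₁ z (hsub hz)).trans ((le_max_left _ _).trans (le_max_right _ _))
  have hNK : ∀ z ∈ closedBall (x₀, y₀) ε, ‖N z‖ ≤ K := fun z hz =>
    (hK₂ z (hsub hz)).trans ((le_max_right _ _).trans (le_max_right _ _))
  have hmem : ∀ {x y}, x ∈ Icc (x₀ - ε) (x₀ + ε) → y ∈ Icc (y₀ - ε) (y₀ + ε) →
      (x, y) ∈ closedBall (x₀, y₀) ε := fun {x y} hx hy => by
    rw [← closedBall_prod_same, Real.closedBall_eq_Icc, Real.closedBall_eq_Icc]
    exact ⟨hx, hy⟩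
  have hx₀ : x₀ ∈ Ioo (x₀ - ε) (x₀ + ε) := ⟨by linarith, by linarith⟩
  have hy₀ : y₀ ∈ Ioo (y₀ - ε) (y₀ + ε) := ⟨by linarith, by linarith⟩
  -- The row through the base point is solved first; its values are then the initial data of the
  -- columns.
  obtain ⟨f, hf₀, hf⟩ := exists_linear_ode (A := fun x => M (x, y₀)) hε hK0.le hεK
    ((hM.continuousOn.mono hBU).comp (by fun_prop)
      fun x hx => hmem hx (Ioo_subset_Icc_self hy₀))
    (fun x hx => hMK _ (hmem hx (Ioo_subset_Icc_self hy₀))) v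
  have hcol : ∀ x ∈ Ioo (x₀ - ε) (x₀ + ε), ∃ g : ℝ → F, g y₀ = f x ∧
      ∀ y ∈ Ioo (y₀ - ε) (y₀ + ε), HasDerivAt g (N (x, y) (g y)) y := fun x hx =>
    exists_linear_ode (A := fun y => N (x, y)) hε hK0.le hεK
      ((hN.continuousOn.mono hBU).comp (by fun_prop)
        fun y hy => hmem (Ioo_subset_Icc_self hx) hy)
      (fun y hy => hNK _ (hmem (Ioo_subset_Icc_self hx) hy)) (f x)
  choose! V hV₀ hVy using hcol
  have hfS : ∀ x ∈ Ioo (x₀ - ε) (x₀ + ε), ‖f x‖ ≤ (‖v‖ + 0) * Real.exp K := fun x hx =>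
    gronwall_two_sided hε1 hK (norm_nonneg _) le_rfl hf (fun t ht => by
      rw [add_zero]
      exact (ContinuousLinearMap.le_opNorm _ _).trans (by
        gcongr; exact hMK _ (hmem (Ioo_subset_Icc_self ht) (Ioo_subset_Icc_self hy₀))))
      (by rw [hf₀]) hx
  obtain ⟨S, hS⟩ : ∃ S, ∀ x ∈ Ioo (x₀ - ε) (x₀ + ε), ∀ y ∈ Ioo (y₀ - ε) (y₀ + ε),
      ‖V x y‖ ≤ S := by
    refine ⟨((‖v‖ + 0) * Real.exp K + 0) * Real.exp K, fun x hx y hy => ?_⟩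
    refine gronwall_two_sided hε1 hK (by positivity) le_rfl (hVy x hx) (fun t ht => ?_)
      (by rw [hV₀ x hx]; exact hfS x hx) hy
    rw [add_zero]
    exact (ContinuousLinearMap.le_opNorm _ _).trans (by
      gcongr; exact hNK _ (hmem (Ioo_subset_Icc_self hx) (Ioo_subset_Icc_self ht)))
  have hVx₀ : ∀ x ∈ Ioo (x₀ - ε) (x₀ + ε),
      HasDerivAt (fun x => V x y₀) (M (x, y₀) (V x y₀)) x := fun x hx => by
    rw [hV₀ x hx]
    exact (hf x hx).congr_of_eventuallyEq
      (eventuallyEq_of_mem (isOpen_Ioo.mem_nhds hx) fun t ht => hV₀ t ht)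
  have hVx : ∀ x ∈ Ioo (x₀ - ε) (x₀ + ε), ∀ y ∈ Ioo (y₀ - ε) (y₀ + ε),
      HasDerivAt (fun x => V x y) (M (x, y) (V x y)) x := fun x hx y hy =>
    hasDerivAt_row hU hM hN hMN hε hε1 hK hBU hMK hNK hS hVy hVx₀ hx hy
  set W : Set (ℝ × ℝ) := Ioo (x₀ - ε) (x₀ + ε) ×ˢ Ioo (y₀ - ε) (y₀ + ε) with hW
  have hWo : IsOpen W := isOpen_Ioo.prod isOpen_Ioo
  have hWB : W ⊆ closedBall (x₀, y₀) ε := fun z hz =>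
    hmem (Ioo_subset_Icc_self hz.1) (Ioo_subset_Icc_self hz.2)
  have hWU : W ⊆ U := hWB.trans hBU
  have hS0 : 0 ≤ S := (norm_nonneg _).trans (hS x₀ hx₀ y₀ hy₀)
  -- Joint continuity makes the two partial derivatives continuous, which upgrades them to a Fréchet
  -- derivative.
  have hcont : ContinuousOn (fun z : ℝ × ℝ => V z.1 z.2) W := by
    refine LipschitzOnWith.continuousOn (K := Real.toNNReal (K * S + K * S))
      (LipschitzOnWith.of_dist_le_mul fun z hz w hw => ?_)
    rw [Real.coe_toNNReal _ (by positivity), dist_eq_norm, dist_eq_norm]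
    have h1 := Convex.norm_image_sub_le_of_norm_hasDerivWithin_le (C := K * S)
      (fun x hx => (hVx x hx z.2 hz.2).hasDerivWithinAt)
      (fun x hx => (ContinuousLinearMap.le_opNorm _ _).trans (by
        have := hMK (x, z.2) (hWB ⟨hx, hz.2⟩)
        have := hS x hx z.2 hz.2
        gcongr)) (convex_Ioo _ _) hw.1 hz.1
    have h2 := Convex.norm_image_sub_le_of_norm_hasDerivWithin_le (C := K * S)
      (fun y hy => (hVy w.1 hw.1 y hy).hasDerivWithinAt)
      (fun y hy => (ContinuousLinearMap.le_opNorm _ _).trans (by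
        have := hNK (w.1, y) (hWB ⟨hw.1, hy⟩)
        have := hS w.1 hw.1 y hy
        gcongr)) (convex_Ioo _ _) hw.2 hz.2
    have h3 : ‖z.1 - w.1‖ ≤ ‖z - w‖ := norm_fst_le (z - w)
    have h4 : ‖z.2 - w.2‖ ≤ ‖z - w‖ := norm_snd_le (z - w)
    calc ‖V z.1 z.2 - V w.1 w.2‖ = ‖(V z.1 z.2 - V w.1 z.2) + (V w.1 z.2 - V w.1 w.2)‖ := by
          congr 1; abel
      _ ≤ K * S * ‖z.1 - w.1‖ + K * S * ‖z.2 - w.2‖ := (norm_add_le _ _).trans (add_le_add h1 h2)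
      _ ≤ K * S * ‖z - w‖ + K * S * ‖z - w‖ := by gcongr
      _ = (K * S + K * S) * ‖z - w‖ := by ring
  have hfd : ∀ z ∈ W, HasFDerivAt (fun z : ℝ × ℝ => V z.1 z.2)
      ((ContinuousLinearMap.fst ℝ ℝ ℝ).smulRight (M z (V z.1 z.2))
        + (ContinuousLinearMap.snd ℝ ℝ ℝ).smulRight (N z (V z.1 z.2))) z := fun z hz => by
    have hev := hWo.mem_nhds hz
    have hcz := hcont.continuousAt hev
    have hMz : ContinuousAt M z := (hM.continuousOn.mono hWU).continuousAt hev
    have hNz : ContinuousAt N z := (hN.continuousOn.mono hWU).continuousAt hev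
    have := hasStrictFDerivAt_uncurry_coprod (𝕜 := ℝ) (u := z) (f := V)
      (f₁ := fun x y => (1 : ℝ →L[ℝ] ℝ).smulRight (M (x, y) (V x y)))
      (f₂ := fun x y => (1 : ℝ →L[ℝ] ℝ).smulRight (N (x, y) (V x y)))
      (by filter_upwards [hev] with w hw using (hVx w.1 hw.1 w.2 hw.2).hasFDerivAt)
      (by filter_upwards [hev] with w hw using (hVy w.1 hw.1 w.2 hw.2).hasFDerivAt)
      (by
        have h5 : ContinuousAt (fun w : ℝ × ℝ => (1 : ℝ →L[ℝ] ℝ).smulRight (M w (V w.1 w.2))) z :=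
          ((ContinuousLinearMap.smulRightL ℝ ℝ F 1).continuous.continuousAt).comp
            (hMz.clm_apply hcz)
        exact h5)
      (by
        have h5 : ContinuousAt (fun w : ℝ × ℝ => (1 : ℝ →L[ℝ] ℝ).smulRight (N w (V w.1 w.2))) z :=
          ((ContinuousLinearMap.smulRightL ℝ ℝ F 1).continuous.continuousAt).comp
            (hNz.clm_apply hcz)
        exact h5)
    refine this.hasFDerivAt.congr_fderiv ?_
    ext <;> simp [Function.HasUncurry.uncurry]
  refine ⟨W, hWo, ⟨hx₀, hy₀⟩, hWU, fun z => V z.1 z.2,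
    contDiffOn_of_total hWo (hM.mono hWU) (hN.mono hWU) hfd, ?_, hfd⟩
  simp only [hV₀ x₀ hx₀, hf₀]

end Frobenius

open smoothFn

/-! ### The Fefferman metrics and the differential ring of smooth functions -/

/-- The scale factors `∂_ψ = (3 / 2i) ∂_φ`. -/
def scaleT (i : ℝ) : Fin 4 → ℝ := ![1, 1, 1, 3 / (2 * i)]

/-- The scale factors `dψ = (2i / 3) dφ`. -/
def scaleS (i : ℝ) : Fin 4 → ℝ := ![1, 1, 1, 2 / 3 * i]

theorem scaleS_mul_scaleT {i : ℝ} (hi : i ≠ 0) (k : Fin 4) : scaleS i k * scaleT i k = 1 := by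
  fin_cases k <;> simp [scaleS, scaleT]
  field_simp

/-- The equation `y'' = Q(x, y, y')` is smooth over a box. -/
structure SmoothOn (X Y P Φ : Set ℝ) (Q : (Fin 3 → ℝ) → ℝ) : Prop where
  openX : IsOpen X
  openY : IsOpen Y
  openP : IsOpen P
  openΦ : IsOpen Φ
  smooth : ContDiffOn ℝ ∞ Q (jetBox X Y P)

namespace SmoothOn

variable {X Y P Φ : Set ℝ} {Q : (Fin 3 → ℝ) → ℝ}

theorem openM (H : SmoothOn X Y P Φ Q) : IsOpen (fefBox X Y P Φ) := isOpen_fefBox H.openX H.openY H.openP H.openΦ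

theorem openJ (H : SmoothOn X Y P Φ Q) : IsOpen (jetBox X Y P) := isOpen_jetBox H.openX H.openY H.openP

theorem openB (H : SmoothOn X Y P Φ Q) : IsOpen (planeBox X Y) := isOpen_planeBox H.openX H.openY

/-- A function on the jet space as a function on the four-dimensional space. -/
def lift (Φ : Set ℝ) {F : (Fin 3 → ℝ) → ℝ} (hF : ContDiffOn ℝ ∞ F (jetBox X Y P)) :
    smoothFn (fefBox X Y P Φ) :=
  smoothFn.mk (fun z => F (toJet z)) (contDiffOn_comp_toJet hF)

theorem lift_apply {F : (Fin 3 → ℝ) → ℝ} (hF : ContDiffOn ℝ ∞ F (jetBox X Y P))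
    (z : fefBox X Y P Φ) : (lift Φ hF).1 z = F (toJet z) := rfl

theorem der_lift (H : SmoothOn X Y P Φ Q) (k : Fin 3) {F : (Fin 3 → ℝ) → ℝ} (hF : ContDiffOn ℝ ∞ F (jetBox X Y P)) :
    der H.openM k.castSucc (lift Φ hF) = lift Φ (contDiffOn_pd H.openJ hF k) :=
  smoothFn.ext fun z => by
    rw [← pd_eq_der H.openM (F := fun z => F (toJet z)) (fun z => (lift_apply hF z).symm) k.castSucc z, lift_apply]
    exact pd_comp_toJet (differentiableAt_of_contDiffOn H.openJ hF (toJet_mem z.2)) k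

theorem der_three_lift (H : SmoothOn X Y P Φ Q) {F : (Fin 3 → ℝ) → ℝ} (hF : ContDiffOn ℝ ∞ F (jetBox X Y P)) :
    der H.openM 3 (lift Φ hF) = 0 :=
  smoothFn.ext fun z => by
    rw [← pd_eq_der H.openM (F := fun z => F (toJet z)) (fun z => (lift_apply hF z).symm) 3 z, zero_apply]
    exact pd_three_comp_toJet (differentiableAt_of_contDiffOn H.openJ hF (toJet_mem z.2))

theorem contDiffOn_coord : ContDiffOn ℝ ∞ (fun z : Fin 3 → ℝ => z 2) (jetBox X Y P) :=
  (contDiff_apply ℝ ℝ (2 : Fin 3)).contDiffOn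

theorem pd_coord {n : ℕ} (k l : Fin n) (z : Fin n → ℝ) :
    pd k (fun z => z l) z = if l = k then 1 else 0 := by
  have h : (fun z : Fin n → ℝ => z l) = ContinuousLinearMap.proj (R := ℝ) (φ := fun _ => ℝ) l := rfl
  rw [pd, h, ContinuousLinearMap.fderiv]
  simp [Pi.single_apply]

variable (H : SmoothOn X Y P Φ Q)

/-- The differential ring of the equation. -/
def jet (i : ℝ) : JetAlgebra (smoothFn (fefBox X Y P Φ)) where
  d k := scaleT i k • der H.openM k
  comm a b f := by
    simp only [Derivation.smul_apply, Derivation.map_smul, der_comm H.openM b a]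
    rw [smul_comm]
  p := lift Φ contDiffOn_coord
  Q := lift Φ H.smooth
  d0_p := by
    rw [Derivation.smul_apply]
    refine (congrArg _ (H.der_lift 0 contDiffOn_coord)).trans (smoothFn.ext fun z => ?_)
    simp [smul_apply, lift_apply, pd_coord, zero_apply]
  d1_p := by
    rw [Derivation.smul_apply]
    refine (congrArg _ (H.der_lift 1 contDiffOn_coord)).trans (smoothFn.ext fun z => ?_)
    simp [smul_apply, lift_apply, pd_coord, zero_apply]
  d2_p := by
    rw [Derivation.smul_apply]
    refine (congrArg _ (H.der_lift 2 contDiffOn_coord)).trans (smoothFn.ext fun z => ?_)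
    simp [lift_apply, pd_coord, one_apply, scaleT]
  d3_p := by rw [Derivation.smul_apply, H.der_three_lift, smul_zero]
  d3_Q := by rw [Derivation.smul_apply, H.der_three_lift, smul_zero]

variable (i : ℝ)

theorem d_castSucc (k : Fin 3) : (H.jet i).d k.castSucc = der H.openM k.castSucc := by
  fin_cases k <;> simp [jet, scaleT]

theorem d0 : (H.jet i).d 0 = der H.openM 0 := H.d_castSucc i 0
theorem d1 : (H.jet i).d 1 = der H.openM 1 := H.d_castSucc i 1
theorem d2 : (H.jet i).d 2 = der H.openM 2 := H.d_castSucc i 2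

theorem d3 : (H.jet i).d 3 = (3 / (2 * i)) • der H.openM 3 := rfl

variable {F : (Fin 3 → ℝ) → ℝ} (hF : ContDiffOn ℝ ∞ F (jetBox X Y P))

theorem d0_lift : (H.jet i).d 0 (lift Φ hF) = lift Φ (contDiffOn_pd H.openJ hF 0) := by
  rw [d0]; exact H.der_lift 0 hF

theorem d1_lift : (H.jet i).d 1 (lift Φ hF) = lift Φ (contDiffOn_pd H.openJ hF 1) := by
  rw [d1]; exact H.der_lift 1 hF

theorem d2_lift : (H.jet i).d 2 (lift Φ hF) = lift Φ (contDiffOn_pd H.openJ hF 2) := by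
  rw [d2]; exact H.der_lift 2 hF

theorem d3_lift : (H.jet i).d 3 (lift Φ hF) = 0 := by
  rw [d3, Derivation.smul_apply, H.der_three_lift, smul_zero]

include H in
theorem contDiffOn_totalD {F : (Fin 3 → ℝ) → ℝ} (hF : ContDiffOn ℝ ∞ F (jetBox X Y P)) : ContDiffOn ℝ ∞ (totalD Q F) (jetBox X Y P) :=
  ((contDiffOn_pd H.openJ hF 0).add (contDiffOn_coord.mul (contDiffOn_pd H.openJ hF 1))).add
    (H.smooth.mul (contDiffOn_pd H.openJ hF 2))

theorem Q_eq : (H.jet i).Q = lift Φ H.smooth := rfl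

theorem D_lift : (H.jet i).D (lift Φ hF) = lift Φ (H.contDiffOn_totalD hF) := by
  rw [JetAlgebra.D, d0_lift, d1_lift, d2_lift]
  rfl

theorem w1_apply (z : fefBox X Y P Φ) : (H.jet i).w1.1 z = w₁ Q (toJet z) := by
  simp only [JetAlgebra.w1, Q_eq, d2_lift, d1_lift, D_lift]
  rfl

theorem w2_apply (z : fefBox X Y P Φ) : (H.jet i).w2.1 z = w₂ Q (toJet z) := by
  simp only [JetAlgebra.w2, Q_eq, d2_lift]
  rfl

variable {i} (hi : i ≠ 0) {r s : smoothFn (fefBox X Y P Φ)}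

/-- The Fefferman metric in the coordinates `(x, y, p, φ)`. -/
theorem gF_apply (i : ℝ) (ρ : (Fin 4 → ℝ) → ℝ) (z : fefBox X Y P Φ) (a b : Fin 4) :
    gF i Q ρ z a b = scaleS i a * scaleS i b * (ρ z ^ 2 * ((H.jet i).g a b).1 z) := by
  have h1 : ((H.jet i).d 2 (H.jet i).Q).1 z = pd 2 Q (toJet z) := by
    rw [Q_eq, d2_lift]; rfl
  have h2 : ((H.jet i).d 2 ((H.jet i).d 2 (H.jet i).Q)).1 z = pd 2 (pd 2 Q) (toJet z) := by
    rw [Q_eq, d2_lift, d2_lift]; rfl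
  have h3 : (H.jet i).Q.1 z = Q (toJet z) := rfl
  have h4 : (H.jet i).p.1 z = z.1 2 := rfl
  have h5 : (2 : smoothFn (fefBox X Y P Φ)).1 z = 2 := rfl
  rw [JetAlgebra.g_apply]
  fin_cases a <;> fin_cases b <;>
    simp [gF, θ₁, θ₂, θ₃, θ₄, scaleS, JetAlgebra.gtab, smul_apply, smoothFn.add_apply,
      smoothFn.sub_apply, smoothFn.neg_apply, smoothFn.mul_apply, smoothFn.zero_apply,
      smoothFn.one_apply, smoothFn.pow_apply, h1, h2, h3, h4, h5] <;> ring

-- `G` need only agree with `g_F` on the box. For conformal flatness it is `e^{2u} g_F`, which there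
-- equals a Fefferman metric with another `ρ`.
include hi in
theorem riemann_eq {ρ : (Fin 4 → ℝ) → ℝ} (hr : ∀ z : fefBox X Y P Φ, ρ z = r.1 z) (hrs : r * s = 1)
    {G : (Fin 4 → ℝ) → Matrix (Fin 4) (Fin 4) ℝ}
    (hG : ∀ z ∈ fefBox X Y P Φ, ∀ a b, G z a b = gF i Q ρ z a b) (a b c e : Fin 4)
    (z : fefBox X Y P Φ) :
    riemann G a b c e z = scaleT i a * scaleS i b * scaleS i c * scaleS i e *
      (curv (H.jet i).d (chr (H.jet i).d (r ^ 2 • (H.jet i).g) (s ^ 2 • (H.jet i).h)) a b c e).1 z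
    := by
  have hst := scaleS_mul_scaleT hi
  set J := H.jet i with hJ
  have hst' : ∀ k, scaleT i k * scaleS i k = 1 := fun k => by rw [mul_comm, hst]
  have hd : ∀ k f, der H.openM k f = scaleS i k • J.d k f := fun k f => by
    change _ = scaleS i k • (scaleT i k • der H.openM k f)
    rw [smul_smul, hst, one_smul]
  set g' : Matrix (Fin 4) (Fin 4) (smoothFn (fefBox X Y P Φ)) :=
    Matrix.of fun a b => (scaleS i a * scaleS i b) • (r ^ 2 * J.g a b) with hg'
  set h' : Matrix (Fin 4) (Fin 4) (smoothFn (fefBox X Y P Φ)) :=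
    Matrix.of fun a b => (scaleT i a * scaleT i b) • (s ^ 2 * J.h a b) with hh'
  have hgh : g' * h' = 1 := by
    ext1 a b
    have h1 := congrFun (congrFun J.g_mul_h a) b
    rw [Matrix.mul_apply] at h1
    have h2 : ∀ c, g' a c * h' c b = (scaleS i a * scaleT i b) • (J.g a c * J.h c b) := fun c => by
      have h3 : g' a c * h' c b = ((scaleS i c * scaleT i c) * (scaleS i a * scaleT i b)) •
          ((r * s) ^ 2 * (J.g a c * J.h c b)) := by
        simp only [hg', hh', Matrix.of_apply]; algebra
      rw [h3, hst, hrs, one_mul, one_pow, one_mul]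
    rw [Matrix.mul_apply, Finset.sum_congr rfl fun c _ => h2 c, ← Finset.smul_sum, h1,
      Matrix.one_apply]
    split_ifs with hab
    · rw [hab, hst, one_smul]
    · rw [smul_zero]
  rw [riemann_eq_curv H.openM (g' := g') (h' := h') (fun z a b => ?_) hgh,
    curv_rescale (d' := J.d) (s := scaleT i) (t := scaleS i) hst' (fun k f => ?_)
      (fun a b c => ?_), smul_apply]
  · exact hd k f
  · refine chr_rescale (s := scaleT i) (t := scaleS i) hst' hd (fun a b => ?_)
      (fun a b => ?_) a b c <;> rfl
  · rw [hG z z.2, H.gF_apply, hr]; rfl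

include hi in
theorem ricci_eq {ρ : (Fin 4 → ℝ) → ℝ} (hr : ∀ z : fefBox X Y P Φ, ρ z = r.1 z) (hrs : r * s = 1)
    (b e : Fin 4) (z : fefBox X Y P Φ) :
    ricci (gF i Q ρ) b e z = scaleS i b * scaleS i e * (∑ a, curv (H.jet i).d
      (chr (H.jet i).d (r ^ 2 • (H.jet i).g) (s ^ 2 • (H.jet i).h)) a b a e).1 z := by
  simp only [ricci, H.riemann_eq hi hr hrs (fun _ _ _ _ => rfl), sum_apply, Finset.mul_sum]
  refine Finset.sum_congr rfl fun a _ => ?_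
  linear_combination scaleS i b * scaleS i e * (curv (H.jet i).d
      (chr (H.jet i).d (r ^ 2 • (H.jet i).g) (s ^ 2 • (H.jet i).h)) a b a e).1 z
      * scaleS_mul_scaleT hi a

-- Here `m = Λρ²`, because `Λ g_F = Λρ² g` after the coordinate scaling.
include hi in
theorem isPlus_isMinus_of_einstein {ρ : (Fin 4 → ℝ) → ℝ}
    (hr : ∀ z : fefBox X Y P Φ, ρ z = r.1 z) (hrs : r * s = 1) {Λ : ℝ}
    (hE : EinsteinOn (gF i Q ρ) Λ (fefBox X Y P Φ)) :
    (H.jet i).IsPlus ((H.jet i).plus s) ∧ (H.jet i).IsMinus ((H.jet i).minus s) := by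
  have hs : ∀ k, scaleS i k ≠ 0 := fun k => left_ne_zero_of_mul_eq_one (scaleS_mul_scaleT hi k)
  obtain ⟨h11, h14, h22, h24, h44⟩ := JetAlgebra.almostEinstein_components
    (J := H.jet i) (m := Λ • r ^ 2) hrs fun b e => smoothFn.ext fun z => by
      have h1 := hE z z.2 b e
      rw [H.ricci_eq hi hr hrs, H.gF_apply, hr] at h1
      rw [smoothFn.mul_apply, smul_apply, smoothFn.pow_apply]
      refine mul_left_cancel₀ (mul_ne_zero (hs b) (hs e)) ?_
      rw [h1]; ring
  exact JetAlgebra.isPlus_isMinus h11 h14 h22 h24 h44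

include hi in
theorem ricciFlat {ρ : (Fin 4 → ℝ) → ℝ} (hr : ∀ z : fefBox X Y P Φ, ρ z = r.1 z) (hrs : r * s = 1)
    (hs : (H.jet i).IsPlus s ∨ (H.jet i).IsMinus s) :
    RicciFlatOn (gF i Q ρ) (fefBox X Y P Φ) := fun z hz b e => by
  rw [H.ricci_eq hi hr hrs b e ⟨z, hz⟩]
  rcases hs with hs | hs <;> rw [hs.ricci hrs, zero_apply, mul_zero]

end SmoothOn

/-! ### Phases `e^{κφ}` and the three cases -/

open smoothFn

namespace SmoothOn

variable {X Y P Φ : Set ℝ} {Q : (Fin 3 → ℝ) → ℝ} {ρ : (Fin 4 → ℝ) → ℝ}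
  (H : SmoothOn X Y P Φ Q) {i : ℝ} (hi : i ≠ 0)

theorem exists_inverse (hρ : ContDiffOn ℝ ∞ ρ (fefBox X Y P Φ)) (h0 : ∀ z ∈ fefBox X Y P Φ, ρ z ≠ 0) :
    ∃ r s : smoothFn (fefBox X Y P Φ), (∀ z : fefBox X Y P Φ, ρ z = r.1 z) ∧ r * s = 1 :=
  ⟨smoothFn.mk ρ hρ, smoothFn.mk (fun z => (ρ z)⁻¹) (hρ.inv h0), fun _ => rfl,
    smoothFn.ext fun z => by
      rw [smoothFn.mul_apply, mk_apply, mk_apply, smoothFn.one_apply, mul_inv_cancel₀ (h0 z z.2)]⟩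

/-- The function `e^{κφ}`. -/
def phase (X Y P Φ : Set ℝ) (κ : ℝ) : smoothFn (fefBox X Y P Φ) :=
  smoothFn.mk (fun z => Real.exp (κ * z 3))
    (Real.contDiff_exp.comp (contDiff_const.mul (contDiff_apply ℝ ℝ (3 : Fin 4)))).contDiffOn

theorem pd_exp (κ : ℝ) (k : Fin 4) (z : Fin 4 → ℝ) :
    pd k (fun z => Real.exp (κ * z 3)) z = if 3 = k then κ * Real.exp (κ * z 3) else 0 := by
  have h1 : HasFDerivAt (fun z : Fin 4 → ℝ => z 3)
      (ContinuousLinearMap.proj (R := ℝ) (φ := fun _ => ℝ) (3 : Fin 4)) z :=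
    ContinuousLinearMap.hasFDerivAt (ContinuousLinearMap.proj (R := ℝ) (φ := fun _ => ℝ) (3 : Fin 4))
  rw [pd, ((h1.const_mul κ).exp).fderiv]
  by_cases hk : 3 = k
  · subst hk; simp [mul_comm]
  · simp [hk]

theorem der_phase (κ : ℝ) (k : Fin 4) :
    der H.openM k (phase X Y P Φ κ) = if 3 = k then κ • phase X Y P Φ κ else 0 :=
  smoothFn.ext fun z => by
    rw [← pd_eq_der H.openM (F := fun z => Real.exp (κ * z 3)) (fun _ => rfl), pd_exp]
    split_ifs <;> rfl

theorem phase_mul (κ κ' : ℝ) : phase X Y P Φ κ * phase X Y P Φ κ' = phase X Y P Φ (κ + κ') :=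
  smoothFn.ext fun z => by
    rw [smoothFn.mul_apply, phase, phase, phase, mk_apply, mk_apply, mk_apply, ← Real.exp_add,
      add_mul]

theorem phase_zero : phase X Y P Φ 0 = 1 :=
  smoothFn.ext fun z => by simp [phase, mk_apply, smoothFn.one_apply]

/-- A function whose `φ`-derivative vanishes is a function of `(x, y, p)`. -/
theorem exists_lift (hc : Convex ℝ (fefBox X Y P Φ)) (hΦ : Φ.Nonempty)
    {f : smoothFn (fefBox X Y P Φ)} (hf : der H.openM 3 f = 0) :
    ∃ (F : (Fin 3 → ℝ) → ℝ) (hF : ContDiffOn ℝ ∞ F (jetBox X Y P)), f = lift Φ hF := by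
  obtain ⟨φ, hφ⟩ := hΦ
  refine ⟨fun q => out f (ofJet φ q), (contDiffOn_out f).comp (contDiff_ofJet φ).contDiffOn
    fun q hq => ofJet_mem hφ hq, smoothFn.ext fun z => ?_⟩
  have hz : ofJet φ (toJet z) ∈ fefBox X Y P Φ := ofJet_mem hφ (toJet_mem z.2)
  rw [lift_apply, out_apply f ⟨_, hz⟩]
  refine apply_eq_of_der_eq_zero H.openM hc fun k => ?_
  fin_cases k
  · exact Or.inl rfl
  · exact Or.inl rfl
  · exact Or.inl rfl
  · exact Or.inr hf

/-- Multiplication by `e^{-κφ}` turns the eigenvalue equation for `∂_φ` into independence of `φ`. -/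
theorem hasPhase_iff (hc : Convex ℝ (fefBox X Y P Φ)) (hΦ : Φ.Nonempty)
    {r : smoothFn (fefBox X Y P Φ)} (hr : ∀ z : fefBox X Y P Φ, ρ z = r.1 z) (κ : ℝ) :
    HasPhase X Y P Φ κ ρ ↔ der H.openM 3 r = κ • r := by
  constructor
  · rintro ⟨A, hA, h⟩
    have h1 : r = lift Φ hA * phase X Y P Φ κ := smoothFn.ext fun z => by
      rw [← hr, h z z.2]; rfl
    rw [h1, Derivation.leibniz, H.der_three_lift, H.der_phase, if_pos rfl]
    simp only [smul_eq_mul]; algebra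
  · intro h
    have h1 : der H.openM 3 (r * phase X Y P Φ (-κ)) = 0 := by
      rw [Derivation.leibniz, h, H.der_phase, if_pos rfl]
      simp only [smul_eq_mul]; algebra
    obtain ⟨A, hA, h2⟩ := H.exists_lift hc hΦ h1
    refine ⟨A, hA, fun z hz => ?_⟩
    have h3 : r = lift Φ hA * phase X Y P Φ κ := by
      rw [← h2, mul_assoc, phase_mul, neg_add_cancel, phase_zero, mul_one]
    rw [hr ⟨z, hz⟩, h3]; rfl

theorem der_inv {n : ℕ} {U : Set (Fin n → ℝ)} (hU : IsOpen U) {r s : smoothFn U} (hrs : r * s = 1)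
    (k : Fin n) : der hU k s = -(s ^ 2 * der hU k r) := by
  have h := congrArg (der hU k) hrs
  rw [Derivation.leibniz, Derivation.map_one_eq_zero] at h
  simp only [smul_eq_mul] at h
  linear_combination s * h - der hU k s * hrs

theorem der_eq_smul_iff {n : ℕ} {U : Set (Fin n → ℝ)} (hU : IsOpen U) {r s : smoothFn U}
    (hrs : r * s = 1) (k : Fin n) (κ : ℝ) : der hU k r = κ • r ↔ der hU k s = -(κ • s) := by
  constructor
  · intro h
    rw [der_inv hU hrs, h]
    linear_combination (norm := algebra) -(κ • (s * hrs))
  · intro h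
    rw [der_inv hU (by rw [mul_comm, hrs] : s * r = 1), h]
    linear_combination (norm := algebra) κ • (r * hrs)

include hi in
theorem d3_eq_iff (f g : smoothFn (fefBox X Y P Φ)) :
    (H.jet i).d 3 f = g ↔ der H.openM 3 f = (2 / 3 * i) • g := by
  have h1 : 2 / 3 * i * (3 / (2 * i)) = 1 := by field_simp
  rw [H.d3, Derivation.smul_apply]
  constructor
  · rintro rfl
    rw [smul_smul, h1, one_smul]
  · intro h
    rw [h, smul_smul, mul_comm, h1, one_smul]

-- `ρ ∼ e^{-iφ/3}` means `1/ρ ∼ e^{iφ/3} = e^{ψ/2}`: the phases of `ρ` and of the scale `s` are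
-- opposite.
include hi in
theorem hasPhase_neg_iff (hc : Convex ℝ (fefBox X Y P Φ)) (hΦ : Φ.Nonempty)
    {r s : smoothFn (fefBox X Y P Φ)} (hr : ∀ z : fefBox X Y P Φ, ρ z = r.1 z) (hrs : r * s = 1) :
    HasPhase X Y P Φ (-(i / 3)) ρ ↔ (H.jet i).d 3 s = (1 / 2 : ℝ) • s := by
  rw [H.hasPhase_iff hc hΦ hr, der_eq_smul_iff H.openM hrs, H.d3_eq_iff hi, smul_smul, ← neg_smul]
  ring_nf

include hi in
theorem hasPhase_pos_iff (hc : Convex ℝ (fefBox X Y P Φ)) (hΦ : Φ.Nonempty)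
    {r s : smoothFn (fefBox X Y P Φ)} (hr : ∀ z : fefBox X Y P Φ, ρ z = r.1 z) (hrs : r * s = 1) :
    HasPhase X Y P Φ (i / 3) ρ ↔ (H.jet i).d 3 s = -((1 / 2 : ℝ) • s) := by
  rw [H.hasPhase_iff hc hΦ hr, der_eq_smul_iff H.openM hrs, H.d3_eq_iff hi, smul_neg, smul_smul]
  ring_nf

include hi in
theorem der_eq (k : Fin 4) (f : smoothFn (fefBox X Y P Φ)) :
    der H.openM k f = scaleS i k • (H.jet i).d k f := by
  change _ = scaleS i k • (scaleT i k • der H.openM k f)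
  rw [smul_smul, scaleS_mul_scaleT hi, one_smul]

include hi in
/-- Unique continuation for a closed system. -/
theorem eq_zero_of_mul_eq_zero (hc : Convex ℝ (fefBox X Y P Φ)) {b w : smoothFn (fefBox X Y P Φ)}
    (hw : w * b = 0) {z : fefBox X Y P Φ} (hz : w.1 z ≠ 0) {k l : Fin 4}
    (hcl : ∀ m (j : Fin 3), (H.jet i).d m (![b, (H.jet i).d k b, (H.jet i).d l b] j)
      ∈ Ideal.span (Set.range ![b, (H.jet i).d k b, (H.jet i).d l b])) : b = 0 := by
  have h0 : b.1 z = 0 := by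
    have := congrArg (fun f => f.1 z) hw
    simpa [smoothFn.mul_apply, smoothFn.zero_apply, hz] using this
  -- Differentiating `w b = 0` where `b` vanishes leaves `w · ∂b = 0`, so all first derivatives of
  -- `b` vanish there too.
  have hd : ∀ m, ((H.jet i).d m b).1 z = 0 := fun m => by
    have := congrArg (fun f => f.1 z) (congrArg ((H.jet i).d m) hw)
    simpa [smoothFn.mul_apply, smoothFn.zero_apply, smoothFn.add_apply, hz, h0] using this
  refine eq_zero_of_closed H.openM hc (v := ![b, (H.jet i).d k b, (H.jet i).d l b])
    (fun m j => ?_) (z₀ := z) (fun j => ?_) 0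
  · rw [H.der_eq hi]
    exact Submodule.smul_of_tower_mem _ _ (hcl m j)
  · fin_cases j
    · exact h0
    · exact hd k
    · exact hd l

-- The integrability conditions `w₂ · plus s = 0` and `w₁ · minus s = 0`, rewritten in `ρ`, are the
-- two pointwise identities. Unique continuation makes each of them global: one point with `w₂ ≠ 0`
-- gives `plus s = 0` everywhere, and likewise for `w₁` and `minus s`.
include H hi in
theorem einstein_cases (hc : Convex ℝ (fefBox X Y P Φ)) (hne : (fefBox X Y P Φ).Nonempty)
    (hρ : ContDiffOn ℝ ∞ ρ (fefBox X Y P Φ)) (h0 : ∀ z ∈ fefBox X Y P Φ, ρ z ≠ 0)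
    {Λ : ℝ} (hE : EinsteinOn (gF i Q ρ) Λ (fefBox X Y P Φ)) :
    (∀ z ∈ fefBox X Y P Φ, (3 * pd 3 ρ z - i * ρ z) * w₂ Q (toJet z) = 0 ∧
      (3 * pd 3 ρ z + i * ρ z) * w₁ Q (toJet z) = 0) ∧
    (((∀ z ∈ jetBox X Y P, w₁ Q z = 0) ∧ (∀ z ∈ jetBox X Y P, w₂ Q z = 0)) ∨
      ((∀ z ∈ jetBox X Y P, w₂ Q z = 0) ∧ (∃ z ∈ jetBox X Y P, w₁ Q z ≠ 0) ∧
        HasPhase X Y P Φ (-(i / 3)) ρ) ∨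
      ((∃ z ∈ jetBox X Y P, w₂ Q z ≠ 0) ∧ (∀ z ∈ jetBox X Y P, w₁ Q z = 0) ∧
        HasPhase X Y P Φ (i / 3) ρ)) := by
  obtain ⟨r, s, hr, hrs⟩ := exists_inverse hρ h0
  obtain ⟨hp, hm⟩ := H.isPlus_isMinus_of_einstein hi hr hrs hE
  obtain ⟨⟨z₁, hz₁⟩, hΦ⟩ : (fefBox X Y P Φ).Nonempty ∧ Φ.Nonempty :=
    ⟨hne, let ⟨z, hz⟩ := hne; ⟨z 3, hz.2.2.2⟩⟩
  set J := H.jet i with hJ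
  have hd3 : ∀ z : fefBox X Y P Φ, 2 * i * (J.d 3 r).1 z = 3 * pd 3 ρ z := fun z => by
    rw [pd_eq_der H.openM hr, hJ, H.d3, Derivation.smul_apply, smul_apply]
    field_simp
  have hd3s : J.d 3 s = -(s ^ 2 * J.d 3 r) := by
    rw [hJ, H.d3, Derivation.smul_apply, Derivation.smul_apply, der_inv H.openM hrs]; algebra
  constructor
  · intro z hz
    -- Multiplication by `ρ²` exchanges `s` for `ρ` and `∂_ψ s` for `-∂_ψ ρ`.
    have e1 : J.w2 * ((1 / 2 : ℝ) • r - J.d 3 r) = 0 := by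
      have h := hp.w2_mul
      rw [JetAlgebra.plus, hd3s] at h
      linear_combination (norm := algebra) r ^ 2 * h - (1 / 2 : ℝ) • (r * J.w2 * hrs)
        + (J.w2 * J.d 3 r) * ((r * s + 1) * hrs)
    have e2 : J.w1 * ((1 / 2 : ℝ) • r + J.d 3 r) = 0 := by
      have h := hm.w1_mul
      rw [JetAlgebra.minus, hd3s] at h
      linear_combination (norm := algebra) r ^ 2 * h - (1 / 2 : ℝ) • (r * J.w1 * hrs)
        - (J.w1 * J.d 3 r) * ((r * s + 1) * hrs)
    have e1' := congrArg (fun f => f.1 ⟨z, hz⟩) e1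
    have e2' := congrArg (fun f => f.1 ⟨z, hz⟩) e2
    simp only [smoothFn.mul_apply, smoothFn.sub_apply, smoothFn.add_apply, smul_apply,
      smoothFn.zero_apply, ← hr] at e1' e2'
    rw [hJ, H.w2_apply] at e1'
    rw [hJ, H.w1_apply] at e2'
    have := hd3 ⟨z, hz⟩
    constructor
    · linear_combination -(2 * i) * e1' - w₂ Q (toJet z) * this
    · linear_combination (2 * i) * e2' - w₁ Q (toJet z) * this
  · have hw1 : (∃ z ∈ jetBox X Y P, w₁ Q z ≠ 0) → J.minus s = 0 := by
      rintro ⟨q, hq, hq'⟩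
      have hz : ofJet (z₁ 3) q ∈ fefBox X Y P Φ := ofJet_mem hz₁.2.2.2 hq
      exact H.eq_zero_of_mul_eq_zero hi hc hm.w1_mul (z := ⟨_, hz⟩)
        (by rw [hJ, H.w1_apply, toJet_ofJet]; exact hq') hm.closed
    have hw2 : (∃ z ∈ jetBox X Y P, w₂ Q z ≠ 0) → J.plus s = 0 := by
      rintro ⟨q, hq, hq'⟩
      have hz : ofJet (z₁ 3) q ∈ fefBox X Y P Φ := ofJet_mem hz₁.2.2.2 hq
      exact H.eq_zero_of_mul_eq_zero hi hc hp.w2_mul (z := ⟨_, hz⟩)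
        (by rw [hJ, H.w2_apply, toJet_ofJet]; exact hq') hp.closed
    by_cases h1 : ∀ z ∈ jetBox X Y P, w₁ Q z = 0 <;> by_cases h2 : ∀ z ∈ jetBox X Y P, w₂ Q z = 0
    · exact Or.inl ⟨h1, h2⟩
    · push Not at h2
      refine Or.inr (Or.inr ⟨h2, h1, (H.hasPhase_pos_iff hi hc hΦ hr hrs).2 ?_⟩)
      have := hw2 h2
      rw [JetAlgebra.plus] at this
      linear_combination this
    · push Not at h1
      refine Or.inr (Or.inl ⟨h2, h1, (H.hasPhase_neg_iff hi hc hΦ hr hrs).2 ?_⟩)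
      have := hw1 h1
      rw [JetAlgebra.minus] at this
      linear_combination -this
    · push Not at h1 h2
      exfalso
      have h3 : s = 0 := by rw [← J.plus_add_minus s, hw1 h1, hw2 h2, add_zero]
      rw [h3, mul_zero] at hrs
      have := congrArg (fun f => f.1 ⟨z₁, hz₁⟩) hrs
      simp [smoothFn.zero_apply, smoothFn.one_apply] at this

end SmoothOn

/-! ### The scale equation for `ρ = a e^{iφ/3}` -/

open smoothFn

namespace JetAlgebra

variable {R : Type*} [CommRing R] [Algebra ℝ R] (J : JetAlgebra R)

/-- The left hand side of the scale equation. -/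
def scaleEq (f : R) : R :=
  36 * J.D f ^ 2 + 6 * f * (-3 * J.D (J.D f) + J.d 2 J.Q * J.D f)
    + f ^ 2 * (6 * J.D (J.d 2 J.Q) - 18 * J.d 1 J.Q - 4 * J.d 2 J.Q ^ 2)

variable {J}

theorem D_inv {r s : R} (hrs : r * s = 1) : J.D s = -(s ^ 2 * J.D r) := by
  have h := congrArg J.D hrs
  rw [D_mul, D_one] at h
  linear_combination s * h - J.D s * hrs

/-- The quadratic equation for `ρ` is the linear equation `L s = 0` for `s = 1/ρ`. -/
theorem L_inv {r s : R} (hrs : r * s = 1) : 18 * J.L s = s ^ 3 * J.scaleEq r := by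
  have h1 : J.D (J.D s) = -(s ^ 2 * J.D (J.D r)) + 2 * s ^ 3 * J.D r ^ 2 := by
    have h : J.D (J.D s) = J.D (-(s * s * J.D r)) := by rw [← sq, ← D_inv hrs]
    rw [h, D_neg, D_mul, D_mul, D_inv hrs]; ring
  rw [L, scaleEq, h1, D_inv hrs]
  linear_combination (norm := algebra) (18 * s ^ 2 * J.D (J.D r) - 6 * (s ^ 2 * J.d 2 J.Q * J.D r)
    - (6 * J.D (J.d 2 J.Q) - 18 * J.d 1 J.Q - 4 * J.d 2 J.Q ^ 2) * s * (r * s + 1)) * hrs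

theorem L_eq_zero_iff {r s : R} (hrs : r * s = 1) : J.L s = 0 ↔ J.scaleEq r = 0 := by
  have h := L_inv (J := J) hrs
  constructor
  · intro h1
    rw [h1, mul_zero] at h
    calc J.scaleEq r = (r * s) ^ 3 * J.scaleEq r := by rw [hrs, one_pow, one_mul]
      _ = r ^ 3 * (s ^ 3 * J.scaleEq r) := by ring
      _ = 0 := by rw [← h, mul_zero]
  · intro h1
    rw [h1, mul_zero] at h
    linear_combination (norm := algebra) (1 / 18 : ℝ) • h

theorem scaleEq_mul {f e : R} (he : J.D e = 0) : J.scaleEq (f * e) = e ^ 2 * J.scaleEq f := by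
  simp only [scaleEq, D_mul, D_add, he, D_zero]
  ring

end JetAlgebra

namespace SmoothOn

variable {X Y P Φ : Set ℝ} {Q : (Fin 3 → ℝ) → ℝ} {ρ : (Fin 4 → ℝ) → ℝ}

/-- A function of `(x, y)` as a function on the four-dimensional space. -/
def liftB (P Φ : Set ℝ) {a : (Fin 2 → ℝ) → ℝ} (ha : ContDiffOn ℝ ∞ a (planeBox X Y)) :
    smoothFn (fefBox X Y P Φ) :=
  lift Φ (contDiffOn_comp_toPlane (P := P) ha)

theorem liftB_apply {a : (Fin 2 → ℝ) → ℝ} (ha : ContDiffOn ℝ ∞ a (planeBox X Y))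
    (z : fefBox X Y P Φ) : (liftB P Φ ha).1 z = a (toPlane (toJet z)) := rfl

variable (H : SmoothOn X Y P Φ Q) {i : ℝ} (hi : i ≠ 0)

theorem exists_liftB (hc : Convex ℝ (fefBox X Y P Φ)) (hP : P.Nonempty) (hΦ : Φ.Nonempty)
    {f : smoothFn (fefBox X Y P Φ)} (hf2 : der H.openM 2 f = 0) (hf3 : der H.openM 3 f = 0) :
    ∃ (a : (Fin 2 → ℝ) → ℝ) (ha : ContDiffOn ℝ ∞ a (planeBox X Y)), f = liftB P Φ ha := by
  obtain ⟨φ, hφ⟩ := hΦ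
  obtain ⟨p, hp⟩ := hP
  refine ⟨fun q => out f (ofJet φ (ofPlane p q)), (contDiffOn_out f).comp
    ((contDiff_ofJet φ).comp (contDiff_ofPlane p)).contDiffOn
    fun q hq => ofJet_mem hφ (ofPlane_mem hp hq), smoothFn.ext fun z => ?_⟩
  have hz : ofJet φ (ofPlane p (toPlane (toJet z))) ∈ fefBox X Y P Φ :=
    ofJet_mem hφ (ofPlane_mem hp (toPlane_mem (toJet_mem z.2)))
  rw [liftB_apply, out_apply f ⟨_, hz⟩]
  refine apply_eq_of_der_eq_zero H.openM hc fun k => ?_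
  fin_cases k
  · exact Or.inl rfl
  · exact Or.inl rfl
  · exact Or.inr hf2
  · exact Or.inr hf3

variable {a : (Fin 2 → ℝ) → ℝ} (ha : ContDiffOn ℝ ∞ a (planeBox X Y))

theorem d3_liftB : (H.jet i).d 3 (liftB P Φ ha) = 0 := H.d3_lift i _

theorem d2_liftB : (H.jet i).d 2 (liftB P Φ ha) = 0 := by
  rw [liftB, d2_lift]
  refine smoothFn.ext fun z => ?_
  exact pd_two_comp_toPlane (differentiableAt_of_contDiffOn H.openB ha (toPlane_mem (toJet_mem z.2)))

theorem d0_liftB : (H.jet i).d 0 (liftB P Φ ha) = liftB P Φ (contDiffOn_pd H.openB ha 0) := by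
  rw [liftB, d0_lift]
  refine smoothFn.ext fun z => ?_
  exact pd_comp_toPlane (differentiableAt_of_contDiffOn H.openB ha (toPlane_mem (toJet_mem z.2))) 0

theorem d1_liftB : (H.jet i).d 1 (liftB P Φ ha) = liftB P Φ (contDiffOn_pd H.openB ha 1) := by
  rw [liftB, d1_lift]
  refine smoothFn.ext fun z => ?_
  exact pd_comp_toPlane (differentiableAt_of_contDiffOn H.openB ha (toPlane_mem (toJet_mem z.2))) 1

theorem d_phase (κ : ℝ) (k : Fin 3) : (H.jet i).d k.castSucc (phase X Y P Φ κ) = 0 := by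
  rw [d_castSucc, H.der_phase]
  fin_cases k <;> rfl

theorem D_phase (κ : ℝ) : (H.jet i).D (phase X Y P Φ κ) = 0 := by
  have h0 : (H.jet i).d 0 (phase X Y P Φ κ) = 0 := H.d_phase κ 0
  have h1 : (H.jet i).d 1 (phase X Y P Φ κ) = 0 := H.d_phase κ 1
  have h2 : (H.jet i).d 2 (phase X Y P Φ κ) = 0 := H.d_phase κ 2
  rw [JetAlgebra.D, h0, h1, h2]; ring

theorem d2_phase (κ : ℝ) : (H.jet i).d 2 (phase X Y P Φ κ) = 0 := H.d_phase κ 2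

include hi in
theorem d3_phase (κ : ℝ) :
    (H.jet i).d 3 (phase X Y P Φ κ) = (3 * κ / (2 * i)) • phase X Y P Φ κ := by
  rw [H.d3_eq_iff hi, H.der_phase, if_pos rfl, smul_smul]
  congr 1
  field_simp

theorem scaleEquation_iff (i : ℝ) (hΦ : Φ.Nonempty) :
    ScaleEquation X Y P Q a ↔ (H.jet i).scaleEq (liftB P Φ ha) = 0 := by
  have key : ∀ z : fefBox X Y P Φ, ((H.jet i).scaleEq (liftB P Φ ha)).1 z =
      36 * totalD Q (fun v => a (toPlane v)) (toJet z) ^ 2 + 6 * a (toPlane (toJet z)) *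
        (-3 * totalD Q (totalD Q (fun v => a (toPlane v))) (toJet z)
          + pd 2 Q (toJet z) * totalD Q (fun v => a (toPlane v)) (toJet z))
      + a (toPlane (toJet z)) ^ 2 * (6 * totalD Q (pd 2 Q) (toJet z) - 18 * pd 1 Q (toJet z)
        - 4 * pd 2 Q (toJet z) ^ 2) := fun z => by
    rw [JetAlgebra.scaleEq, liftB, D_lift, D_lift, Q_eq, d2_lift, d1_lift, D_lift]
    rfl
  constructor
  · intro h
    refine smoothFn.ext fun z => ?_
    rw [key]
    exact h (toJet z) (toJet_mem z.2)
  · intro h q hq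
    obtain ⟨φ, hφ⟩ := hΦ
    have h1 := key ⟨ofJet φ q, ofJet_mem hφ hq⟩
    rw [h] at h1
    simp only [toJet_ofJet] at h1
    exact h1.symm

include hi in
/-- Solutions of the scale equation yield Einstein scales. -/
theorem isMinus_of_scaleEquation (hΦ : Φ.Nonempty) (hS : ScaleEquation X Y P Q a)
    {s : smoothFn (fefBox X Y P Φ)} (hrs : liftB P Φ ha * phase X Y P Φ (i / 3) * s = 1) :
    (H.jet i).IsMinus s := by
  rw [H.scaleEquation_iff ha i hΦ] at hS
  have hinv : ∀ k : Fin 4, (H.jet i).d k s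
      = -(s ^ 2 * (H.jet i).d k (liftB P Φ ha * phase X Y P Φ (i / 3))) := fun k => by
    have h := congrArg ((H.jet i).d k) hrs
    rw [Derivation.leibniz, Derivation.map_one_eq_zero, smul_eq_mul, smul_eq_mul] at h
    linear_combination s * h - (H.jet i).d k s * hrs
  refine ⟨?_, ?_, ?_⟩
  · have h3 : 3 * (i / 3) / (2 * i) = 1 / 2 := by field_simp
    rw [hinv, Derivation.leibniz, d3_liftB, H.d3_phase hi, h3, smul_zero, add_zero, smul_eq_mul]
    linear_combination (norm := algebra) -((1 / 2 : ℝ) • (s * hrs))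
  · rw [hinv, Derivation.leibniz, d2_liftB, d2_phase, smul_zero, smul_zero, add_zero, mul_zero,
      neg_zero]
  · rw [JetAlgebra.L_eq_zero_iff hrs, JetAlgebra.scaleEq_mul (H.D_phase _), hS, mul_zero]

-- A scale of pure phase `e^{-ψ/2}` coincides with its `minus` part, so `ρ` is a function of `(x,
-- y)` times the phase, and the Einstein condition reduces to the scale equation. Conversely, such a
-- scale gives a Ricci flat metric, so `Λ = 0` is the witness.
include H hi in
theorem scale_iff (hc : Convex ℝ (fefBox X Y P Φ)) (hP : P.Nonempty) (hΦ : Φ.Nonempty)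
    (hρ : ContDiffOn ℝ ∞ ρ (fefBox X Y P Φ)) (h0 : ∀ z ∈ fefBox X Y P Φ, ρ z ≠ 0) :
    ((∃ Λ : ℝ, EinsteinOn (gF i Q ρ) Λ (fefBox X Y P Φ)) ∧ HasPhase X Y P Φ (i / 3) ρ) ↔
      ∃ a : (Fin 2 → ℝ) → ℝ, ContDiffOn ℝ ∞ a (planeBox X Y) ∧
        (∀ z ∈ fefBox X Y P Φ, ρ z = a (toPlane (toJet z)) * Real.exp (i * z 3 / 3)) ∧
        ScaleEquation X Y P Q a := by
  obtain ⟨r, s, hr, hrs⟩ := exists_inverse hρ h0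
  have hexp : ∀ z : Fin 4 → ℝ, Real.exp (i / 3 * z 3) = Real.exp (i * z 3 / 3) := fun z => by
    congr 1; ring
  constructor
  · rintro ⟨⟨Λ, hE⟩, hph⟩
    have hph3 := (H.hasPhase_iff hc hΦ hr _).1 hph
    rw [H.hasPhase_pos_iff hi hc hΦ hr hrs] at hph
    have hm := (H.isPlus_isMinus_of_einstein hi hr hrs hE).2
    have hms : (H.jet i).minus s = s := by rw [JetAlgebra.minus, hph]; algebra
    rw [hms] at hm
    have h2 : der H.openM 2 r = 0 := by
      rw [der_inv H.openM (by rw [mul_comm, hrs] : s * r = 1), ← H.d2 i, hm.d2, mul_zero, neg_zero]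
    obtain ⟨a, ha, hf⟩ := H.exists_liftB hc hP hΦ (f := r * phase X Y P Φ (-(i / 3)))
      (by rw [Derivation.leibniz, h2, H.der_phase, if_neg (by decide), smul_zero, smul_zero, add_zero])
      (by rw [Derivation.leibniz, hph3, H.der_phase, if_pos rfl]; simp only [smul_eq_mul]; algebra)
    have hra : r = liftB P Φ ha * phase X Y P Φ (i / 3) := by
      rw [← hf, mul_assoc, phase_mul, neg_add_cancel, phase_zero, mul_one]
    refine ⟨a, ha, fun z hz => ?_, ?_⟩
    · rw [hr ⟨z, hz⟩, hra, ← hexp]; rfl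
    · rw [H.scaleEquation_iff ha i hΦ, ← hf, JetAlgebra.scaleEq_mul (H.D_phase _),
        (JetAlgebra.L_eq_zero_iff hrs).1 hm.L, mul_zero]
  · rintro ⟨a, ha, hra, hS⟩
    have hra' : r = liftB P Φ ha * phase X Y P Φ (i / 3) := smoothFn.ext fun z => by
      rw [← hr, hra z z.2, ← hexp]; rfl
    have hm := H.isMinus_of_scaleEquation hi ha hΦ hS (s := s) (by rw [← hra', hrs])
    refine ⟨⟨0, fun z hz b e => ?_⟩, (H.hasPhase_pos_iff hi hc hΦ hr hrs).2 hm.d3⟩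
    rw [H.ricciFlat hi hr hrs (Or.inr hm) z hz, zero_mul]

-- The statement does not involve `i`, so the value `i = 1` is used. The resulting scale is
-- invertible, and `w₁ s = 0` yields `w₁ = 0`.
include H ha in
theorem w₁_eq_zero_of_scaleEquation (hΦ : Φ.Nonempty) (h0 : ∀ q ∈ planeBox X Y, a q ≠ 0)
    (hS : ScaleEquation X Y P Q a) : ∀ z ∈ jetBox X Y P, w₁ Q z = 0 := by
  intro z hz
  obtain ⟨r, s, hr, hrs⟩ := exists_inverse (contDiffOn_out (liftB P Φ ha * phase X Y P Φ (1 / 3)))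
    fun w hw => by
      rw [out_apply _ ⟨w, hw⟩]
      exact mul_ne_zero (h0 _ (toPlane_mem (toJet_mem hw))) (Real.exp_ne_zero _)
  have hr' : r = liftB P Φ ha * phase X Y P Φ (1 / 3) :=
    smoothFn.ext fun w => by rw [← hr, out_apply]
  rw [hr'] at hrs
  have hm := H.isMinus_of_scaleEquation one_ne_zero ha hΦ hS hrs
  obtain ⟨φ, hφ⟩ := hΦ
  have h1 : (H.jet 1).w1 = 0 := by
    have := hm.w1_mul
    linear_combination (liftB P Φ ha * phase X Y P Φ (1 / 3)) * this - (H.jet 1).w1 * hrs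
  have h2 := H.w1_apply 1 ⟨ofJet φ z, ofJet_mem hφ hz⟩
  rw [h1, toJet_ofJet] at h2
  exact h2.symm

end SmoothOn

open smoothFn

/-! ### Local solutions of the scale equation -/

section Plane

open Set

/-- A point of the plane as a function on `Fin 2`. -/
def ofPair : ℝ × ℝ →L[ℝ] (Fin 2 → ℝ) :=
  ContinuousLinearMap.pi ![ContinuousLinearMap.fst ℝ ℝ ℝ, ContinuousLinearMap.snd ℝ ℝ ℝ]

/-- A function on `Fin 2` as a point of the plane. -/
def toPair : (Fin 2 → ℝ) →L[ℝ] ℝ × ℝ :=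
  (ContinuousLinearMap.proj (R := ℝ) (φ := fun _ => ℝ) 0).prod (ContinuousLinearMap.proj 1)

theorem ofPair_toPair (q : Fin 2 → ℝ) : ofPair (toPair q) = q := by
  ext k; fin_cases k <;> rfl

theorem ofPair_one_zero : ofPair (1, 0) = Pi.single 0 1 := by
  ext k; fin_cases k <;> simp [ofPair]

theorem ofPair_zero_one : ofPair (0, 1) = Pi.single 1 1 := by
  ext k; fin_cases k <;> simp [ofPair]

variable {X Y : Set ℝ} {m : ℕ}

/-- The matrix unit as a continuous linear map. -/
def matUnit (j k : Fin m) : (Fin m → ℝ) →L[ℝ] (Fin m → ℝ) :=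
  (ContinuousLinearMap.proj (R := ℝ) (φ := fun _ => ℝ) k).smulRight (Pi.single j 1)

/-- A matrix of functions of `(x, y)` as a family of operators. -/
def matOp (μ : Fin m → Fin m → (Fin 2 → ℝ) → ℝ) (z : ℝ × ℝ) : (Fin m → ℝ) →L[ℝ] (Fin m → ℝ) :=
  ∑ j, ∑ k, μ j k (ofPair z) • matUnit j k

theorem sum_matUnit_apply (c : Fin m → Fin m → ℝ) (v : Fin m → ℝ) (j : Fin m) :
    (∑ j, ∑ k, c j k • matUnit j k) v j = ∑ k, c j k * v k := by
  simp [matUnit, Pi.single_apply]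

theorem matOp_apply (μ : Fin m → Fin m → (Fin 2 → ℝ) → ℝ) (z : ℝ × ℝ) (v : Fin m → ℝ) (j : Fin m) :
    matOp μ z v j = ∑ k, μ j k (ofPair z) * v k := sum_matUnit_apply _ v j

theorem contDiffOn_matOp {μ : Fin m → Fin m → (Fin 2 → ℝ) → ℝ}
    (hμ : ∀ j k, ContDiffOn ℝ ∞ (μ j k) (planeBox X Y)) : ContDiffOn ℝ ∞ (matOp μ) (X ×ˢ Y) :=
  ContDiffOn.sum fun j _ => ContDiffOn.sum fun k _ =>
    ((hμ j k).comp ofPair.contDiff.contDiffOn fun _ hz => hz).smul contDiffOn_const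

theorem fderiv_matOp_apply {μ : Fin m → Fin m → (Fin 2 → ℝ) → ℝ} {z : ℝ × ℝ}
    (hμ : ∀ j k, DifferentiableAt ℝ (μ j k) (ofPair z)) (w : ℝ × ℝ) (v : Fin m → ℝ) (j : Fin m) :
    fderiv ℝ (matOp μ) z w v j = ∑ k, fderiv ℝ (μ j k) (ofPair z) (ofPair w) * v k := by
  have h1 : HasFDerivAt (matOp μ) (∑ j, ∑ k,
      ((fderiv ℝ (μ j k) (ofPair z)).comp ofPair).smulRight (matUnit j k)) z :=
    HasFDerivAt.fun_sum fun j _ => HasFDerivAt.fun_sum fun k _ =>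
      ((hμ j k).hasFDerivAt.comp z ofPair.hasFDerivAt).smul_const (matUnit j k)
  rw [h1.fderiv]
  rw [← sum_matUnit_apply (fun j k => fderiv ℝ (μ j k) (ofPair z) (ofPair w)) v j]
  simp only [_root_.sum_apply, ContinuousLinearMap.smulRight_apply, ContinuousLinearMap.comp_apply]

/-- Local solvability of integrable linear systems `v_x = μ v`, `v_y = ν v`. -/
theorem exists_solution_plane (hX : IsOpen X) (hY : IsOpen Y)
    {μ ν : Fin m → Fin m → (Fin 2 → ℝ) → ℝ} (hμ : ∀ j k, ContDiffOn ℝ ∞ (μ j k) (planeBox X Y))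
    (hν : ∀ j k, ContDiffOn ℝ ∞ (ν j k) (planeBox X Y))
    (hμν : ∀ q ∈ planeBox X Y, ∀ j k, pd 1 (μ j k) q + ∑ l, μ j l q * ν l k q
      = pd 0 (ν j k) q + ∑ l, ν j l q * μ l k q)
    {q₀ : Fin 2 → ℝ} (hq₀ : q₀ ∈ planeBox X Y) {O : Set (Fin m → ℝ)} (hO : IsOpen O)
    {v₀ : Fin m → ℝ} (hv₀ : v₀ ∈ O) :
    ∃ X' Y' : Set ℝ, IsOpen X' ∧ IsOpen Y' ∧ X' ⊆ X ∧ Y' ⊆ Y ∧ q₀ ∈ planeBox X' Y' ∧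
      ∃ v : Fin m → (Fin 2 → ℝ) → ℝ, (∀ j, ContDiffOn ℝ ∞ (v j) (planeBox X' Y')) ∧
        ∀ q ∈ planeBox X' Y', (fun j => v j q) ∈ O ∧ ∀ j, pd 0 (v j) q = ∑ k, μ j k q * v k q ∧
          pd 1 (v j) q = ∑ k, ν j k q * v k q := by
  have hd : ∀ {F : (Fin 2 → ℝ) → ℝ}, ContDiffOn ℝ ∞ F (planeBox X Y) → ∀ z ∈ X ×ˢ Y,
      DifferentiableAt ℝ F (ofPair z) := fun hF z hz =>
    differentiableAt_of_contDiffOn (isOpen_planeBox hX hY) hF hz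
  obtain ⟨W, hWo, hzW, hWU, V, hVs, hV₀, hV⟩ := exists_total_solution (hX.prod hY)
    (contDiffOn_matOp hμ) (contDiffOn_matOp hν) (z₀ := toPair q₀) (fun z hz => by
      ext v j
      simp only [_root_.add_apply, ContinuousLinearMap.comp_apply, Pi.add_apply]
      rw [fderiv_matOp_apply (fun j k => hd (hμ j k) z hz),
        fderiv_matOp_apply (fun j k => hd (hν j k) z hz), matOp_apply, matOp_apply,
        ofPair_one_zero, ofPair_zero_one]
      simp only [matOp_apply, Finset.mul_sum]
      rw [Finset.sum_comm, Finset.sum_comm (f := fun k l => ν j k (ofPair z)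
        * (μ k l (ofPair z) * v l)), ← Finset.sum_add_distrib, ← Finset.sum_add_distrib]
      refine Finset.sum_congr rfl fun k _ => ?_
      have h := hμν (ofPair z) hz j k
      simp only [← mul_assoc, ← Finset.sum_mul, ← add_mul]
      exact congrArg (· * v k) h) hq₀ v₀
  -- Shrinking the neighbourhood keeps the solution inside the open set `O`; this is how
  -- nonvanishing is secured later.
  have hW' : IsOpen (W ∩ V ⁻¹' O) := hVs.continuousOn.isOpen_inter_preimage hWo hO
  obtain ⟨X', Y', hX', hY', hx, hy, hsub⟩ := isOpen_prod_iff.1 hW' (toPair q₀).1 (toPair q₀).2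
    ⟨hzW, by simpa [hV₀] using hv₀⟩
  have hmem : ∀ q ∈ planeBox X' Y', toPair q ∈ W ∩ V ⁻¹' O := fun q hq => hsub ⟨hq.1, hq.2⟩
  refine ⟨X', Y', hX', hY', fun x hx' => (hWU (hsub (Set.mk_mem_prod hx' hy)).1).1,
    fun y hy' => (hWU (hsub (Set.mk_mem_prod hx hy')).1).2, ⟨hx, hy⟩, fun j q => V (toPair q) j, fun j => ?_,
    fun q hq => ⟨(hmem q hq).2, fun j => ?_⟩⟩
  · exact (contDiffOn_pi.1 hVs j).comp toPair.contDiff.contDiffOn fun q hq => (hmem q hq).1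
  · have h1 := hasFDerivAt_pi'.1 ((hV _ (hmem q hq).1).comp q toPair.hasFDerivAt) j
    have h2 : ∀ k, pd k (fun q => V (toPair q) j) q
        = (toPair (Pi.single k 1)).1 * matOp μ (toPair q) (V (toPair q)) j
          + (toPair (Pi.single k 1)).2 * matOp ν (toPair q) (V (toPair q)) j := fun k => by
      rw [pd, show (fun q => V (toPair q) j) = fun q => (V ∘ toPair) q j from rfl, h1.fderiv]
      simp
    rw [h2, h2, matOp_apply, matOp_apply, ofPair_toPair]
    simp [toPair]

end Plane

/-! ### The closed system of the scale equation when `Q` is cubic in `p` -/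

namespace JetAlgebra

variable {R : Type*} [CommRing R] [Algebra ℝ R]

/-- The `p⁰`-coefficient of the potential in the scale equation of a cubic `Q`. -/
def pot0 (c cx cy : Fin 4 → R) : R :=
  (1 / 3 : ℝ) • (cx 1 + 2 * c 0 * c 2) - cy 0 - (2 / 9 : ℝ) • c 1 ^ 2

/-- The `p¹`-coefficient of the potential in the scale equation of a cubic `Q`. -/
def pot1 (c cx cy : Fin 4 → R) : R :=
  (1 / 3 : ℝ) • (2 * cx 2 + 6 * c 0 * c 3) - (2 / 3 : ℝ) • cy 1 - (2 / 9 : ℝ) • (c 1 * c 2)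

/-- The `p²`-coefficient of the potential in the scale equation of a cubic `Q`. -/
def pot2 (c cx cy : Fin 4 → R) : R :=
  cx 3 + (2 / 3 : ℝ) • (c 1 * c 3) - (1 / 3 : ℝ) • cy 2 - (2 / 9 : ℝ) • c 2 ^ 2

/-- The `x`-derivative of `(b, b_x, b_y)` for a solution `b` of the scale equation. -/
def sysX (c cx cy : Fin 4 → R) : Matrix (Fin 3) (Fin 3) R :=
  !![0, 1, 0;
    -pot0 c cx cy, (1 / 3 : ℝ) • c 1, -c 0;
    -((1 / 2 : ℝ) • pot1 c cx cy), (1 / 3 : ℝ) • c 2, -((1 / 3 : ℝ) • c 1)]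

/-- The `y`-derivative of `(b, b_x, b_y)` for a solution `b` of the scale equation. -/
def sysY (c cx cy : Fin 4 → R) : Matrix (Fin 3) (Fin 3) R :=
  !![0, 0, 1;
    -((1 / 2 : ℝ) • pot1 c cx cy), (1 / 3 : ℝ) • c 2, -((1 / 3 : ℝ) • c 1);
    -pot2 c cx cy, c 3, -((1 / 3 : ℝ) • c 2)]

variable {J : JetAlgebra R}

/-- For cubic `Q` the invariant `w1` is affine in `p`. Of the nine integrability conditions all but
two hold identically, and these two are, up to the factor 1/6, the coefficients `w1 - p ∂_p w1` and
`∂_p w1`. -/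
theorem sys_integrable {c : Fin 4 → R} (hc : ∀ j, J.d 2 (c j) = 0)
    (hQ : J.Q = c 0 + c 1 * J.p + c 2 * J.p ^ 2 + c 3 * J.p ^ 3) (hw : J.w1 = 0)
    (j k : Fin 3) :
    let M := sysX c (fun j => J.d 0 (c j)) fun j => J.d 1 (c j)
    let N := sysY c (fun j => J.d 0 (c j)) fun j => J.d 1 (c j)
    J.d 1 (M j k) + ∑ l, M j l * N l k = J.d 0 (N j k) + ∑ l, N j l * M l k := by
  intro M N
  have hcd : ∀ j k, J.d 2 (J.d k (c j)) = 0 := fun j k => by rw [J.comm, hc, map_zero]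
  have hcdd : ∀ j k l, J.d 2 (J.d l (J.d k (c j))) = 0 := fun j k l => by
    rw [J.comm, hcd, map_zero]
  have hQ' : J.Q = c 0 + c 1 * J.p + c 2 * (J.p * J.p) + c 3 * (J.p * (J.p * J.p)) := by
    rw [hQ]; ring
  simp only [w1, D, hQ', map_add, Derivation.leibniz, smul_eq_mul, J.d2_p, J.d1_p, J.d0_p, hc, hcd,
    mul_zero, add_zero, zero_add, mul_one, Derivation.map_one_eq_zero,
    J.d10] at hw
  have hw' := congrArg (J.d 2) hw
  simp only [map_add, map_sub, Derivation.leibniz, smul_eq_mul, J.d2_p, hc, hcd, hcdd, map_zero,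
    J.d_ofNat, mul_zero, add_zero, zero_add, mul_one, Derivation.map_one_eq_zero] at hw'
  fin_cases j <;> fin_cases k <;>
    simp [M, N, sysX, sysY, Fin.sum_univ_three, pot0, pot1, pot2, J.d10, J.d_ofNat]
  all_goals try algebra
  · linear_combination (norm := algebra) (1 / 6 : ℝ) • hw - (1 / 6 : ℝ) • (J.p * hw')
  · linear_combination (norm := algebra) (1 / 6 : ℝ) • hw'

/-- For cubic `Q` the expression `L b` is only quadratic in `p`, as the higher powers cancel. Its
three coefficients are the equations for `b_xx`, `b_xy` and `b_yy` encoded in `sysX` and `sysY`. -/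
theorem L_eq_zero_of_sys {c : Fin 4 → R} (hc : ∀ j, J.d 2 (c j) = 0)
    (hQ : J.Q = c 0 + c 1 * J.p + c 2 * J.p ^ 2 + c 3 * J.p ^ 3) {v : Fin 3 → R}
    (hv : ∀ j, J.d 2 (v j) = 0)
    (h0 : ∀ j, J.d 0 (v j) = ∑ k, sysX c (fun j => J.d 0 (c j)) (fun j => J.d 1 (c j)) j k * v k)
    (h1 : ∀ j, J.d 1 (v j) = ∑ k, sysY c (fun j => J.d 0 (c j)) (fun j => J.d 1 (c j)) j k * v k) :
    J.L (v 0) = 0 := by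
  have hcd : ∀ j k, J.d 2 (J.d k (c j)) = 0 := fun j k => by rw [J.comm, hc, map_zero]
  have a1 : J.d 2 J.Q = c 1 + 2 * c 2 * J.p + 3 * c 3 * J.p ^ 2 := by
    rw [hQ]
    simp [J.d2_p, hc]
    ring
  have x0 := h0 0
  have y0 := h1 0
  have x1 := h0 1
  have y1 := h1 1
  have x2 := h0 2
  have y2 := h1 2
  simp [sysX, sysY, Fin.sum_univ_three] at x0 y0 x1 y1 x2 y2
  have a2 : J.D (v 0) = v 1 + J.p * v 2 := by rw [D, x0, y0, hv]; ring
  rw [L, a1, a2]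
  simp only [D, hQ, map_add, Derivation.leibniz, Derivation.leibniz_pow, hv, x1, y1, x2, y2,
    J.d0_p, J.d1_p, J.d2_p, hc, smul_eq_mul, nsmul_eq_mul, J.d_ofNat]
  simp only [pot0, pot1, pot2]
  push_cast
  algebra

end JetAlgebra

/-! ### Conformal flatness when both invariants vanish -/

open smoothFn

namespace JetAlgebra

variable {R : Type*} [CommRing R] [Algebra ℝ R] {J : JetAlgebra R}

/-- If `Q_pppp = 0` then `Q` is a cubic polynomial in `p`. -/
theorem exists_cubic (hw : J.w2 = 0) : ∃ c : Fin 4 → R, (∀ j, J.d 2 (c j) = 0) ∧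
    (∀ j, J.d 3 (c j) = 0) ∧ J.Q = c 0 + c 1 * J.p + c 2 * J.p ^ 2 + c 3 * J.p ^ 3 := by
  set q1 := J.d 2 J.Q with h1
  set q2 := J.d 2 q1 with h2
  set q3 := J.d 2 q2 with h3
  have h4 : J.d 2 q3 = 0 := hw
  have k1 : J.d 3 q1 = 0 := by rw [h1, J.comm, J.d3_Q, map_zero]
  have k2 : J.d 3 q2 = 0 := by rw [h2, J.comm, k1, map_zero]
  have k3 : J.d 3 q3 = 0 := by rw [h3, J.comm, k2, map_zero]
  -- Taylor coefficients of `Q` in `p`, expanded around the current point and shifted formally to `p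
  -- = 0`, a value that need not lie in `P`.
  refine ⟨![J.Q - J.p * q1 + (1 / 2 : ℝ) • (J.p * (J.p * q2)) - (1 / 6 : ℝ) • (J.p * (J.p * (J.p * q3))),
    q1 - J.p * q2 + (1 / 2 : ℝ) • (J.p * (J.p * q3)), (1 / 2 : ℝ) • (q2 - J.p * q3),
    (1 / 6 : ℝ) • q3], fun j => ?_, fun j => ?_, ?_⟩
  · fin_cases j <;>
      simp [Derivation.leibniz, J.d2_p, ← h1, ← h2, ← h3, h4] <;> algebra
  · fin_cases j <;>
      simp [Derivation.leibniz, J.d3_p, J.d3_Q, k1, k2, k3]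
  · simp; algebra

theorem L_mul {b e : R} (he : J.D e = 0) : J.L (b * e) = e * J.L b := by
  simp only [L, D_mul, D_add, he, D_zero]
  algebra

end JetAlgebra

namespace SmoothOn

variable {X Y P Φ : Set ℝ} {Q : (Fin 3 → ℝ) → ℝ} {ρ : (Fin 4 → ℝ) → ℝ}

theorem sysX_apply {n : ℕ} {U : Set (Fin n → ℝ)} (c cx cy : Fin 4 → smoothFn U) (j k : Fin 3)
    (z : U) : (JetAlgebra.sysX c cx cy j k).1 z = JetAlgebra.sysX (fun j => (c j).1 z)
      (fun j => (cx j).1 z) (fun j => (cy j).1 z) j k := by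
  fin_cases j <;> fin_cases k <;> rfl

theorem sysY_apply {n : ℕ} {U : Set (Fin n → ℝ)} (c cx cy : Fin 4 → smoothFn U) (j k : Fin 3)
    (z : U) : (JetAlgebra.sysY c cx cy j k).1 z = JetAlgebra.sysY (fun j => (c j).1 z)
      (fun j => (cx j).1 z) (fun j => (cy j).1 z) j k := by
  fin_cases j <;> fin_cases k <;> rfl

theorem contDiffOn_sysX {U : Set (Fin 2 → ℝ)} {c cx cy : Fin 4 → (Fin 2 → ℝ) → ℝ}
    (hc : ∀ j, ContDiffOn ℝ ∞ (c j) U) (hx : ∀ j, ContDiffOn ℝ ∞ (cx j) U)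
    (hy : ∀ j, ContDiffOn ℝ ∞ (cy j) U) (j k : Fin 3) :
    ContDiffOn ℝ ∞ (fun q => JetAlgebra.sysX (fun j => c j q) (fun j => cx j q)
      (fun j => cy j q) j k) U := by
  fin_cases j <;> fin_cases k <;>
    simp [JetAlgebra.sysX, JetAlgebra.pot0, JetAlgebra.pot1] <;> fun_prop

theorem contDiffOn_sysY {U : Set (Fin 2 → ℝ)} {c cx cy : Fin 4 → (Fin 2 → ℝ) → ℝ}
    (hc : ∀ j, ContDiffOn ℝ ∞ (c j) U) (hx : ∀ j, ContDiffOn ℝ ∞ (cx j) U)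
    (hy : ∀ j, ContDiffOn ℝ ∞ (cy j) U) (j k : Fin 3) :
    ContDiffOn ℝ ∞ (fun q => JetAlgebra.sysY (fun j => c j q) (fun j => cx j q)
      (fun j => cy j q) j k) U := by
  fin_cases j <;> fin_cases k <;>
    simp [JetAlgebra.sysY, JetAlgebra.pot1, JetAlgebra.pot2] <;> fun_prop

variable (H : SmoothOn X Y P Φ Q) {i : ℝ} (hi : i ≠ 0)

theorem w1_eq_zero (h : ∀ z ∈ jetBox X Y P, w₁ Q z = 0) : (H.jet i).w1 = 0 :=
  smoothFn.ext fun z => (H.w1_apply i z).trans (h _ (toJet_mem z.2))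

theorem w2_eq_zero (h : ∀ z ∈ jetBox X Y P, w₂ Q z = 0) : (H.jet i).w2 = 0 :=
  smoothFn.ext fun z => (H.w2_apply i z).trans (h _ (toJet_mem z.2))

include H hi in
/-- Local existence of nowhere vanishing solutions of the linear scale equation. -/
theorem exists_scale (hc : Convex ℝ (fefBox X Y P Φ)) (h1 : ∀ z ∈ jetBox X Y P, w₁ Q z = 0)
    (h2 : ∀ z ∈ jetBox X Y P, w₂ Q z = 0) {z₀ : Fin 4 → ℝ} (hz₀ : z₀ ∈ fefBox X Y P Φ) :
    ∃ (X' Y' : Set ℝ) (H' : SmoothOn X' Y' P Φ Q), X' ⊆ X ∧ Y' ⊆ Y ∧ z₀ ∈ fefBox X' Y' P Φ ∧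
      ∃ (b : (Fin 2 → ℝ) → ℝ) (hb : ContDiffOn ℝ ∞ b (planeBox X' Y')),
        (∀ q ∈ planeBox X' Y', b q ≠ 0) ∧ (H'.jet i).L (liftB P Φ hb) = 0 := by
  have hP : P.Nonempty := ⟨_, hz₀.2.2.1⟩
  have hΦ : Φ.Nonempty := ⟨_, hz₀.2.2.2⟩
  obtain ⟨c, hc2, hc3, hQ⟩ := JetAlgebra.exists_cubic (H.w2_eq_zero (i := i) h2)
  have hex : ∀ j, ∃ (a : (Fin 2 → ℝ) → ℝ) (ha : ContDiffOn ℝ ∞ a (planeBox X Y)),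
      c j = liftB P Φ ha := fun j => H.exists_liftB hc hP hΦ (by rw [← H.d2 i, hc2])
    (by rw [(H.d3_eq_iff hi _ _).1 (hc3 j), smul_zero])
  choose C hC hcC using hex
  have hC0 := fun j => contDiffOn_pd H.openB (hC j) 0
  have hC1 := fun j => contDiffOn_pd H.openB (hC j) 1
  have hd0 : ∀ j, (H.jet i).d 0 (c j) = liftB P Φ (hC0 j) := fun j => by rw [hcC, d0_liftB]
  have hd1 : ∀ j, (H.jet i).d 1 (c j) = liftB P Φ (hC1 j) := fun j => by rw [hcC, d1_liftB]
  have hμ := contDiffOn_sysX hC hC0 hC1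
  have hν := contDiffOn_sysY hC hC0 hC1
  have hμJ : ∀ j k, JetAlgebra.sysX c (fun j => (H.jet i).d 0 (c j)) (fun j => (H.jet i).d 1 (c j)) j k
      = liftB P Φ (hμ j k) := fun j k => smoothFn.ext fun z => by
    rw [sysX_apply]; simp only [hd0, hd1]; simp only [hcC]; rfl
  have hνJ : ∀ j k, JetAlgebra.sysY c (fun j => (H.jet i).d 0 (c j)) (fun j => (H.jet i).d 1 (c j)) j k
      = liftB P Φ (hν j k) := fun j k => smoothFn.ext fun z => by
    rw [sysY_apply]; simp only [hd0, hd1]; simp only [hcC]; rfl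
  -- The initial value `(b, b_x, b_y) = (1, 0, 0)` and the open condition `v 0 ≠ 0` make `b`
  -- nonvanishing nearby.
  obtain ⟨X', Y', hX', hY', hXX, hYY, hz, v, hv, hvO⟩ := exists_solution_plane H.openX H.openY hμ hν
    (fun q hq j k => by
      have h := JetAlgebra.sys_integrable hc2 hQ (H.w1_eq_zero h1) j k
      simp only [hμJ, hνJ, d1_liftB, d0_liftB] at h
      have hq' : ofJet (z₀ 3) (ofPlane (z₀ 2) q) ∈ fefBox X Y P Φ :=
        ofJet_mem hz₀.2.2.2 (ofPlane_mem hz₀.2.2.1 hq)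
      have h' := congrArg (fun f => f.1 ⟨_, hq'⟩) h
      simp only [smoothFn.add_apply, smoothFn.sum_apply, smoothFn.mul_apply, liftB_apply, toJet_ofJet,
        toPlane_ofPlane] at h'
      exact h') (toPlane_mem (toJet_mem hz₀)) (O := {v | v 0 ≠ 0})
    (isOpen_ne.preimage (continuous_apply 0)) (v₀ := ![1, 0, 0]) (by simp)
  have hsub : planeBox X' Y' ⊆ planeBox X Y := fun q hq => ⟨hXX hq.1, hYY hq.2⟩
  have H' : SmoothOn X' Y' P Φ Q := ⟨hX', hY', H.openP, H.openΦ,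
    H.smooth.mono fun q hq => ⟨hXX hq.1, hYY hq.2.1, hq.2.2⟩⟩
  refine ⟨X', Y', H', hXX, hYY, ⟨hz.1, hz.2, hz₀.2.2⟩, v 0, hv 0, fun q hq => (hvO q hq).1, ?_⟩
  have hC' := fun j => (hC j).mono hsub
  refine JetAlgebra.L_eq_zero_of_sys (c := fun j => liftB P Φ (hC' j))
    (v := fun j => liftB P Φ (hv j)) (fun j => H'.d2_liftB _) (smoothFn.ext fun z => ?_)
    (fun j => H'.d2_liftB _) (fun j => ?_) (fun j => ?_)
  · have hzz : z.1 ∈ fefBox X Y P Φ := ⟨hXX z.2.1, hYY z.2.2.1, z.2.2.2⟩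
    have h := congrArg (fun f => f.1 ⟨z.1, hzz⟩) hQ
    simp only [hcC] at h
    exact h
  · simp only [d0_liftB, d1_liftB]
    refine smoothFn.ext fun z => ?_
    rw [smoothFn.sum_apply]
    simp only [smoothFn.mul_apply, sysX_apply, liftB_apply]
    exact ((hvO _ (toPlane_mem (toJet_mem z.2))).2 j).1
  · simp only [d0_liftB, d1_liftB]
    refine smoothFn.ext fun z => ?_
    rw [smoothFn.sum_apply]
    simp only [smoothFn.mul_apply, sysY_apply, liftB_apply]
    exact ((hvO _ (toPlane_mem (toJet_mem z.2))).2 j).2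

-- The class of `g_F` contains the metric of the scale `σ = b e^{-iφ/3}` with `L b = 0`, and that
-- metric is flat by `IsMinus.curv_eq_zero`.
include H hi in
theorem conformallyFlat (hc : Convex ℝ (fefBox X Y P Φ))
    (hρ : ContDiffOn ℝ ∞ ρ (fefBox X Y P Φ)) (h0 : ∀ z ∈ fefBox X Y P Φ, ρ z ≠ 0)
    (h1 : ∀ z ∈ jetBox X Y P, w₁ Q z = 0) (h2 : ∀ z ∈ jetBox X Y P, w₂ Q z = 0) :
    ConformallyFlatOn (gF i Q ρ) (fefBox X Y P Φ) := by
  intro z₀ hz₀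
  obtain ⟨X', Y', H', hXX, hYY, hz, b, hb, hb0, hL⟩ := H.exists_scale hi hc h1 h2 hz₀
  have hsub : fefBox X' Y' P Φ ⊆ fefBox X Y P Φ := fun q hq => ⟨hXX hq.1, hYY hq.2.1, hq.2.2⟩
  have hsubJ : jetBox X' Y' P ⊆ jetBox X Y P := fun q hq => ⟨hXX hq.1, hYY hq.2.1, hq.2.2⟩
  set s := liftB P Φ hb * phase X' Y' P Φ (-(i / 3)) with hs
  set σ : (Fin 4 → ℝ) → ℝ := fun z => b (toPlane (toJet z)) * Real.exp (-(i / 3) * z 3) with hσ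
  have hσs : ∀ z : fefBox X' Y' P Φ, s.1 z = σ z := fun z => rfl
  have hσ0 : ∀ z ∈ fefBox X' Y' P Φ, σ z ≠ 0 := fun z hz =>
    mul_ne_zero (hb0 _ (toPlane_mem (toJet_mem hz))) (Real.exp_ne_zero _)
  have hσc : ContDiffOn ℝ ∞ σ (fefBox X' Y' P Φ) :=
    (contDiffOn_comp_toJet (contDiffOn_comp_toPlane hb)).mul
      (Real.contDiff_exp.comp (contDiff_const.mul (contDiff_apply ℝ ℝ (3 : Fin 4)))).contDiffOn
  set r := smoothFn.mk (fun z => (σ z)⁻¹) (hσc.inv hσ0) with hr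
  have hrs : r * s = 1 := smoothFn.ext fun z => inv_mul_cancel₀ (hσ0 z z.2)
  have hm : (H'.jet i).IsMinus s := by
    have h3 : 3 * -(i / 3) / (2 * i) = -(1 / 2) := by field_simp
    refine ⟨?_, ?_, ?_⟩
    · rw [hs, Derivation.leibniz, d3_liftB, H'.d3_phase hi, h3, smul_zero, add_zero, smul_eq_mul]
      algebra
    · rw [hs, Derivation.leibniz, d2_liftB, d2_phase, smul_zero, smul_zero, add_zero]
    · rw [hs, JetAlgebra.L_mul (H'.D_phase _), hL, mul_zero]
  -- This `u` satisfies `e^{2u} = (ρσ)⁻²`, so `e^{2u} g_F` is the Fefferman metric with `ρ` replaced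
  -- by `1/σ`. The square inside the logarithm makes the signs of `ρ` and `σ` irrelevant.
  refine ⟨fefBox X' Y' P Φ, H'.openM, hz, hsub, fun z => -(1 / 2) * Real.log ((ρ z * σ z) ^ 2),
    contDiffOn_const.mul ((((hρ.mono hsub).mul hσc).pow 2).log fun z hz =>
      pow_ne_zero 2 (mul_ne_zero (h0 z (hsub hz)) (hσ0 z hz))), fun w hw a b' c e => ?_⟩
  rw [H'.riemann_eq hi (ρ := fun z => (σ z)⁻¹) (r := r) (s := s) (fun _ => rfl) hrs
    (fun z hz a b => ?_) a b' c e ⟨w, hw⟩, hm.curv_eq_zero hrs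
    (H'.w1_eq_zero fun z hz => h1 z (hsubJ hz)) (H'.w2_eq_zero fun z hz => h2 z (hsubJ hz)),
    smoothFn.zero_apply, mul_zero]
  have hpos : 0 < (ρ z * σ z) ^ 2 := by
    have := mul_ne_zero (h0 z (hsub hz)) (hσ0 z hz)
    positivity
  have hexp : Real.exp (2 * (-(1 / 2) * Real.log ((ρ z * σ z) ^ 2))) = ((ρ z * σ z) ^ 2)⁻¹ := by
    rw [show 2 * (-(1 / 2) * Real.log ((ρ z * σ z) ^ 2)) = -Real.log ((ρ z * σ z) ^ 2) by ring,
      Real.exp_neg, Real.exp_log hpos]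
  rw [Matrix.smul_apply, smul_eq_mul, hexp, H'.gF_apply i _ ⟨z, hz⟩, H'.gF_apply i _ ⟨z, hz⟩]
  have h3 := h0 z (hsub hz)
  have h4 := hσ0 z hz
  field_simp

-- Failure of conformal flatness excludes `w₁ = w₂ = 0`, and in the remaining cases `ρ` has a pure
-- phase. The scale then equals its `plus` or its `minus` part, either of which gives a Ricci flat
-- metric.
include H hi in
theorem ricciFlat_of_einstein (hc : Convex ℝ (fefBox X Y P Φ)) (hne : (fefBox X Y P Φ).Nonempty)
    (hρ : ContDiffOn ℝ ∞ ρ (fefBox X Y P Φ)) (h0 : ∀ z ∈ fefBox X Y P Φ, ρ z ≠ 0)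
    {Λ : ℝ} (hE : EinsteinOn (gF i Q ρ) Λ (fefBox X Y P Φ))
    (h : HasPhase X Y P Φ (-(i / 3)) ρ ∨ HasPhase X Y P Φ (i / 3) ρ ∨
      ¬ ConformallyFlatOn (gF i Q ρ) (fefBox X Y P Φ)) :
    RicciFlatOn (gF i Q ρ) (fefBox X Y P Φ) := by
  have hΦ : Φ.Nonempty := let ⟨z, hz⟩ := hne; ⟨z 3, hz.2.2.2⟩
  have h' : HasPhase X Y P Φ (-(i / 3)) ρ ∨ HasPhase X Y P Φ (i / 3) ρ := by
    rcases h with h | h | h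
    · exact Or.inl h
    · exact Or.inr h
    · rcases (H.einstein_cases hi hc hne hρ h0 hE).2 with h3 | h3 | h3
      · exact absurd (H.conformallyFlat hi hc hρ h0 h3.1 h3.2) h
      · exact Or.inl h3.2.2
      · exact Or.inr h3.2.2
  obtain ⟨r, s, hr, hrs⟩ := exists_inverse hρ h0
  obtain ⟨hp, hm⟩ := H.isPlus_isMinus_of_einstein hi hr hrs hE
  refine H.ricciFlat hi hr hrs ?_
  rcases h' with h' | h'
  · rw [H.hasPhase_neg_iff hi hc hΦ hr hrs] at h'
    left
    rwa [JetAlgebra.plus, h', ← add_smul, add_halves, one_smul] at hp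
  · rw [H.hasPhase_pos_iff hi hc hΦ hr hrs] at h'
    right
    rwa [JetAlgebra.minus, h', sub_neg_eq_add, ← add_smul, add_halves, one_smul] at hm

end SmoothOn

/-! ### Scales affine in `p` and the equations they determine -/

open smoothFn

namespace JetAlgebra

variable {R : Type*} [CommRing R] [Algebra ℝ R] {J : JetAlgebra R}

/-- The right hand side of the equations of the first family. -/
def firstQ (p ax ay b bx b_y c : R) : R :=
  p ^ 3 * c + p ^ 2 * (6 * b * c - 2 * ay) + p * (12 * b ^ 2 * c - 3 * b_y - 6 * b * ay - ax)
    + 8 * b ^ 3 * c - 2 * b * b_y - 4 * b ^ 2 * ay - 2 * bx - 2 * b * ax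

section

variable {A a b c : R} (hA : ∀ k, J.d k A = (2 / 3 : ℝ) • (J.d k a * A)) (ha : J.d 2 a = 0)
  (hb : J.d 2 b = 0)
include hA ha hb

/-- `A` plays the role of `±e^{2a/3}`, of which only the logarithmic derivative is needed here. -/
theorem D_firstScale : J.D (A * (J.p + 2 * b))
    = A * ((2 / 3 : ℝ) • ((J.d 0 a + J.p * J.d 1 a) * (J.p + 2 * b))
      + 2 * J.d 0 b + 2 * J.p * J.d 1 b + J.Q) := by
  simp only [D, Derivation.leibniz, map_add, J.d0_p, J.d1_p, J.d2_p, hA, ha, hb, J.d_ofNat,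
    smul_eq_mul]
  algebra

/-- The scale determines the equation in the first family. -/
theorem eq_firstQ {A' : R} (hAA : A' * A = 1)
    (hD : J.D (A * (J.p + 2 * b)) = (1 / 3 : ℝ) • (J.d 2 J.Q * (A * (J.p + 2 * b)))) :
    J.Q = firstQ J.p (J.d 0 a) (J.d 1 a) b (J.d 0 b) (J.d 1 b)
      ((1 / 6 : ℝ) • J.d 2 (J.d 2 (J.d 2 J.Q))) := by
  have h0 : (2 / 3 : ℝ) • ((J.d 0 a + J.p * J.d 1 a) * (J.p + 2 * b))
      + 2 * J.d 0 b + 2 * J.p * J.d 1 b + J.Q = (1 / 3 : ℝ) • (J.d 2 J.Q * (J.p + 2 * b)) := by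
    rw [D_firstScale hA ha hb] at hD
    linear_combination (norm := algebra) A' * hD
      + ((1 / 3 : ℝ) • (J.d 2 J.Q * (J.p + 2 * b))
        - ((2 / 3 : ℝ) • ((J.d 0 a + J.p * J.d 1 a) * (J.p + 2 * b))
          + 2 * J.d 0 b + 2 * J.p * J.d 1 b + J.Q)) * hAA
  have hak : ∀ k, J.d 2 (J.d k a) = 0 := fun k => by rw [J.comm, ha, map_zero]
  have hbk : ∀ k, J.d 2 (J.d k b) = 0 := fun k => by rw [J.comm, hb, map_zero]
  -- With `u = p + 2b` the equation has the form `Q - u Q_p/3 = F`. Adding `u/2` times its first and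
  -- `u²/2` times its second `p`-derivative cancels `Q_p` and `Q_pp`, leaving only `Q` and `u³
  -- Q_ppp/6`.
  have h1 := congrArg (J.d 2) h0
  simp only [map_add, Derivation.map_smul, Derivation.leibniz, J.d2_p, hak, hbk, hb, J.d_ofNat,
    smul_eq_mul, mul_zero, zero_add, mul_one, add_zero] at h1
  have h2 := congrArg (J.d 2) h1
  simp only [map_add, Derivation.map_smul, Derivation.leibniz, J.d2_p, hak, hbk, hb, J.d_ofNat,
    smul_eq_mul, mul_zero, zero_add, mul_one, add_zero] at h2
  rw [firstQ]
  linear_combination (norm := algebra) h0 + (1 / 2 : ℝ) • ((J.p + 2 * b) * h1)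
    + (1 / 2 : ℝ) • ((J.p + 2 * b) ^ 2 * h2)

theorem D_of_firstQ (hc : J.d 2 c = 0)
    (hQ : J.Q = firstQ J.p (J.d 0 a) (J.d 1 a) b (J.d 0 b) (J.d 1 b) c) :
    J.D (A * (J.p + 2 * b)) = (1 / 3 : ℝ) • (J.d 2 J.Q * (A * (J.p + 2 * b))) := by
  have hak : ∀ k, J.d 2 (J.d k a) = 0 := fun k => by rw [J.comm, ha, map_zero]
  have hbk : ∀ k, J.d 2 (J.d k b) = 0 := fun k => by rw [J.comm, hb, map_zero]
  rw [D_firstScale hA ha hb, hQ, firstQ]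
  simp only [map_add, map_sub, Derivation.leibniz, Derivation.leibniz_pow, J.d2_p, hak, hbk, hb, hc,
    J.d_ofNat, smul_eq_mul, nsmul_eq_mul]
  push_cast
  algebra

omit hb

theorem D_secondScale : J.D A = A * (2 / 3 : ℝ) • (J.d 0 a + J.p * J.d 1 a) := by
  simp only [D, hA, ha]
  algebra

end

end JetAlgebra

theorem der_exp {n : ℕ} {U : Set (Fin n → ℝ)} (hU : IsOpen U) {f g : smoothFn U} {ε κ : ℝ}
    (h : ∀ z, f.1 z = ε * Real.exp (κ * g.1 z)) (k : Fin n) :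
    der hU k f = κ • (der hU k g * f) := smoothFn.ext fun z => by
  have hF : ∀ z : U, ε * Real.exp (κ * out g z) = f.1 z := fun z => by rw [out_apply, h]
  have h1 := (differentiableAt_of_contDiffOn hU (contDiffOn_out g) z.2).hasFDerivAt
  have h2 := ((h1.const_mul κ).exp).const_mul ε
  rw [← pd_eq_der hU (F := fun z => ε * Real.exp (κ * out g z)) hF k z, pd, h2.fderiv, smul_apply, smoothFn.mul_apply, h,
    ← pd_eq_der hU (out_apply g) k z, pd, out_apply]
  simp
  ring

/-- A nowhere vanishing function on a convex set has a logarithm up to sign. -/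
theorem exists_log {n : ℕ} {U : Set (Fin n → ℝ)} (hc : Convex ℝ U)
    {F : (Fin n → ℝ) → ℝ} (hF : ContDiffOn ℝ ∞ F U) (h0 : ∀ z ∈ U, F z ≠ 0) :
    ∃ (ε : ℝ) (a : (Fin n → ℝ) → ℝ), (ε = 1 ∨ ε = -1) ∧ ContDiffOn ℝ ∞ a U ∧
      ∀ z ∈ U, F z = ε * Real.exp (2 / 3 * a z) := by
  have hsign : (∀ z ∈ U, 0 < F z) ∨ ∀ z ∈ U, F z < 0 := by
    by_contra hcon
    push Not at hcon
    obtain ⟨⟨z, hz, hz'⟩, w, hw, hw'⟩ := hcon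
    obtain ⟨t, ht, ht'⟩ := hc.isPreconnected.intermediate_value hz hw hF.continuousOn ⟨hz', hw'⟩
    exact h0 t ht ht'
  have ha : ContDiffOn ℝ ∞ (fun z => 3 / 2 * Real.log (F z)) U := contDiffOn_const.mul (hF.log h0)
  have hexp : ∀ z ∈ U, Real.exp (2 / 3 * (3 / 2 * Real.log (F z))) = |F z| := fun z hz => by
    rw [← mul_assoc, show (2 / 3 : ℝ) * (3 / 2) = 1 by norm_num, one_mul,
      Real.exp_log_eq_abs (h0 z hz)]
  rcases hsign with hs | hs
  · exact ⟨1, _, Or.inl rfl, ha, fun z hz => by rw [hexp z hz, abs_of_pos (hs z hz), one_mul]⟩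
  · exact ⟨-1, _, Or.inr rfl, ha, fun z hz => by rw [hexp z hz, abs_of_neg (hs z hz)]; ring⟩

theorem convex_planeBox {X Y : Set ℝ} (hX : X.OrdConnected) (hY : Y.OrdConnected) :
    Convex ℝ (planeBox X Y) := fun _ hz _ hw _ _ ha hb hab =>
  ⟨hX.convex hz.1 hw.1 ha hb hab, hY.convex hz.2 hw.2 ha hb hab⟩

namespace SmoothOn

variable {X Y P Φ : Set ℝ} {Q : (Fin 3 → ℝ) → ℝ} {ρ : (Fin 4 → ℝ) → ℝ}
  (H : SmoothOn X Y P Φ Q) {i : ℝ} (hi : i ≠ 0)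

theorem d_exp {f g : smoothFn (fefBox X Y P Φ)} {ε κ : ℝ}
    (h : ∀ z, f.1 z = ε * Real.exp (κ * g.1 z)) (k : Fin 4) :
    (H.jet i).d k f = κ • ((H.jet i).d k g * f) := by
  change scaleT i k • der H.openM k f = κ • ((scaleT i k • der H.openM k g) * f)
  rw [der_exp H.openM h]
  algebra

include hi in
/-- The Einstein scales of the first kind, with the phase removed. -/
theorem isPlus_mul_phase_iff {f : smoothFn (fefBox X Y P Φ)} (hf : (H.jet i).d 3 f = 0) :
    (H.jet i).IsPlus (f * phase X Y P Φ (i / 3)) ↔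
      (H.jet i).d 2 ((H.jet i).d 2 f) = 0 ∧
        (H.jet i).D f = (1 / 3 : ℝ) • ((H.jet i).d 2 (H.jet i).Q * f) := by
  have h3 : 3 * (i / 3) / (2 * i) = 1 / 2 := by field_simp
  have hcancel : ∀ g : smoothFn (fefBox X Y P Φ), g * phase X Y P Φ (i / 3) = 0 → g = 0 :=
    fun g hg => by
      have := congrArg (· * phase X Y P Φ (-(i / 3))) hg
      simpa only [mul_assoc, phase_mul, add_neg_cancel, phase_zero, mul_one, zero_mul] using this
  have h22 : (H.jet i).d 2 ((H.jet i).d 2 (f * phase X Y P Φ (i / 3)))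
      = (H.jet i).d 2 ((H.jet i).d 2 f) * phase X Y P Φ (i / 3) := by
    simp only [Derivation.leibniz, d2_phase, smul_eq_mul, mul_zero, zero_mul, add_zero,
      zero_add, mul_comm]
  have hD : (H.jet i).D (f * phase X Y P Φ (i / 3))
      - (1 / 3 : ℝ) • ((H.jet i).d 2 (H.jet i).Q * (f * phase X Y P Φ (i / 3)))
      = ((H.jet i).D f - (1 / 3 : ℝ) • ((H.jet i).d 2 (H.jet i).Q * f)) * phase X Y P Φ (i / 3) := by
    rw [JetAlgebra.D_mul, D_phase]; algebra
  constructor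
  · intro h
    refine ⟨hcancel _ (by rw [← h22, h.d22]), sub_eq_zero.1 (hcancel _ ?_)⟩
    rw [← hD, h.D, sub_self]
  · rintro ⟨h1, h2⟩
    refine ⟨?_, by rw [h22, h1, zero_mul], sub_eq_zero.1 ?_⟩
    · rw [Derivation.leibniz, H.d3_phase hi, hf, h3, smul_zero, add_zero, smul_eq_mul]; algebra
    · rw [hD, h2, sub_self, zero_mul]

include hi in
/-- Einstein metrics with `ρ = A(x, y, p) e^{-iφ/3}` in terms of `1 / A`. -/
theorem einstein_phase_iff (hc : Convex ℝ (fefBox X Y P Φ)) (hΦ : Φ.Nonempty)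
    {r s : smoothFn (fefBox X Y P Φ)} (hr : ∀ z : fefBox X Y P Φ, ρ z = r.1 z) (hrs : r * s = 1) :
    ((∃ Λ : ℝ, EinsteinOn (gF i Q ρ) Λ (fefBox X Y P Φ)) ∧ HasPhase X Y P Φ (-(i / 3)) ρ) ↔
      ∃ f, s = f * phase X Y P Φ (i / 3) ∧ (H.jet i).d 3 f = 0 ∧
        (H.jet i).d 2 ((H.jet i).d 2 f) = 0 ∧
        (H.jet i).D f = (1 / 3 : ℝ) • ((H.jet i).d 2 (H.jet i).Q * f) := by
  have h3 : 3 * -(i / 3) / (2 * i) = -(1 / 2) := by field_simp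
  constructor
  · rintro ⟨⟨Λ, hE⟩, hph⟩
    rw [H.hasPhase_neg_iff hi hc hΦ hr hrs] at hph
    have hp := (H.isPlus_isMinus_of_einstein hi hr hrs hE).1
    rw [JetAlgebra.plus, hph, ← add_smul, add_halves, one_smul] at hp
    have hs : s = s * phase X Y P Φ (-(i / 3)) * phase X Y P Φ (i / 3) := by
      rw [mul_assoc, phase_mul, neg_add_cancel, phase_zero, mul_one]
    have hf : (H.jet i).d 3 (s * phase X Y P Φ (-(i / 3))) = 0 := by
      rw [Derivation.leibniz, hph, H.d3_phase hi, h3]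
      simp only [smul_eq_mul]; algebra
    exact ⟨_, hs, hf, (H.isPlus_mul_phase_iff hi hf).1 (by rwa [← hs])⟩
  · rintro ⟨f, hs, hf, h⟩
    have hp := (H.isPlus_mul_phase_iff hi hf).2 h
    rw [← hs] at hp
    refine ⟨⟨0, fun z hz b e => ?_⟩, (H.hasPhase_neg_iff hi hc hΦ hr hrs).2 hp.d3⟩
    rw [H.ricciFlat hi hr hrs (Or.inl hp) z hz, zero_mul]

end SmoothOn

/-! ### The two explicit families -/

open smoothFn

namespace SmoothOn

variable {X Y P Φ : Set ℝ} {Q : (Fin 3 → ℝ) → ℝ} {ρ : (Fin 4 → ℝ) → ℝ}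
  (H : SmoothOn X Y P Φ Q) {i : ℝ} (hi : i ≠ 0)

theorem eq_scale_iff {x ε a u i t : ℝ} (hε : ε = 1 ∨ ε = -1) (hu : u ≠ 0) :
    x = ε * (Real.exp (-(2 / 3) * a) / u) * Real.exp (-(i * t / 3)) ↔
      x * (ε * Real.exp (2 / 3 * a) * u * Real.exp (i / 3 * t)) = 1 := by
  have hε2 : ε * ε = 1 := by rcases hε with rfl | rfl <;> norm_num
  have hε0 : ε ≠ 0 := left_ne_zero_of_mul_eq_one hε2
  have h1 := Real.exp_ne_zero (2 / 3 * a)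
  have h2 := Real.exp_ne_zero (i / 3 * t)
  rw [neg_mul, Real.exp_neg, Real.exp_neg, show i * t / 3 = i / 3 * t by ring]
  generalize Real.exp (2 / 3 * a) = E at *
  generalize Real.exp (i / 3 * t) = e at *
  constructor
  · rintro rfl
    field_simp
    linear_combination hε2
  · intro h
    field_simp
    linear_combination ε * h - x * E * u * e * hε2

theorem contDiffOn_signed_exp {ε : ℝ} {a : (Fin 2 → ℝ) → ℝ}
    (ha : ContDiffOn ℝ ∞ a (planeBox X Y)) :
    ContDiffOn ℝ ∞ (fun q => ε * Real.exp (2 / 3 * a q)) (planeBox X Y) :=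
  contDiffOn_const.mul (contDiffOn_const.mul ha).exp

theorem d_signed_exp {ε : ℝ} {a : (Fin 2 → ℝ) → ℝ} (ha : ContDiffOn ℝ ∞ a (planeBox X Y))
    (k : Fin 4) : (H.jet i).d k (liftB P Φ (contDiffOn_signed_exp (ε := ε) ha))
      = (2 / 3 : ℝ) • ((H.jet i).d k (liftB P Φ ha) * liftB P Φ (contDiffOn_signed_exp (ε := ε) ha)) :=
  H.d_exp (fun _ => rfl) k

/-- The `p`-derivative of `ρ` in terms of the scale. -/
theorem pd_two_eq (i : ℝ) {r s f : smoothFn (fefBox X Y P Φ)}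
    (hr : ∀ z : fefBox X Y P Φ, ρ z = r.1 z) (hrs : r * s = 1) {κ : ℝ}
    (hs : s = f * phase X Y P Φ κ) (z : fefBox X Y P Φ) :
    pd 2 ρ z = -(ρ z ^ 2 * (((H.jet i).d 2 f).1 z * Real.exp (κ * z.1 3))) := by
  have h1 : (H.jet i).d 2 s = (H.jet i).d 2 f * phase X Y P Φ κ := by
    rw [hs, Derivation.leibniz, d2_phase, smul_zero, zero_add, smul_eq_mul, mul_comm]
  rw [pd_eq_der H.openM hr 2 z, der_inv H.openM (by rw [mul_comm, hrs] : s * r = 1), ← H.d2 i, h1,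
    hr]
  rfl

theorem firstQ_lift {a b c : (Fin 2 → ℝ) → ℝ} (ha : ContDiffOn ℝ ∞ a (planeBox X Y))
    (hb : ContDiffOn ℝ ∞ b (planeBox X Y)) (hc : ContDiffOn ℝ ∞ c (planeBox X Y))
    (z : fefBox X Y P Φ) :
    (JetAlgebra.firstQ (H.jet i).p ((H.jet i).d 0 (liftB P Φ ha)) ((H.jet i).d 1 (liftB P Φ ha))
      (liftB P Φ hb) ((H.jet i).d 0 (liftB P Φ hb)) ((H.jet i).d 1 (liftB P Φ hb))
      (liftB P Φ hc)).1 z = JetAlgebra.firstQ (toJet z 2) (pd 0 a (toPlane (toJet z)))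
        (pd 1 a (toPlane (toJet z))) (b (toPlane (toJet z))) (pd 0 b (toPlane (toJet z)))
        (pd 1 b (toPlane (toJet z))) (c (toPlane (toJet z))) := by
  rw [d0_liftB, d1_liftB, d0_liftB, d1_liftB]; rfl

-- After removing the phase, `1/ρ` is `f = a₁ p + a₀` with coefficients in `(x, y)`. Since `ρ_p` is
-- a nonvanishing multiple of `a₁`, the condition `ρ_p ≠ 0` permits `a₁ = ε e^{2a/3}` and `f = a₁(p
-- + 2b)`; then `D f = Q_p f/3` determines `Q` up to its cubic coefficient.
include H hi in
theorem firstFamily_iff (hc : Convex ℝ (fefBox X Y P Φ)) (hcB : Convex ℝ (planeBox X Y))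
    (hP : P.Nonempty) (hΦ : Φ.Nonempty) (hρ : ContDiffOn ℝ ∞ ρ (fefBox X Y P Φ))
    (h0 : ∀ z ∈ fefBox X Y P Φ, ρ z ≠ 0) :
    ((∃ Λ : ℝ, EinsteinOn (gF i Q ρ) Λ (fefBox X Y P Φ)) ∧ HasPhase X Y P Φ (-(i / 3)) ρ ∧
      (∀ z ∈ fefBox X Y P Φ, pd 2 ρ z ≠ 0)) ↔ IsFirstFamily X Y P Φ i Q ρ := by
  obtain ⟨r, s, hr, hrs⟩ := exists_inverse hρ h0
  obtain ⟨p₀, hp₀⟩ := hP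
  obtain ⟨φ₀, hφ₀⟩ := hΦ
  have hrs' : ∀ z : fefBox X Y P Φ, ρ z * s.1 z = 1 := fun z => by
    rw [hr, ← smoothFn.mul_apply, hrs]; rfl
  rw [← and_assoc, H.einstein_phase_iff hi hc ⟨_, hφ₀⟩ hr hrs]
  constructor
  · rintro ⟨⟨f, hs, hf3, hf22, hfD⟩, hρp⟩
    have hw2 : (H.jet i).w2 = 0 := by
      have h := ((H.isPlus_mul_phase_iff hi hf3).2 ⟨hf22, hfD⟩).w2_mul
      rw [← hs] at h
      linear_combination r * h - (H.jet i).w2 * hrs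
    obtain ⟨a₁, ha₁, hfa₁⟩ := H.exists_liftB hc ⟨_, hp₀⟩ ⟨_, hφ₀⟩ (f := (H.jet i).d 2 f)
      (by rw [← H.d2 i, hf22])
      (by rw [(H.d3_eq_iff hi _ 0).1 (by rw [(H.jet i).comm, hf3, map_zero]), smul_zero])
    have hne : ∀ q ∈ planeBox X Y, a₁ q ≠ 0 := fun q hq h => by
      have hz : ofJet φ₀ (ofPlane p₀ q) ∈ fefBox X Y P Φ := ofJet_mem hφ₀ (ofPlane_mem hp₀ hq)
      refine hρp _ hz ?_
      rw [H.pd_two_eq i hr hrs hs ⟨_, hz⟩, hfa₁, liftB_apply, toJet_ofJet, toPlane_ofPlane, h]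
      ring
    obtain ⟨ε, a, hε, ha, haa⟩ := exists_log hcB ha₁ hne
    obtain ⟨a₀, ha₀, hfa₀⟩ := H.exists_liftB hc ⟨_, hp₀⟩ ⟨_, hφ₀⟩
      (f := f - (H.jet i).p * (H.jet i).d 2 f)
      (by
        rw [← H.d2 i, map_sub, Derivation.leibniz, (H.jet i).d2_p, hf22]
        simp only [smul_eq_mul]; ring)
      (by
        rw [(H.d3_eq_iff hi _ 0).1, smul_zero]
        rw [map_sub, Derivation.leibniz, (H.jet i).d3_p, (H.jet i).comm 3 2, hf3, map_zero]
        simp)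
    -- `b = a₀/(2a₁)`, so that `a₁ p + a₀ = a₁(p + 2b)`.
    have hb : ContDiffOn ℝ ∞ (fun q => a₀ q / (2 * a₁ q)) (planeBox X Y) :=
      ha₀.div (contDiffOn_const.mul ha₁) fun q hq => mul_ne_zero two_ne_zero (hne q hq)
    -- `c = Q_ppp/6` is a function of `(x, y)` because `w₂ = 0`, which holds as the scale is
    -- invertible.
    obtain ⟨c, hcs, hcc⟩ := H.exists_liftB hc ⟨_, hp₀⟩ ⟨_, hφ₀⟩
      (f := (1 / 6 : ℝ) • (H.jet i).d 2 ((H.jet i).d 2 ((H.jet i).d 2 (H.jet i).Q)))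
      (by
        rw [← H.d2 i, Derivation.map_smul]
        exact (congrArg _ hw2).trans (smul_zero _))
      (by
        rw [(H.d3_eq_iff hi _ 0).1, smul_zero]
        rw [Derivation.map_smul, (H.jet i).comm 3 2, (H.jet i).comm 3 2, (H.jet i).comm 3 2,
          (H.jet i).d3_Q]
        simp)
    have hfA : f = liftB P Φ (contDiffOn_signed_exp (ε := ε) ha)
        * ((H.jet i).p + 2 * liftB P Φ hb) := smoothFn.ext fun z => by
      have h1 := congrArg (fun f => f.1 z) hfa₀
      have hz := toPlane_mem (toJet_mem z.2)
      simp only [smoothFn.sub_apply, smoothFn.mul_apply, hfa₁, liftB_apply] at h1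
      have h2 : (liftB P Φ (contDiffOn_signed_exp (ε := ε) ha)).1 z = a₁ (toPlane (toJet z)) :=
        (haa _ hz).symm
      rw [smoothFn.mul_apply, h2]
      change f.1 z = a₁ (toPlane (toJet z)) * ((H.jet i).p.1 z
        + 2 * (a₀ (toPlane (toJet z)) / (2 * a₁ (toPlane (toJet z)))))
      have := hne _ hz
      rw [← h1]
      field_simp
      ring
    have hsz : ∀ z : fefBox X Y P Φ, s.1 z = ε * Real.exp (2 / 3 * a (toPlane (toJet z)))
        * (z.1 2 + 2 * (a₀ (toPlane (toJet z)) / (2 * a₁ (toPlane (toJet z)))))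
        * Real.exp (i / 3 * z.1 3) := fun z => by
      rw [hs, hfA]; rfl
    have hu : ∀ z ∈ fefBox X Y P Φ,
        z 2 + 2 * (a₀ (toPlane (toJet z)) / (2 * a₁ (toPlane (toJet z)))) ≠ 0 := fun z hz h => by
      have := hrs' ⟨z, hz⟩
      rw [hsz, h] at this
      simp at this
    refine ⟨ε, a, _, c, hε, ha, hb, hcs, fun q hq => ?_, fun z hz => ?_, fun q hq => ?_⟩
    · have := hu _ (ofJet_mem hφ₀ hq)
      rwa [toJet_ofJet] at this
    · rw [eq_scale_iff hε (hu z hz), ← hsz ⟨z, hz⟩]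
      exact hrs' ⟨z, hz⟩
    · have hA : liftB P Φ (contDiffOn_signed_exp (ε := ε) (ha.neg))
          * liftB P Φ (contDiffOn_signed_exp (ε := ε) ha) = 1 := smoothFn.ext fun z => by
        have hε2 : ε * ε = 1 := by rcases hε with rfl | rfl <;> norm_num
        change ε * Real.exp (2 / 3 * -a _) * (ε * Real.exp (2 / 3 * a _)) = 1
        rw [mul_neg, Real.exp_neg]
        have := Real.exp_ne_zero (2 / 3 * a (toPlane (toJet z)))
        field_simp
        linear_combination hε2
      have hQ := JetAlgebra.eq_firstQ (J := H.jet i) (fun k => H.d_signed_exp ha k)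
        (H.d2_liftB ha) (H.d2_liftB hb) hA (by rw [← hfA, hfD])
      rw [hcc] at hQ
      have h1 := congrArg (fun f => f.1 ⟨_, ofJet_mem hφ₀ hq⟩) hQ
      simp only [firstQ_lift, toJet_ofJet] at h1
      refine Eq.trans ?_ h1
      change Q q = Q (toJet (ofJet φ₀ q))
      rw [toJet_ofJet]
  · rintro ⟨ε, a, b, c, hε, ha, hb, hcs, hu, hρf, hQ⟩
    have hε0 : ε ≠ 0 := by rcases hε with rfl | rfl <;> norm_num
    have hs : s = liftB P Φ (contDiffOn_signed_exp (ε := ε) ha)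
        * ((H.jet i).p + 2 * liftB P Φ hb) * phase X Y P Φ (i / 3) := smoothFn.ext fun z => by
      have h1 := (eq_scale_iff hε (hu _ (toJet_mem z.2))).1 (hρf z z.2)
      exact mul_left_cancel₀ (h0 z z.2) ((hrs' z).trans h1.symm)
    have hd2 : (H.jet i).d 2 (liftB P Φ (contDiffOn_signed_exp (ε := ε) ha)
        * ((H.jet i).p + 2 * liftB P Φ hb)) = liftB P Φ (contDiffOn_signed_exp (ε := ε) ha) := by
      rw [Derivation.leibniz, map_add, Derivation.leibniz, d2_liftB, d2_liftB, (H.jet i).d2_p,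
        (H.jet i).d_ofNat]
      simp
    refine ⟨⟨_, hs, ?_, ?_, ?_⟩, fun z hz => ?_⟩
    · rw [Derivation.leibniz, map_add, Derivation.leibniz, d3_liftB, d3_liftB, (H.jet i).d3_p,
        (H.jet i).d_ofNat]
      simp
    · rw [hd2, d2_liftB]
    · refine JetAlgebra.D_of_firstQ (fun k => H.d_signed_exp ha k) (H.d2_liftB ha) (H.d2_liftB hb)
        (H.d2_liftB hcs) (smoothFn.ext fun z => ?_)
      rw [firstQ_lift]
      exact hQ (toJet z) (toJet_mem z.2)
    · rw [H.pd_two_eq i hr hrs hs ⟨z, hz⟩, hd2]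
      exact neg_ne_zero.2 (mul_ne_zero (pow_ne_zero 2 (h0 z hz)) (mul_ne_zero
        (mul_ne_zero hε0 (Real.exp_ne_zero _)) (Real.exp_ne_zero _)))

-- Here `f` is independent of `p`, so `f = ε e^{2a/3}`, and `D f = Q_p f/3` says `Q_p = 2a_x + 2p
-- a_y`. The function `b` is the constant of integration in `p`.
include H hi in
theorem secondFamily_iff (hc : Convex ℝ (fefBox X Y P Φ)) (hcB : Convex ℝ (planeBox X Y))
    (hP : P.Nonempty) (hΦ : Φ.Nonempty) (hρ : ContDiffOn ℝ ∞ ρ (fefBox X Y P Φ))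
    (h0 : ∀ z ∈ fefBox X Y P Φ, ρ z ≠ 0) :
    ((∃ Λ : ℝ, EinsteinOn (gF i Q ρ) Λ (fefBox X Y P Φ)) ∧ HasPhase X Y P Φ (-(i / 3)) ρ ∧
      (∀ z ∈ fefBox X Y P Φ, pd 2 ρ z = 0)) ↔ IsSecondFamily X Y P Φ i Q ρ := by
  obtain ⟨r, s, hr, hrs⟩ := exists_inverse hρ h0
  obtain ⟨p₀, hp₀⟩ := hP
  obtain ⟨φ₀, hφ₀⟩ := hΦ
  have hrs' : ∀ z : fefBox X Y P Φ, ρ z * s.1 z = 1 := fun z => by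
    rw [hr, ← smoothFn.mul_apply, hrs]; rfl
  rw [← and_assoc, H.einstein_phase_iff hi hc ⟨_, hφ₀⟩ hr hrs]
  constructor
  · rintro ⟨⟨f, hs, hf3, hf22, hfD⟩, hρp⟩
    have hf2 : (H.jet i).d 2 f = 0 := smoothFn.ext fun z => by
      have h1 := hρp z z.2
      rw [H.pd_two_eq i hr hrs hs z] at h1
      simpa [h0 z z.2, Real.exp_ne_zero] using h1
    obtain ⟨a₁, ha₁, hfa₁⟩ := H.exists_liftB hc ⟨_, hp₀⟩ ⟨_, hφ₀⟩ (f := f)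
      (by rw [← H.d2 i, hf2]) (by rw [(H.d3_eq_iff hi _ 0).1 hf3, smul_zero])
    have hne : ∀ q ∈ planeBox X Y, a₁ q ≠ 0 := fun q hq h => by
      have hz : ofJet φ₀ (ofPlane p₀ q) ∈ fefBox X Y P Φ := ofJet_mem hφ₀ (ofPlane_mem hp₀ hq)
      have h1 := hrs' ⟨_, hz⟩
      rw [hs, hfa₁, smoothFn.mul_apply, liftB_apply, toJet_ofJet, toPlane_ofPlane, h] at h1
      simp at h1
    obtain ⟨ε, a, hε, ha, haa⟩ := exists_log hcB ha₁ hne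
    have hε2 : ε * ε = 1 := by rcases hε with rfl | rfl <;> norm_num
    have hfA : f = liftB P Φ (contDiffOn_signed_exp (ε := ε) ha) := by
      rw [hfa₁]
      exact smoothFn.ext fun z => haa _ (toPlane_mem (toJet_mem z.2))
    have hA : liftB P Φ (contDiffOn_signed_exp (ε := ε) (ha.neg)) * f = 1 :=
      smoothFn.ext fun z => by
        rw [hfA]
        change ε * Real.exp (2 / 3 * -a _) * (ε * Real.exp (2 / 3 * a _)) = 1
        rw [mul_neg, Real.exp_neg]
        have := Real.exp_ne_zero (2 / 3 * a (toPlane (toJet z)))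
        field_simp
        linear_combination hε2
    have hQp : (H.jet i).d 2 (H.jet i).Q
        = 2 * (H.jet i).d 0 (liftB P Φ ha) + 2 * (H.jet i).p * (H.jet i).d 1 (liftB P Φ ha) := by
      have h1 := hfD
      rw [hfA, JetAlgebra.D_secondScale (fun k => H.d_signed_exp ha k) (H.d2_liftB ha), ← hfA] at h1
      linear_combination (norm := algebra) -(3 : ℝ) • (liftB P Φ
        (contDiffOn_signed_exp (ε := ε) (ha.neg)) * h1) - ((H.jet i).d 2 (H.jet i).Q
          - 2 * (H.jet i).d 0 (liftB P Φ ha) - 2 * (H.jet i).p * (H.jet i).d 1 (liftB P Φ ha)) * hA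
    have hp2 : ∀ f : smoothFn (fefBox X Y P Φ), (H.jet i).d 2 f = 0 → ∀ k,
        (H.jet i).d 2 ((H.jet i).d k f) = 0 := fun f hf k => by rw [(H.jet i).comm, hf, map_zero]
    have hp3 : ∀ f : smoothFn (fefBox X Y P Φ), (H.jet i).d 3 f = 0 → ∀ k,
        (H.jet i).d 3 ((H.jet i).d k f) = 0 := fun f hf k => by rw [(H.jet i).comm, hf, map_zero]
    obtain ⟨b, hb, hbb⟩ := H.exists_liftB hc ⟨_, hp₀⟩ ⟨_, hφ₀⟩
      (f := (H.jet i).Q - (H.jet i).p ^ 2 * (H.jet i).d 1 (liftB P Φ ha)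
        - 2 * (H.jet i).p * (H.jet i).d 0 (liftB P Φ ha))
      (by
        rw [← H.d2 i]
        simp only [map_sub, Derivation.leibniz, sq, hQp, hp2 _ (H.d2_liftB ha), (H.jet i).d2_p,
          (H.jet i).d_ofNat, smul_eq_mul]
        ring)
      (by
        rw [(H.d3_eq_iff hi _ 0).1, smul_zero]
        simp only [map_sub, Derivation.leibniz, sq, hp3 _ (H.d3_liftB ha), (H.jet i).d3_p,
          (H.jet i).d3_Q, (H.jet i).d_ofNat, smul_eq_mul]
        ring)
    refine ⟨ε, a, b, hε, ha, hb, fun z hz => ?_, fun q hq => ?_⟩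
    · have h1 := hrs' ⟨z, hz⟩
      -- The formula for the first family is reused with `p + 2b` replaced by 1.
      rw [← div_one (Real.exp (-(2 / 3) * a (toPlane (toJet z)))), eq_scale_iff hε one_ne_zero,
        mul_one]
      rw [hs, hfA] at h1
      exact h1
    · rw [d0_liftB, d1_liftB] at hbb
      have h1 := congrArg (fun f => f.1 ⟨_, ofJet_mem hφ₀ hq⟩) hbb
      change Q (toJet (ofJet φ₀ q)) - q 2 ^ 2 * pd 1 a (toPlane (toJet (ofJet φ₀ q)))
        - 2 * q 2 * pd 0 a (toPlane (toJet (ofJet φ₀ q))) = b (toPlane (toJet (ofJet φ₀ q))) at h1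
      rw [toJet_ofJet] at h1
      linear_combination h1
  · rintro ⟨ε, a, b, hε, ha, hb, hρf, hQ⟩
    have hs : s = liftB P Φ (contDiffOn_signed_exp (ε := ε) ha) * phase X Y P Φ (i / 3) :=
      smoothFn.ext fun z => by
        have h1 := hρf z z.2
        rw [← div_one (Real.exp (-(2 / 3) * a (toPlane (toJet z)))), eq_scale_iff hε one_ne_zero,
          mul_one] at h1
        exact mul_left_cancel₀ (h0 z z.2) ((hrs' z).trans h1.symm)
    refine ⟨⟨_, hs, H.d3_liftB _, ?_, ?_⟩, fun z hz => ?_⟩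
    · rw [d2_liftB, map_zero]
    · have hQ' : (H.jet i).Q = (H.jet i).p * (H.jet i).p * (H.jet i).d 1 (liftB P Φ ha)
          + 2 * (H.jet i).p * (H.jet i).d 0 (liftB P Φ ha) + liftB P Φ hb := by
        rw [d0_liftB, d1_liftB]
        refine smoothFn.ext fun z => (hQ (toJet z) (toJet_mem z.2)).trans ?_
        rw [sq]; rfl
      rw [JetAlgebra.D_secondScale (fun k => H.d_signed_exp ha k) (H.d2_liftB ha), hQ']
      simp only [map_add, Derivation.leibniz, d0_liftB, d1_liftB, d2_liftB, (H.jet i).d2_p,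
        (H.jet i).d_ofNat, smul_eq_mul]
      algebra
    · rw [H.pd_two_eq i hr hrs hs ⟨z, hz⟩, d2_liftB, smoothFn.zero_apply]
      ring

end SmoothOn

end Fefferman

end

/-! ### Assembly of the theorem -/

theorem mainTheorem4 (i : ℝ) (hi : i ≠ 0) (X Y P Φ : Set ℝ)
    (hX : IsOpen X ∧ X.OrdConnected ∧ X.Nonempty) (hY : IsOpen Y ∧ Y.OrdConnected ∧ Y.Nonempty)
    (hP : IsOpen P ∧ P.OrdConnected ∧ P.Nonempty) (hΦ : IsOpen Φ ∧ Φ.OrdConnected ∧ Φ.Nonempty)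
    (Q : (Fin 3 → ℝ) → ℝ) (hQ : ContDiffOn ℝ ∞ Q (Fefferman.jetBox X Y P)) :
    (∀ ρ : (Fin 4 → ℝ) → ℝ, ContDiffOn ℝ ∞ ρ (Fefferman.fefBox X Y P Φ) →
      (∀ z ∈ Fefferman.fefBox X Y P Φ, ρ z ≠ 0) →
      -- an Einstein metric is in one of the three cases
      ((∃ Λ : ℝ, Fefferman.EinsteinOn (Fefferman.gF i Q ρ) Λ (Fefferman.fefBox X Y P Φ)) →
        (∀ z ∈ Fefferman.fefBox X Y P Φ,
          (3 * Fefferman.pd 3 ρ z - i * ρ z) * Fefferman.w₂ Q (Fefferman.toJet z) = 0 ∧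
          (3 * Fefferman.pd 3 ρ z + i * ρ z) * Fefferman.w₁ Q (Fefferman.toJet z) = 0) ∧
        (((∀ z ∈ Fefferman.jetBox X Y P, Fefferman.w₁ Q z = 0) ∧
            (∀ z ∈ Fefferman.jetBox X Y P, Fefferman.w₂ Q z = 0)) ∨
          ((∀ z ∈ Fefferman.jetBox X Y P, Fefferman.w₂ Q z = 0) ∧
            (∃ z ∈ Fefferman.jetBox X Y P, Fefferman.w₁ Q z ≠ 0) ∧
            Fefferman.HasPhase X Y P Φ (-(i / 3)) ρ) ∨
          ((∃ z ∈ Fefferman.jetBox X Y P, Fefferman.w₂ Q z ≠ 0) ∧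
            (∀ z ∈ Fefferman.jetBox X Y P, Fefferman.w₁ Q z = 0) ∧
            Fefferman.HasPhase X Y P Φ (i / 3) ρ))) ∧
      -- the case `w₁ = w₂ = 0`
      ((∀ z ∈ Fefferman.jetBox X Y P, Fefferman.w₁ Q z = 0) →
        (∀ z ∈ Fefferman.jetBox X Y P, Fefferman.w₂ Q z = 0) →
        Fefferman.ConformallyFlatOn (Fefferman.gF i Q ρ) (Fefferman.fefBox X Y P Φ)) ∧
      -- the case `ρ = A e^{-iφ/3}`
      (((∃ Λ : ℝ, Fefferman.EinsteinOn (Fefferman.gF i Q ρ) Λ (Fefferman.fefBox X Y P Φ)) ∧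
          Fefferman.HasPhase X Y P Φ (-(i / 3)) ρ ∧
          (∀ z ∈ Fefferman.fefBox X Y P Φ, Fefferman.pd 2 ρ z ≠ 0)) ↔
        Fefferman.IsFirstFamily X Y P Φ i Q ρ) ∧
      (((∃ Λ : ℝ, Fefferman.EinsteinOn (Fefferman.gF i Q ρ) Λ (Fefferman.fefBox X Y P Φ)) ∧
          Fefferman.HasPhase X Y P Φ (-(i / 3)) ρ ∧
          (∀ z ∈ Fefferman.fefBox X Y P Φ, Fefferman.pd 2 ρ z = 0)) ↔
        Fefferman.IsSecondFamily X Y P Φ i Q ρ) ∧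
      -- the case `ρ = A e^{iφ/3}`
      (((∃ Λ : ℝ, Fefferman.EinsteinOn (Fefferman.gF i Q ρ) Λ (Fefferman.fefBox X Y P Φ)) ∧
          Fefferman.HasPhase X Y P Φ (i / 3) ρ) ↔
        ∃ a : (Fin 2 → ℝ) → ℝ, ContDiffOn ℝ ∞ a (Fefferman.planeBox X Y) ∧
          (∀ z ∈ Fefferman.fefBox X Y P Φ,
            ρ z = a (Fefferman.toPlane (Fefferman.toJet z)) * Real.exp (i * z 3 / 3)) ∧
          Fefferman.ScaleEquation X Y P Q a) ∧
      -- Ricci flatness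
      ((∃ Λ : ℝ, Fefferman.EinsteinOn (Fefferman.gF i Q ρ) Λ (Fefferman.fefBox X Y P Φ)) →
        (Fefferman.HasPhase X Y P Φ (-(i / 3)) ρ ∨ Fefferman.HasPhase X Y P Φ (i / 3) ρ ∨
          ¬ Fefferman.ConformallyFlatOn (Fefferman.gF i Q ρ) (Fefferman.fefBox X Y P Φ)) →
        Fefferman.RicciFlatOn (Fefferman.gF i Q ρ) (Fefferman.fefBox X Y P Φ))) ∧
    -- `w₁ = 0` is an integrability condition of the equation for `a`
    (∀ a : (Fin 2 → ℝ) → ℝ, ContDiffOn ℝ ∞ a (Fefferman.planeBox X Y) →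
      (∀ q ∈ Fefferman.planeBox X Y, a q ≠ 0) → Fefferman.ScaleEquation X Y P Q a →
      ∀ z ∈ Fefferman.jetBox X Y P, Fefferman.w₁ Q z = 0) := by
  have H : Fefferman.SmoothOn X Y P Φ Q := ⟨hX.1, hY.1, hP.1, hΦ.1, hQ⟩
  have hc := Fefferman.convex_fefBox hX.2.1 hY.2.1 hP.2.1 hΦ.2.1
  have hcB := Fefferman.convex_planeBox hX.2.1 hY.2.1
  have hne : (Fefferman.fefBox X Y P Φ).Nonempty := by
    obtain ⟨⟨-, -, x, hx⟩, ⟨-, -, y, hy⟩, ⟨-, -, p, hp⟩, ⟨-, -, φ, hφ⟩⟩ := And.intro hX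
      (And.intro hY (And.intro hP hΦ))
    exact ⟨![x, y, p, φ], hx, hy, hp, hφ⟩
  refine ⟨fun ρ hρ h0 => ⟨fun ⟨Λ, hE⟩ => H.einstein_cases hi hc hne hρ h0 hE,
    H.conformallyFlat hi hc hρ h0, H.firstFamily_iff hi hc hcB hP.2.2 hΦ.2.2 hρ h0,
    H.secondFamily_iff hi hc hcB hP.2.2 hΦ.2.2 hρ h0, H.scale_iff hi hc hP.2.2 hΦ.2.2 hρ h0,
    fun ⟨Λ, hE⟩ h => H.ricciFlat_of_einstein hi hc hne hρ h0 hE h⟩,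
    fun a ha h0 hS => H.w₁_eq_zero_of_scaleEquation ha hΦ.2.2 h0 hS⟩
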